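/- **Setting.** Let $Y$ be a Noetherian separated scheme and let $\mathcal{A}=\bigoplus_{i\in\mathbb{Z}}\mathcal{A}_i$ be a quasi-coherent sheaf of commutative $\mathbb{Z}$-graded $\mathcal{O}_Y$-algebras such that $\mathcal{A}(U)$ is a Noetherian ring for every affine open $U\subset Y$ and $\mathcal{A}_0$ is coherent over $\mathcal{O}_Y$. Let $\mathrm{Gr}(\mathcal{A})$ be the category of quasi-coherent graded $\mathcal{A}$-modules (with degree $0$ morphisms) and $\mathcal{D}(\mathrm{Gr}(\mathcal{A}))$ its derived category. For $\mathcal{M}\in\mathcal{D}(\mathrm{Gr}(\mathcal{A}))$ write $\mathcal{M}_i\in\mathcal{D}(\mathrm{QCoh}(Y))$ for the weight $i$ component, and let $\mathcal{M}(a)$ be the twist $\mathcal{M}(a)_i=\mathcal{M}_{i+a}$. A map in $\mathcal{D}(\mathrm{Gr}(\mathcal{A}))$ is a quasi-isomorphism in weight $i$ if it induces isomorphisms on the weight $i$ components of all cohomology sheaves. Let $I^+=\mathcal{A}_{>0}\cdot\mathcal{A}$ and $I^-=\mathcal{A}_{<0}\cdot\mathcal{A}$. For $I=I^{\pm}$ let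 ${\bm R}\Gamma_I$ be the right derived functor of the functor sending a graded module to its submodule of sections locally killed by a power of $I$, and let $\check{\mathcal{C}}_I(\mathcal{A})$ be the Čech complex, that is, the third vertex of the local cohomology triangle $${\bm R}\Gamma_I(\mathcal{A})\to\mathcal{A}\xrightarrow{\ \eta\ }\check{\mathcal{C}}_I(\mathcal{A})\to{\bm R}\Gamma_I(\mathcal{A})[1];$$ write $\eta^{\pm}$ for $\eta$ when $I=I^{\pm}$. Let $\omega$ be a dualizing complex in $\mathcal{D}^b_{\mathrm{coh}}(\mathrm{QCoh}(Y))$. Let $\mathbb{D}_Y={\bm R}\underline{\mathcal{H}om}_{\mathcal{O}_Y}(-,\omega):\mathcal{D}(\mathrm{Gr}(\mathcal{A}))^{\mathrm{op}}\to\mathcal{D}(\mathrm{Gr}(\mathcal{A}))$ be the associated duality functor, with weight components $\mathbb{D}_Y(\mathcal{M})_i={\bm R}\mathcal{H}om_{\mathcal{O}_Y}(\mathcal{M}_{-i},\omega)$; here the internal Hom is taken in quasi-coherent sheaves, i.e. it is the coherator of the sheaf Hom. A *homological flip* (resp. *homological flop*) is a sextuple $(Y,\omega,\mathcal{A},a,\Phi^-,\Phi^+)$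 with $Y,\omega,\mathcal{A}$ as above, $a\in\mathbb{Z}$ with $a>0$ (resp. $a=0$), and maps $$\Phi^{\pm}:\check{\mathcal{C}}_{I^{\pm}}(\mathcal{A})(a)\to\mathbb{D}_Y(\check{\mathcal{C}}_{I^{\pm}}(\mathcal{A}))$$ in $\mathcal{D}(\mathrm{Gr}(\mathcal{A}))$ that are quasi-isomorphisms in all weights and are compatible in the sense that $$\mathbb{D}_Y(\eta^+)\circ\Phi^+\circ\eta^+(a)=\mathbb{D}_Y(\eta^-)\circ\Phi^-\circ\eta^-(a):\ \mathcal{A}(a)\to\mathbb{D}_Y(\mathcal{A}).$$ **Theorem.** Let $(Y,\omega,\mathcal{A},a,\Phi^-,\Phi^+)$ be a homological flip or a homological flop. Then there is a map $$\Psi:{\bm R}\Gamma_{I^+}(\mathcal{A})(a)[1]\to\mathbb{D}_Y({\bm R}\Gamma_{I^-}(\mathcal{A}))\quad\text{in }\mathcal{D}(\mathrm{Gr}(\mathcal{A}))$$ with the following property: whenever $c^+,c^-\in\mathbb{Z}$ are integers such that ${\bm R}\Gamma_{I^+}(\mathcal{A})_i\simeq 0$ for all $i\ge c^+$ and ${\bm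 R}\Gamma_{I^-}(\mathcal{A})_i\simeq 0$ for all $i\le c^-$, the map $\Psi$ is a quasi-isomorphism in every weight $i$ such that $$i\ge\max\{-c^-,\,c^+-a\}\qquad\text{or}\qquad i\le\min\{-c^+,\,c^--a\}.$$ -/

import Mathlib

open CategoryTheory CategoryTheory.Limits AlgebraicGeometry Opposite

universe u

namespace HFF

/-- A quasi-coherent sheaf of commutative `Λ`-graded algebras on the scheme `Y`, described by its
sections on the affine open sets: a graded ring `obj U` with a structure map from `Γ(Y, U)` to the
part of degree zero for each affine open `U`, compatible restriction maps, and the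
quasi-coherence condition that for `f : Γ(Y, U)` the sections on the basic open set `D(f)` are the
localization at `f` of the sections on `U` (surjectivity: `qc_surj`, injectivity: `qc_inj`). -/
structure GradedAlgebra (Y : Scheme.{u}) (Λ : Type) [AddCommGroup Λ] [DecidableEq Λ] where
  obj : Y.affineOpens → Type u
  [commRing : ∀ U, CommRing (obj U)]
  res : ∀ {U V : Y.affineOpens}, V ≤ U → obj U →+* obj V
  res_self : ∀ {U : Y.affineOpens} (h : U ≤ U) (a : obj U), res h a = a
  res_res : ∀ {U V W : Y.affineOpens} (h : V ≤ U) (h' : W ≤ V) (a : obj U),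
    res h' (res h a) = res (h'.trans h) a
  deg : ∀ U : Y.affineOpens, Λ → AddSubgroup (obj U)
  one_mem : ∀ U, (1 : obj U) ∈ deg U 0
  mul_mem : ∀ {U i j} {a b : obj U}, a ∈ deg U i → b ∈ deg U j → a * b ∈ deg U (i + j)
  isInternal : ∀ U, DirectSum.IsInternal (deg U)
  res_mem : ∀ {U V : Y.affineOpens} (h : V ≤ U) {i : Λ} {a : obj U},
    a ∈ deg U i → res h a ∈ deg V i
  str : ∀ U : Y.affineOpens, Γ(Y, U.1) →+* obj U
  str_mem : ∀ (U : Y.affineOpens) (r : Γ(Y, U.1)), str U r ∈ deg U 0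
  res_str : ∀ {U V : Y.affineOpens} (h : V ≤ U) (r : Γ(Y, U.1)),
    res h (str U r) = str V (Y.presheaf.map (homOfLE (show V.1 ≤ U.1 from h)).op r)
  qc_surj : ∀ (U : Y.affineOpens) (f : Γ(Y, U.1)) (y : obj (Y.affineBasicOpen f)),
    ∃ (n : ℕ) (x : obj U), res (Y.affineBasicOpen_le f) x =
      res (Y.affineBasicOpen_le f) (str U f) ^ n * y
  qc_inj : ∀ (U : Y.affineOpens) (f : Γ(Y, U.1)) (x : obj U),
    res (Y.affineBasicOpen_le f) x = 0 → ∃ n : ℕ, str U f ^ n * x = 0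

attribute [instance] GradedAlgebra.commRing

variable {Y : Scheme.{u}} {Λ : Type} [AddCommGroup Λ] [DecidableEq Λ]

/-- The pairs of an affine open set and a degree. They are the objects of a category in which a
morphism `(U, i) ⟶ (V, j)` exists only if `V ⊆ U` and is then a homogeneous section of `A` over `V`
of degree `j - i`. An additive functor from this category to abelian groups is the same thing as a
presheaf, on the affine open sets, of graded `A`-modules. -/
structure Cell (A : GradedAlgebra Y Λ) : Type u where
  U : Y.affineOpens
  i : Λ

namespace Cell
variable {A : GradedAlgebra Y Λ}

/-- The morphisms of cells: restrict to a smaller affine open set, and multiply by a homogeneous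
section. -/
@[ext]
structure Hom (X Z : Cell A) : Type u where
  val : A.obj Z.U
  hle : Z.U ≤ X.U
  mem : val ∈ A.deg Z.U (Z.i - X.i)

instance : SmallCategory (Cell A) where
  Hom X Z := Hom X Z
  id X := ⟨1, le_rfl, by simpa using A.one_mem X.U⟩
  comp f g := ⟨g.val * A.res g.hle f.val, g.hle.trans f.hle, by
    have := A.mul_mem g.mem (A.res_mem g.hle f.mem)
    simpa using this⟩
  id_comp f := by
    apply Hom.ext; simp
  comp_id f := by
    apply Hom.ext; simp [A.res_self]
  assoc f g h := by
    apply Hom.ext; simp [A.res_res, mul_assoc]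

end Cell

namespace Cell
variable {A : GradedAlgebra Y Λ}

@[simp] lemma id_val (X : Cell A) : Hom.val (𝟙 X) = 1 := rfl

@[simp] lemma comp_val {X Z W : Cell A} (f : X ⟶ Z) (g : Z ⟶ W) :
    Hom.val (f ≫ g) = g.val * A.res g.hle f.val := rfl

@[ext] lemma hom_ext {X Z : Cell A} {f g : X ⟶ Z} (h : Hom.val f = Hom.val g) : f = g :=
  Hom.ext h

/-- The restriction from `U` to `V` followed by the multiplication by a function on `V`. -/
def scal {U V : Y.affineOpens} (h : V ≤ U) (r : Γ(Y, V.1)) (i : Λ) :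
    (⟨U, i⟩ : Cell A) ⟶ ⟨V, i⟩ :=
  Hom.mk (A.str V r) h (by simpa using A.str_mem V r)

@[simp] lemma scal_val {U V : Y.affineOpens} (h : V ≤ U) (r : Γ(Y, V.1)) (i : Λ) :
    Hom.val (scal (A := A) h r i) = A.str V r := rfl

end Cell

variable {A : GradedAlgebra Y Λ}

/-- The restriction of functions. -/
abbrev rs {U V : Y.affineOpens} (h : V ≤ U) : Γ(Y, U.1) →+* Γ(Y, V.1) :=
  (Y.presheaf.map (homOfLE (show V.1 ≤ U.1 from h)).op).hom

/-- A presheaf of graded `A`-modules on the affine open sets is (the restriction of) a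
quasi-coherent sheaf of graded `A`-modules if each of its weight components satisfies the
localization condition for all basic open sets. -/
structure IsGrMod (M : Cell A ⥤ AddCommGrpCat.{u}) : Prop where
  map_add : ∀ {X Z : Cell A} (a b c : X ⟶ Z), c.val = a.val + b.val →
    M.map c = M.map a + M.map b
  qc_surj : ∀ (U : Y.affineOpens) (f : Γ(Y, U.1)) (i : Λ)
    (y : M.obj ⟨Y.affineBasicOpen f, i⟩), ∃ (n : ℕ) (x : M.obj ⟨U, i⟩),
      M.map (Cell.scal (Y.affineBasicOpen_le f) 1 i) x =
        M.map (Cell.scal le_rfl (rs (Y.affineBasicOpen_le f) f ^ n) i) y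
  qc_inj : ∀ (U : Y.affineOpens) (f : Γ(Y, U.1)) (i : Λ) (x : M.obj ⟨U, i⟩),
    M.map (Cell.scal (Y.affineBasicOpen_le f) 1 i) x = 0 →
      ∃ n : ℕ, M.map (Cell.scal le_rfl (f ^ n) i) x = 0

variable (A) in
def isGrMod : ObjectProperty (Cell A ⥤ AddCommGrpCat.{u}) := fun M => IsGrMod M


section closure

section general
variable {C : Type*} [Category* C] {D : Type*} [Category* D]

lemma isIso_app_of_isColimit {F G : C ⥤ D} (α : F ⟶ G) {J : Type*} [Category* J]
    [PreservesColimitsOfShape J F] [PreservesColimitsOfShape J G]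
    {K : J ⥤ C} {c : Cocone K} (hc : IsColimit c) (h : ∀ j, IsIso (α.app (K.obj j))) :
    IsIso (α.app c.pt) := by
  have : ∀ j, IsIso ((Functor.whiskerLeft K α).app j) := h
  have : IsIso (Functor.whiskerLeft K α) := NatIso.isIso_of_isIso_app _
  have h1 := isColimitOfPreserves F hc
  have h2 := isColimitOfPreserves G hc
  have : α.app c.pt =
      (h1.coconePointsIsoOfNatIso h2 (asIso (Functor.whiskerLeft K α))).hom := by
    refine h1.hom_ext fun j => ?_
    rw [IsColimit.comp_coconePointsIsoOfNatIso_hom]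
    simp
  rw [this]
  infer_instance

lemma isIso_app_of_isLimit {F G : C ⥤ D} (α : F ⟶ G) {J : Type*} [Category* J]
    [PreservesLimitsOfShape J F] [PreservesLimitsOfShape J G]
    {K : J ⥤ C} {c : Cone K} (hc : IsLimit c) (h : ∀ j, IsIso (α.app (K.obj j))) :
    IsIso (α.app c.pt) := by
  have : ∀ j, IsIso ((Functor.whiskerLeft K α).app j) := h
  have : IsIso (Functor.whiskerLeft K α) := NatIso.isIso_of_isIso_app _
  have h1 := isLimitOfPreserves F hc
  have h2 := isLimitOfPreserves G hc
  have : α.app c.pt =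
      (h1.conePointsIsoOfNatIso h2 (asIso (Functor.whiskerLeft K α))).hom := by
    refine h2.hom_ext fun j => ?_
    rw [IsLimit.conePointsIsoOfNatIso_hom_comp]
    simp
  rw [this]
  infer_instance

end general

variable (A) in
def isAdd : ObjectProperty (Cell A ⥤ AddCommGrpCat.{u}) := fun M =>
  ∀ {X Z : Cell A} (a b c : X ⟶ Z), c.val = a.val + b.val → M.map c = M.map a + M.map b

section
variable (U : Y.affineOpens) (f : Γ(Y, U.1)) (i : Λ)

lemma isUnit_rs : IsUnit (rs (Y.affineBasicOpen_le f) f) :=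
  RingedSpace.isUnit_res_basicOpen _ f

/-- The inverse of `f` on the basic open set of `f`. -/
noncomputable def finv : Γ(Y, (Y.affineBasicOpen f).1) := ((isUnit_rs U f).unit⁻¹ : _ˣ)

lemma finv_mul : finv U f * rs (Y.affineBasicOpen_le f) f = 1 := (isUnit_rs U f).val_inv_mul

variable (A) in
/-- The diagram of the successive multiplications by `f`. -/
def sq : ℕ ⥤ Cell A where
  obj _ := ⟨U, i⟩
  map {m n} _ := Cell.scal le_rfl (f ^ (n - m)) i
  map_id m := by ext; simp
  map_comp {k m n} p q := by
    ext
    have h : n - k = (n - m) + (m - k) := by have := leOfHom p; have := leOfHom q; omega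
    simp [h, pow_add, A.res_self]

variable (A) in
/-- The cocone of the maps `x ↦ f ^ (- n) x` to the sections on the basic open set. -/
noncomputable def kap : Cocone (sq A U f i) where
  pt := ⟨Y.affineBasicOpen f, i⟩
  ι :=
    { app := fun n => Cell.scal (U := U) (Y.affineBasicOpen_le f) (finv U f ^ n) i
      naturality := by
        intro m n p
        have h : n = m + (n - m) := by have := leOfHom p; omega
        have e : finv U f ^ n * rs (Y.affineBasicOpen_le f) (f ^ (n - m)) = finv U f ^ m := by
          conv_lhs => rw [h, pow_add]
          rw [map_pow, mul_assoc, Nat.add_sub_cancel_left, ← mul_pow, finv_mul, one_pow, mul_one]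
        refine Eq.trans ?_ (Category.comp_id _).symm
        refine Cell.hom_ext ?_
        refine Eq.trans (b := A.str _ (finv U f ^ n * rs (Y.affineBasicOpen_le f) (f ^ (n - m)))) ?_
          (congrArg _ e)
        rw [map_mul, ← A.res_str]
        rfl }

variable (A) in
/-- The localization at `f` of the sections over `U`, as a functor. -/
noncomputable def locFunctor : (Cell A ⥤ AddCommGrpCat.{u}) ⥤ AddCommGrpCat.{u} :=
  (Functor.whiskeringLeft _ _ _).obj (sq A U f i) ⋙ colim

variable (A) in
noncomputable abbrev evFunctor (X : Cell A) : (Cell A ⥤ AddCommGrpCat.{u}) ⥤ AddCommGrpCat.{u} :=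
  (evaluation _ _).obj X

variable (A) in
/-- The comparison from the localization to the sections on the basic open set. -/
noncomputable def locMap : locFunctor A U f i ⟶ evFunctor A ⟨Y.affineBasicOpen f, i⟩ where
  app M := colimit.desc (sq A U f i ⋙ M) (M.mapCocone (kap A U f i))
  naturality M N φ := by
    apply colimit.hom_ext
    intro j
    dsimp [locFunctor, evFunctor]
    erw [ι_colimMap_assoc, colimit.ι_desc, colimit.ι_desc_assoc]
    exact (φ.naturality _).symm

instance {J : Type*} [Category* J] [HasColimitsOfShape J AddCommGrpCat.{u}] :
    PreservesColimitsOfShape J (locFunctor A U f i) := by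
  unfold locFunctor; infer_instance
instance : HasExactColimitsOfShape ℕ AddCommGrpCat.{u} := by
  have := hasFilteredColimitsOfSize_of_univLE.{0, u, 0, u} (C := AddCommGrpCat.{u})
  have : AB5OfSize.{0, 0} AddCommGrpCat.{u} := AB5OfSize_of_univLE.{0, 0, u, u} _
  infer_instance

instance : PreservesFiniteLimits (locFunctor A U f i) := by
  unfold locFunctor; infer_instance
instance : PreservesColimitsOfShape ℕ (forget AddCommGrpCat.{u}) := by
  have := preservesSmallestFilteredColimits_of_preservesFilteredColimits.{u, u}
    (forget AddCommGrpCat.{u})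
  infer_instance


lemma Cell.scal_comp {U V W : Y.affineOpens} (h : V ≤ U) (h' : W ≤ V) (r : Γ(Y, V.1))
    (s : Γ(Y, W.1)) (i : Λ) :
    Cell.scal (A := A) h r i ≫ Cell.scal h' s i = Cell.scal (h'.trans h) (s * rs h' r) i := by
  ext
  simp [A.res_str]

lemma map_scal_scal (M : Cell A ⥤ AddCommGrpCat.{u}) {U V W : Y.affineOpens} (h : V ≤ U)
    (h' : W ≤ V) (r : Γ(Y, V.1)) (s : Γ(Y, W.1)) (i : Λ) (x : M.obj ⟨U, i⟩) :
    M.map (Cell.scal h' s i) (M.map (Cell.scal h r i) x) =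
      M.map (Cell.scal (h'.trans h) (s * rs h' r) i) x := by
  rw [← Cell.scal_comp, M.map_comp]
  rfl

lemma rs_self {Y : Scheme.{u}} {V : Y.affineOpens} (h : V ≤ V) (r : Γ(Y, V.1)) : rs h r = r := by
  change Y.presheaf.map (𝟙 _) r = r
  simp

lemma map_scal_one (M : Cell A ⥤ AddCommGrpCat.{u}) (x : M.obj ⟨U, i⟩) :
    M.map (Cell.scal le_rfl 1 i) x = x := by
  have : Cell.scal (A := A) (U := U) le_rfl 1 i = 𝟙 _ := by ext; simp
  rw [this, M.map_id]
  rfl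

lemma isIso_locMap_iff (M : Cell A ⥤ AddCommGrpCat.{u}) :
    IsIso ((locMap A U f i).app M) ↔
      (∀ y : M.obj ⟨Y.affineBasicOpen f, i⟩, ∃ (n : ℕ) (x : M.obj ⟨U, i⟩),
        M.map (Cell.scal (Y.affineBasicOpen_le f) 1 i) x =
          M.map (Cell.scal le_rfl (rs (Y.affineBasicOpen_le f) f ^ n) i) y) ∧
      (∀ x : M.obj ⟨U, i⟩,
        M.map (Cell.scal (Y.affineBasicOpen_le f) 1 i) x = 0 →
          ∃ n : ℕ, M.map (Cell.scal le_rfl (f ^ n) i) x = 0) := by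
  have key : ∀ (n : ℕ) (x : M.obj ⟨U, i⟩), (locMap A U f i).app M
      (colimit.ι (sq A U f i ⋙ M) n x) =
      M.map (Cell.scal (Y.affineBasicOpen_le f) (finv U f ^ n) i) x := by
    intro n x
    exact ConcreteCategory.congr_hom (colimit.ι_desc (M.mapCocone (kap A U f i)) n) x
  have k1 : ∀ (n : ℕ) (x : M.obj ⟨U, i⟩), M.map (Cell.scal le_rfl (rs (Y.affineBasicOpen_le f) f ^ n) i)
      (M.map (Cell.scal (Y.affineBasicOpen_le f) (finv U f ^ n) i) x) =
      M.map (Cell.scal (Y.affineBasicOpen_le f) 1 i) x := by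
    intro n x
    rw [map_scal_scal]
    have : rs (Y.affineBasicOpen_le f) f ^ n * rs le_rfl (finv U f ^ n) = 1 := by
      rw [rs_self, ← mul_pow, mul_comm, finv_mul, one_pow]
    rw [this]
  have k2 : ∀ (n : ℕ) (y : M.obj ⟨Y.affineBasicOpen f, i⟩),
      M.map (Cell.scal (A := A) (U := Y.affineBasicOpen f) le_rfl (finv U f ^ n) i)
        (M.map (Cell.scal le_rfl (rs (Y.affineBasicOpen_le f) f ^ n) i) y) = y := by
    intro n y
    rw [map_scal_scal, rs_self, ← mul_pow, finv_mul, one_pow, map_scal_one]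
  have k3 : ∀ (n : ℕ) (x : M.obj ⟨U, i⟩),
      M.map (Cell.scal (A := A) (U := Y.affineBasicOpen f) le_rfl (finv U f ^ n) i)
        (M.map (Cell.scal (Y.affineBasicOpen_le f) 1 i) x) =
      M.map (Cell.scal (Y.affineBasicOpen_le f) (finv U f ^ n) i) x := by
    intro n x
    rw [map_scal_scal, map_one, mul_one]
  have k4 : ∀ (m n : ℕ) (h : m ⟶ n) (x : M.obj ⟨U, i⟩), (sq A U f i ⋙ M).map h x =
      M.map (Cell.scal le_rfl (f ^ (n - m)) i) x := fun m n h x => rfl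
  rw [ConcreteCategory.isIso_iff_bijective]
  constructor
  · rintro ⟨h1, h2⟩
    constructor
    · intro y
      obtain ⟨z, hz⟩ := h2 y
      obtain ⟨n, x, rfl⟩ := Concrete.colimit_exists_rep (sq A U f i ⋙ M) z
      refine ⟨n, x, ?_⟩
      exact (k1 n x).symm.trans (congrArg _ ((key n x).symm.trans hz))
    · intro x hx
      have h3 : colimit.ι (sq A U f i ⋙ M) 0 x = 0 := by
        apply h1
        refine (key 0 x).trans ?_
        rw [← k3, hx, map_zero]
        exact (map_zero ((locMap A U f i).app M).hom).symm
      have h4 : colimit.ι (sq A U f i ⋙ M) 0 x = colimit.ι (sq A U f i ⋙ M) 0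
          (0 : M.obj ⟨U, i⟩) :=
        h3.trans (map_zero (colimit.ι (sq A U f i ⋙ M) 0).hom).symm
      obtain ⟨n, h, h', e⟩ := Concrete.colimit_exists_of_rep_eq (sq A U f i ⋙ M) _ _ h4
      refine ⟨n, (k4 _ _ h _).symm.trans (e.trans ?_)⟩
      exact map_zero ((sq A U f i ⋙ M).map h').hom
  · rintro ⟨h1, h2⟩
    constructor
    · refine (injective_iff_map_eq_zero ((locMap A U f i).app M).hom).2 ?_
      intro z hz
      obtain ⟨n, x, rfl⟩ := Concrete.colimit_exists_rep (sq A U f i ⋙ M) z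
      have hz' := (key n x).symm.trans hz
      have := k1 n x
      rw [hz', map_zero] at this
      obtain ⟨k, hk⟩ := h2 x this.symm
      have e : (sq A U f i ⋙ M).map (homOfLE (Nat.le_add_right n k)) x = 0 := by
        exact (k4 _ _ _ _).trans (by rw [Nat.add_sub_cancel_left]; exact hk)
      rw [← colimit.w (sq A U f i ⋙ M) (homOfLE (Nat.le_add_right n k))]
      refine (ConcreteCategory.comp_apply _ _ _).trans ?_
      rw [e, map_zero]
      rfl
    · intro y
      obtain ⟨n, x, hx⟩ := h1 y
      refine ⟨colimit.ι (sq A U f i ⋙ M) n x, (key n x).trans ?_⟩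
      exact ((k3 n x).symm.trans (congrArg _ hx)).trans (k2 n y)

end

lemma isGrMod_iff (M : Cell A ⥤ AddCommGrpCat.{u}) :
    isGrMod A M ↔ isAdd A M ∧ ∀ U f i, IsIso ((locMap A U f i).app M) := by
  simp only [isIso_locMap_iff]
  exact ⟨fun h => ⟨h.map_add, fun U f i => ⟨h.qc_surj U f i, h.qc_inj U f i⟩⟩,
    fun h => ⟨h.1, fun U f i => (h.2 U f i).1, fun U f i => (h.2 U f i).2⟩⟩

lemma isAdd_of_isLimit {J : Type*} [Category* J] [HasLimitsOfShape J AddCommGrpCat.{u}]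
    {K : J ⥤ Cell A ⥤ AddCommGrpCat.{u}} {c : Cone K} (hc : IsLimit c)
    (h : ∀ j, isAdd A (K.obj j)) : isAdd A c.pt := by
  intro X Z a b s hs
  have hZ := isLimitOfPreserves (evFunctor A Z) hc
  refine hZ.hom_ext fun j => ?_
  have e : ∀ t : X ⟶ Z, c.pt.map t ≫ ((evFunctor A Z).mapCone c).π.app j =
    (c.π.app j).app X ≫ (K.obj j).map t := fun t => (c.π.app j).naturality t
  refine (e s).trans ?_
  rw [h j a b s hs, Preadditive.comp_add, ← e, ← e]
  exact (Preadditive.add_comp _ _ _ _ _ _).symm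

lemma isAdd_of_isColimit {J : Type*} [Category* J] [HasColimitsOfShape J AddCommGrpCat.{u}]
    {K : J ⥤ Cell A ⥤ AddCommGrpCat.{u}} {c : Cocone K} (hc : IsColimit c)
    (h : ∀ j, isAdd A (K.obj j)) : isAdd A c.pt := by
  intro X Z a b s hs
  have hZ := isColimitOfPreserves (evFunctor A X) hc
  refine hZ.hom_ext fun j => ?_
  have e : ∀ t : X ⟶ Z, ((evFunctor A X).mapCocone c).ι.app j ≫ c.pt.map t =
    (K.obj j).map t ≫ (c.ι.app j).app Z := fun t => ((c.ι.app j).naturality t).symm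
  refine (e s).trans ?_
  rw [h j a b s hs, Preadditive.add_comp, ← e, ← e]
  exact (Preadditive.comp_add _ _ _ _ _ _).symm

lemma isGrMod_of_isColimit {J : Type*} [Category* J] [HasColimitsOfShape J AddCommGrpCat.{u}]
    {K : J ⥤ Cell A ⥤ AddCommGrpCat.{u}} {c : Cocone K} (hc : IsColimit c)
    (h : ∀ j, isGrMod A (K.obj j)) : isGrMod A c.pt := by
  simp only [isGrMod_iff] at h ⊢
  exact ⟨isAdd_of_isColimit hc fun j => (h j).1,
    fun U f i => isIso_app_of_isColimit _ hc fun j => (h j).2 U f i⟩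

lemma isGrMod_of_isLimit {J : Type} [SmallCategory J] [FinCategory J]
    {K : J ⥤ Cell A ⥤ AddCommGrpCat.{u}} {c : Cone K} (hc : IsLimit c)
    (h : ∀ j, isGrMod A (K.obj j)) : isGrMod A c.pt := by
  simp only [isGrMod_iff] at h ⊢
  exact ⟨isAdd_of_isLimit hc fun j => (h j).1,
    fun U f i => isIso_app_of_isLimit _ hc fun j => (h j).2 U f i⟩

instance {J : Type*} [Category* J] [HasColimitsOfShape J AddCommGrpCat.{u}] :
    (isGrMod A).IsClosedUnderColimitsOfShape J where
  colimitsOfShape_le := by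
    rintro M ⟨h⟩
    exact isGrMod_of_isColimit h.isColimit h.prop_diag_obj

instance {J : Type} [SmallCategory J] [FinCategory J] :
    (isGrMod A).IsClosedUnderLimitsOfShape J where
  limitsOfShape_le := by
    rintro M ⟨h⟩
    exact isGrMod_of_isLimit h.isLimit h.prop_diag_obj

instance : (isGrMod A).IsClosedUnderKernels where
  kernels_le := by
    rintro _ ⟨f, k, hk, hf⟩
    refine isGrMod_of_isLimit hk ?_
    rintro (_ | _)
    exacts [hf.1, hf.2]

instance : (isGrMod A).IsClosedUnderCokernels where
  cokernels_le := by
    rintro _ ⟨f, k, hk, hf⟩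
    refine isGrMod_of_isColimit hk ?_
    rintro (_ | _)
    exacts [hf.1, hf.2]

instance : (isGrMod A).IsClosedUnderFiniteProducts where
  isClosedUnderLimitsOfShape J _ := by
    have := Fintype.ofFinite J
    constructor
    rintro M ⟨h⟩
    exact isGrMod_of_isLimit h.isLimit h.prop_diag_obj

instance : (isGrMod A).IsClosedUnderIsomorphisms := inferInstance

instance : (isGrMod A).ContainsZero := inferInstance

end closure

variable (A) in
/-- The category of quasi-coherent sheaves of graded `A`-modules. -/
abbrev GrMod := (isGrMod A).FullSubcategory

instance : HasColimits (GrMod A) := ⟨fun _ _ => inferInstance⟩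


section grothendieck

instance : HasFilteredColimitsOfSize.{u, u} (GrMod A) := ⟨fun _ _ _ => inferInstance⟩

instance : PreservesFiniteLimits (isGrMod A).ι := ⟨fun _ _ _ => inferInstance⟩

instance : PreservesColimits (isGrMod A).ι := ⟨⟨inferInstance⟩⟩

instance : AB5OfSize.{u, u} (GrMod A) where
  ofShape J _ _ := HasExactColimitsOfShape.domain_of_functor J (isGrMod A).ι

/-- The formal expressions for the sections of a submodule generated by one section. -/
inductive Tm (d : Cell A) : Cell A → Type u
  | gen : Tm d d
  | zero (X : Cell A) : Tm d X
  | add {X : Cell A} : Tm d X → Tm d X → Tm d X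
  | neg {X : Cell A} : Tm d X → Tm d X
  | map {X Z : Cell A} (f : X ⟶ Z) : Tm d X → Tm d Z
  | lift (U : Y.affineOpens) (f : Γ(Y, U.1)) (i : Λ) :
      Tm d ⟨Y.affineBasicOpen f, i⟩ → Tm d ⟨U, i⟩

noncomputable def Tm.eval {d : Cell A} {M : Cell A ⥤ AddCommGrpCat.{u}} (hM : IsGrMod M)
    (m : M.obj d) : ∀ {X : Cell A}, Tm d X → M.obj X
  | _, .gen => m
  | _, .zero _ => 0
  | _, .add s t => s.eval hM m + t.eval hM m
  | _, .neg s => - s.eval hM m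
  | _, .map f s => M.map f (s.eval hM m)
  | _, .lift U f i s => (hM.qc_surj U f i (s.eval hM m)).choose_spec.choose

noncomputable def Tm.range {d : Cell A} {M : Cell A ⥤ AddCommGrpCat.{u}} (hM : IsGrMod M)
    (m : M.obj d) (X : Cell A) : AddSubgroup (M.obj X) where
  carrier := Set.range (Tm.eval hM m (X := X))
  zero_mem' := ⟨.zero X, rfl⟩
  add_mem' := by rintro _ _ ⟨s, rfl⟩ ⟨t, rfl⟩; exact ⟨.add s t, rfl⟩
  neg_mem' := by rintro _ ⟨s, rfl⟩; exact ⟨.neg s, rfl⟩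

/-- The subfunctor given by a family of subgroups stable under all the structure maps. -/
def subFunctor (M : Cell A ⥤ AddCommGrpCat.{u}) (G : ∀ X, AddSubgroup (M.obj X))
    (hG : ∀ {X Z : Cell A} (f : X ⟶ Z) (x : M.obj X), x ∈ G X → M.map f x ∈ G Z) :
    Cell A ⥤ AddCommGrpCat.{u} where
  obj X := AddCommGrpCat.of (G X)
  map {X Z} f := AddCommGrpCat.ofHom
    (((M.map f).hom.comp (G X).subtype).codRestrict (G Z) fun x => hG f x x.2)
  map_id X := by
    ext x
    exact ConcreteCategory.congr_hom (M.map_id X) x.1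
  map_comp f g := by
    ext x
    exact ConcreteCategory.congr_hom (M.map_comp f g) x.1

def subFunctorι (M : Cell A ⥤ AddCommGrpCat.{u}) (G : ∀ X, AddSubgroup (M.obj X))
    (hG : ∀ {X Z : Cell A} (f : X ⟶ Z) (x : M.obj X), x ∈ G X → M.map f x ∈ G Z) :
    subFunctor M G hG ⟶ M where
  app X := AddCommGrpCat.ofHom (G X).subtype

lemma isGrMod_subFunctor {M : Cell A ⥤ AddCommGrpCat.{u}} (hM : IsGrMod M)
    (G : ∀ X, AddSubgroup (M.obj X))
    (hG : ∀ {X Z : Cell A} (f : X ⟶ Z) (x : M.obj X), x ∈ G X → M.map f x ∈ G Z)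
    (h : ∀ (U : Y.affineOpens) (f : Γ(Y, U.1)) (i : Λ)
      (y : M.obj ⟨Y.affineBasicOpen f, i⟩), y ∈ G _ → ∃ (n : ℕ) (x : M.obj ⟨U, i⟩), x ∈ G _ ∧
      M.map (Cell.scal (Y.affineBasicOpen_le f) 1 i) x =
        M.map (Cell.scal le_rfl (rs (Y.affineBasicOpen_le f) f ^ n) i) y) :
    IsGrMod (subFunctor M G hG) where
  map_add a b c e := by
    ext x
    exact Subtype.ext (ConcreteCategory.congr_hom (hM.map_add a b c e) x.1)
  qc_surj U f i y := by
    obtain ⟨n, x, hx, e⟩ := h U f i y.1 y.2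
    exact ⟨n, ⟨x, hx⟩, Subtype.ext e⟩
  qc_inj U f i x hx := by
    obtain ⟨n, e⟩ := hM.qc_inj U f i x.1 (congrArg Subtype.val hx)
    exact ⟨n, Subtype.ext e⟩

/-- A functor structure on a family of quotients of the sets of terms. -/
structure TmModel (d : Cell A) : Type u where
  s : ∀ X, Setoid (Tm d X)
  g : ∀ X, AddCommGroup (Quotient (s X))
  m : ∀ {X Z : Cell A}, (X ⟶ Z) → (Quotient (s X) →+ Quotient (s Z))
  m_id : ∀ X, m (𝟙 X) = AddMonoidHom.id _
  m_comp : ∀ {X Z W : Cell A} (f : X ⟶ Z) (g : Z ⟶ W), m (f ≫ g) = (m g).comp (m f)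

def TmModel.functor {d : Cell A} (T : TmModel d) : Cell A ⥤ AddCommGrpCat.{u} where
  obj X := letI := T.g X; AddCommGrpCat.of (Quotient (T.s X))
  map {X Z} f := letI := T.g X; letI := T.g Z; AddCommGrpCat.ofHom (T.m f)
  map_id X := by simp only [T.m_id]; rfl
  map_comp f g := by simp only [T.m_comp]; rfl

lemma TmModel.exists_iso {d : Cell A} (N : Cell A ⥤ AddCommGrpCat.{u})
    (e : ∀ X, Tm d X → N.obj X) (he : ∀ X, Function.Surjective (e X)) :
    ∃ T : TmModel d, Nonempty (T.functor ≅ N) := by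
  let s X : Setoid (Tm d X) := Setoid.ker (e X)
  let q X : Quotient (s X) ≃ N.obj X := Setoid.quotientKerEquivOfSurjective (e X) (he X)
  let g X : AddCommGroup (Quotient (s X)) := (q X).addCommGroup
  let r X : Quotient (s X) ≃+ N.obj X := (q X).addEquiv
  refine ⟨⟨s, g, fun {X Z} f => (r Z).symm.toAddMonoidHom.comp
    ((N.map f).hom.comp (r X).toAddMonoidHom), ?_, ?_⟩, ⟨NatIso.ofComponents
      (fun X => AddEquiv.toAddCommGrpIso (X := AddCommGrpCat.of (Quotient (s X))) (r X)) ?_⟩⟩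
  · intro X
    ext x
    simp
  · intro X Z W f g
    ext x
    simp
  · intro X Z f
    ext x
    exact (r Z).apply_symm_apply _

instance : HasSeparator (GrMod A) := by
  let F (x : { p : Σ d : Cell A, TmModel d // IsGrMod p.2.functor }) : GrMod A :=
    ⟨x.1.2.functor, x.2⟩
  have : (ObjectProperty.ofObj F).IsSeparating := by
    intro M M' f g h
    ext X x
    have hM := M.property
    let G := Tm.range hM x
    have hG : ∀ {X Z : Cell A} (f : X ⟶ Z) (x : M.obj.obj X), x ∈ G X → M.obj.map f x ∈ G Z := by
      rintro X Z f _ ⟨t, rfl⟩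
      exact ⟨.map f t, rfl⟩
    have hN : IsGrMod (subFunctor M.obj G hG) := by
      refine isGrMod_subFunctor hM G hG ?_
      rintro U f i _ ⟨t, rfl⟩
      exact ⟨_, _, ⟨.lift U f i t, rfl⟩, (hM.qc_surj U f i (t.eval hM x)).choose_spec.choose_spec⟩
    obtain ⟨T, ⟨α⟩⟩ := TmModel.exists_iso (d := X) (subFunctor M.obj G hG)
      (fun Z t => ⟨t.eval hM x, t, rfl⟩) (by rintro Z ⟨_, t, rfl⟩; exact ⟨t, rfl⟩)
    have hT : IsGrMod T.functor := (isGrMod A).prop_of_iso α.symm hN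
    have := h (F ⟨⟨X, T⟩, hT⟩) ⟨_⟩ (ObjectProperty.homMk (α.hom ≫ subFunctorι M.obj G hG))
    have e := ConcreteCategory.congr_hom (congr_app (congrArg (fun t => t.hom) this) X)
      (α.inv.app X ⟨x, .gen, rfl⟩)
    have e' : (α.hom.app X) (α.inv.app X ⟨x, .gen, rfl⟩) = ⟨x, .gen, rfl⟩ :=
      ConcreteCategory.congr_hom (congr_app α.inv_hom_id X) _
    have e2 : ∀ k : M ⟶ M', ((ObjectProperty.homMk (α.hom ≫ subFunctorι M.obj G hG) :
        F ⟨⟨X, T⟩, hT⟩ ⟶ M) ≫ k).hom.app X (α.inv.app X ⟨x, .gen, rfl⟩) = k.hom.app X x := by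
      intro k
      change k.hom.app X ((subFunctorι M.obj G hG).app X
        ((α.hom.app X) (α.inv.app X ⟨x, .gen, rfl⟩))) = _
      rw [e']
      rfl
    exact (e2 f).symm.trans (e.trans (e2 g))
  have := this.isSeparator_coproduct
  exact ⟨_, this⟩

instance : IsGrothendieckAbelian.{u} (GrMod A) where

instance : (isGrMod A).ι.IsLeftAdjoint :=
  isLeftAdjoint_of_preservesColimits_of_isSeparating (isSeparator_separator (GrMod A)) _

variable (A) in
/-- The coherator: the right adjoint of the inclusion of quasi-coherent modules into presheaves
of modules on the affine open sets. -/
noncomputable def coherator : (Cell A ⥤ AddCommGrpCat.{u}) ⥤ GrMod A := (isGrMod A).ι.rightAdjoint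

end grothendieck

section structureSheaf

variable (Y) in
/-- The structure sheaf, as an algebra graded by the trivial group. -/
def structAlg : GradedAlgebra Y PUnit where
  obj U := Γ(Y, U.1)
  res h := rs h
  res_self h a := rs_self h a
  res_res {U V W} h h' a := by
    have := Y.presheaf.map_comp (homOfLE (show V.1 ≤ U.1 from h)).op
      (homOfLE (show W.1 ≤ V.1 from h')).op
    exact (ConcreteCategory.congr_hom this a).symm
  deg U _ := ⊤
  one_mem _ := trivial
  mul_mem _ _ := trivial
  isInternal U := by
    refine ⟨fun x y h => ?_, fun y => ⟨DirectSum.of _ PUnit.unit ⟨y, trivial⟩, by simp⟩⟩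
    have e : ∀ z : DirectSum PUnit (fun _ => (⊤ : AddSubgroup Γ(Y, U.1))),
        z = DirectSum.of (fun _ => (⊤ : AddSubgroup Γ(Y, U.1))) PUnit.unit (z PUnit.unit) := by
      intro z
      ext i
      simp
    rw [e x, e y] at h
    simp only [DirectSum.coeAddMonoidHom_of] at h
    rw [e x, e y, Subtype.ext h]
  res_mem _ _ _ _ := trivial
  str U := RingHom.id _
  str_mem _ _ := trivial
  res_str _ _ := rfl
  qc_surj U f y := by
    have := U.2.isLocalization_basicOpen f
    obtain ⟨⟨x, _, n, rfl⟩, e⟩ := IsLocalization.surj (Submonoid.powers f)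
      (S := Γ(Y, Y.basicOpen f)) y
    refine ⟨n, x, e.symm.trans ?_⟩
    refine (mul_comm _ _).trans ?_
    exact congrArg (· * y) (map_pow (rs (Y.affineBasicOpen_le f)) f n)
  qc_inj U f x hx := by
    have := U.2.isLocalization_basicOpen f
    obtain ⟨⟨_, n, rfl⟩, e⟩ := (IsLocalization.map_eq_zero_iff (Submonoid.powers f)
      Γ(Y, Y.basicOpen f) x).1 hx
    exact ⟨n, e⟩

variable (Y) in
/-- The category of quasi-coherent sheaves. -/
abbrev QCoh := GrMod (structAlg Y)


/-- Multiplication by the restriction of the scalar of `f` to a smaller affine open set. -/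
def Cell.act {X Z : Cell A} (f : X ⟶ Z) {W : Y.affineOpens} (h : W ≤ Z.U) :
    (⟨W, -Z.i⟩ : Cell A) ⟶ ⟨W, -X.i⟩ :=
  Cell.Hom.mk (A.res h f.val) le_rfl (by
    have e : -X.i - -Z.i = Z.i - X.i := by abel
    have : A.res h f.val ∈ A.deg W (-X.i - -Z.i) := by
      rw [e]
      exact A.res_mem h f.mem
    exact this)

lemma Cell.act_id (X : Cell A) {W : Y.affineOpens} (h : W ≤ X.U) :
    Cell.act (𝟙 X) h = 𝟙 _ := by
  ext
  simp [Cell.act]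

lemma Cell.act_comp {X Z T : Cell A} (f : X ⟶ Z) (g : Z ⟶ T) {W : Y.affineOpens} (h : W ≤ T.U) :
    Cell.act (f ≫ g) h = Cell.act g h ≫ Cell.act f (h.trans g.hle) := by
  ext
  simp [Cell.act, A.res_res, mul_comm]

lemma Cell.act_scal {X Z : Cell A} (f : X ⟶ Z) {W W' : Y.affineOpens} (h : W ≤ Z.U)
    (h' : W' ≤ W) (r : Γ(Y, W'.1)) :
    Cell.act f h ≫ Cell.scal h' r (-X.i) = Cell.scal h' r (-Z.i) ≫ Cell.act f (h'.trans h) := by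
  ext
  simp [Cell.act, A.res_res, A.res_self, mul_comm]

/-- The sections over `X.U`, of weight `X.i`, of the graded sheaf Hom from `M` to `G`: the
`O`-linear maps from the restriction of the component of `M` of weight `- X.i` to the restriction
of `G`. -/
def HomSec (M : Cell A ⥤ AddCommGrpCat.{u}) (G : Cell (structAlg Y) ⥤ AddCommGrpCat.{u})
    (X : Cell A) :
    AddSubgroup (∀ W : {W : Y.affineOpens // W ≤ X.U}, M.obj ⟨W.1, -X.i⟩ →+ G.obj ⟨W.1, ⟨⟩⟩) where
  carrier := {φ | ∀ (W W' : {W : Y.affineOpens // W ≤ X.U}) (h : W'.1 ≤ W.1) (r : Γ(Y, W'.1.1))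
    (x : M.obj ⟨W.1, -X.i⟩), φ W' (M.map (Cell.scal h r (-X.i)) x) =
      G.map (Cell.scal h r ⟨⟩) (φ W x)}
  zero_mem' := fun W W' h r x => by simp
  add_mem' := fun {φ ψ} hφ hψ W W' h r x => by
    simp [hφ W W' h r x, hψ W W' h r x]
  neg_mem' := fun {φ} hφ W W' h r x => by
    simp [hφ W W' h r x]

def HomSec.map (M : Cell A ⥤ AddCommGrpCat.{u}) (G : Cell (structAlg Y) ⥤ AddCommGrpCat.{u})
    {X Z : Cell A} (f : X ⟶ Z) : HomSec M G X →+ HomSec M G Z where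
  toFun φ := ⟨fun W => (φ.1 ⟨W.1, W.2.trans f.hle⟩).comp (M.map (Cell.act f W.2)).hom, by
    intro W W' h r x
    have e := ConcreteCategory.congr_hom (congrArg (fun t => M.map t) (Cell.act_scal f W.2 h r)) x
    have e1 := φ.2 ⟨W.1, W.2.trans f.hle⟩ ⟨W'.1, W'.2.trans f.hle⟩ h r (M.map (Cell.act f W.2) x)
    simp only [M.map_comp] at e
    exact (congrArg _ e.symm).trans e1⟩
  map_zero' := rfl
  map_add' _ _ := rfl

/-- The graded sheaf Hom, as a presheaf of graded modules on the affine open sets. -/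
def preHomObj (M : Cell A ⥤ AddCommGrpCat.{u}) (G : Cell (structAlg Y) ⥤ AddCommGrpCat.{u}) :
    Cell A ⥤ AddCommGrpCat.{u} where
  obj X := AddCommGrpCat.of (HomSec M G X)
  map f := AddCommGrpCat.ofHom (HomSec.map M G f)
  map_id X := by
    ext φ W x
    have e : M.map (Cell.act (𝟙 X) W.2) = 𝟙 _ := by rw [Cell.act_id, M.map_id]
    exact congrArg (φ.1 W) (ConcreteCategory.congr_hom e x)
  map_comp f g := by
    ext φ W x
    have e : M.map (Cell.act (f ≫ g) W.2) =
        M.map (Cell.act g W.2) ≫ M.map (Cell.act f (W.2.trans g.hle)) := by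
      rw [Cell.act_comp, M.map_comp]
    exact congrArg (φ.1 ⟨W.1, W.2.trans (f ≫ g).hle⟩) (ConcreteCategory.congr_hom e x)

def preHomMap {M M' : Cell A ⥤ AddCommGrpCat.{u}} {G G' : Cell (structAlg Y) ⥤ AddCommGrpCat.{u}}
    (α : M' ⟶ M) (β : G ⟶ G') : preHomObj M G ⟶ preHomObj M' G' where
  app X := AddCommGrpCat.ofHom
    { toFun := fun φ => ⟨fun W => ((β.app _).hom.comp (φ.1 W)).comp (α.app _).hom, by
        intro W W' h r x
        have e1 := ConcreteCategory.congr_hom (α.naturality (Cell.scal h r (-X.i))) x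
        have e2 := ConcreteCategory.congr_hom (β.naturality (Cell.scal h r ⟨⟩))
          (φ.1 W (α.app _ x))
        refine Eq.trans ?_ e2
        exact congrArg (β.app _) ((congrArg (φ.1 W') e1).trans (φ.2 W W' h r _))⟩
      map_zero' := by
        refine Subtype.ext (funext fun W => ?_)
        ext x
        exact map_zero (β.app _).hom
      map_add' := fun φ ψ => by
        refine Subtype.ext (funext fun W => ?_)
        ext x
        exact map_add (β.app _).hom _ _ }
  naturality X Z f := by
    ext φ
    refine Subtype.ext (funext fun W => AddMonoidHom.ext fun x => ?_)
    exact congrArg (fun t => β.app _ (φ.1 ⟨W.1, W.2.trans f.hle⟩ t))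
      (ConcreteCategory.congr_hom (α.naturality (Cell.act f W.2)) x).symm

/-- The internal graded Hom of quasi-coherent modules over the structure sheaf, with weight `i`
component `Hom(M_{-i}, G)`: the coherator of the graded sheaf Hom. -/
noncomputable def homQ (M : GrMod A) (G : QCoh Y) : GrMod A :=
  (coherator A).obj (preHomObj M.obj G.obj)

noncomputable def homQMap {M M' : GrMod A} {G G' : QCoh Y} (α : M' ⟶ M) (β : G ⟶ G') :
    homQ M G ⟶ homQ M' G' :=
  (coherator A).map (preHomMap α.hom β.hom)

lemma homQMap_id (M : GrMod A) (G : QCoh Y) : homQMap (𝟙 M) (𝟙 G) = 𝟙 _ :=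
  (coherator A).map_id _

lemma homQMap_comp {M M' M'' : GrMod A} {G G' G'' : QCoh Y} (α : M' ⟶ M) (β : G ⟶ G')
    (α' : M'' ⟶ M') (β' : G' ⟶ G'') :
    homQMap α β ≫ homQMap α' β' = homQMap (α' ≫ α) (β ≫ β') :=
  ((coherator A).map_comp _ _).symm

instance : (coherator A).Additive := by
  exact (Adjunction.ofIsLeftAdjoint (isGrMod A).ι).right_adjoint_additive

lemma homQMap_zero_left {M M' : GrMod A} {G G' : QCoh Y} (β : G ⟶ G') :
    homQMap (0 : M' ⟶ M) β = 0 := by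
  have : preHomMap (0 : M' ⟶ M).hom β.hom = 0 := by
    ext X φ
    refine Subtype.ext (funext fun W => AddMonoidHom.ext fun x => ?_)
    exact (congrArg (β.hom.app _) (map_zero (φ.1 W))).trans (map_zero (β.hom.app _).hom)
  rw [homQMap, this, Functor.map_zero]
  rfl

lemma homQMap_zero_right {M M' : GrMod A} {G G' : QCoh Y} (α : M' ⟶ M) :
    homQMap α (0 : G ⟶ G') = 0 := by
  have : preHomMap α.hom (0 : G ⟶ G').hom = 0 := rfl
  rw [homQMap, this, Functor.map_zero]
  rfl

end structureSheaf

section dual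

instance {J : Type} [Small.{u} J] : HasProductsOfShape J (GrMod A) :=
  hasLimitsOfShape_of_equivalence (Discrete.equivalence (equivShrink.{u} J).symm)

/-- The bidegrees contributing to the degree `n` part of a Hom complex. -/
abbrev HomIdx (n : ℤ) : Type := {x : ℤ × ℤ // x.2 = x.1 + n}

/-- The degree `n` part of the Hom complex from `M` to `J`. -/
noncomputable abbrev dualX (J : CochainComplex (QCoh Y) ℤ) (M : CochainComplex (GrMod A) ℤ)
    (n : ℤ) : GrMod A :=
  ∏ᶜ fun x : HomIdx n => homQ (M.X x.1.1) (J.X x.1.2)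

/-- The differential of the Hom complex, `φ ↦ d ∘ φ - (-1) ^ n • φ ∘ d`. -/
noncomputable def dualD (J : CochainComplex (QCoh Y) ℤ) (M : CochainComplex (GrMod A) ℤ)
    (n : ℤ) : dualX J M n ⟶ dualX J M (n + 1) :=
  Pi.lift fun x : HomIdx (n + 1) =>
    Pi.π (fun y : HomIdx n => homQ (M.X y.1.1) (J.X y.1.2))
        ⟨(x.1.1, x.1.2 - 1), by have := x.2; dsimp only; omega⟩ ≫
      homQMap (𝟙 _) (J.d (x.1.2 - 1) x.1.2) +
    (n + 1).negOnePow • (Pi.π (fun y : HomIdx n => homQ (M.X y.1.1) (J.X y.1.2))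
        ⟨(x.1.1 + 1, x.1.2), by have := x.2; dsimp only; omega⟩ ≫
      homQMap (M.d x.1.1 (x.1.1 + 1)) (𝟙 _))

lemma dualD_comp (J : CochainComplex (QCoh Y) ℤ) (M : CochainComplex (GrMod A) ℤ) (n : ℤ) :
    dualD J M n ≫ dualD J M (n + 1) = 0 := by
  refine Pi.hom_ext _ _ fun x => ?_
  simp only [dualD, Category.assoc, limit.lift_π, Fan.mk_π_app, Preadditive.comp_add,
    Linear.comp_units_smul, limit.lift_π_assoc, Preadditive.add_comp, homQMap_comp,
    Category.id_comp, Category.comp_id, HomologicalComplex.d_comp_d, zero_comp,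
    homQMap_zero_left, homQMap_zero_right, Linear.units_smul_comp, comp_zero, smul_zero,
    zero_add, add_zero]
  rw [Int.negOnePow_succ (n + 1)]
  simp

end dual

section dualizing

noncomputable instance (C : Type*) [Category* C] [Abelian C] : HasDerivedCategory C :=
  HasDerivedCategory.standard C

/-- The sections of a quasi-coherent sheaf over an affine open set, as a module. -/
abbrev secModule (G : Cell (structAlg Y) ⥤ AddCommGrpCat.{u}) (hG : IsGrMod G) (U : Y.affineOpens) :
    Module Γ(Y, U.1) (G.obj ⟨U, ⟨⟩⟩) where
  smul r x := G.map (Cell.scal le_rfl r ⟨⟩) x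
  one_smul x := map_scal_one _ _ _ x
  mul_smul r s x := by
    refine Eq.trans ?_ (map_scal_scal G le_rfl le_rfl s r ⟨⟩ x).symm
    rw [rs_self]
    rfl
  smul_zero r := map_zero (G.map (Cell.scal le_rfl r ⟨⟩)).hom
  smul_add r := map_add (G.map (Cell.scal le_rfl r ⟨⟩)).hom
  add_smul r s x := ConcreteCategory.congr_hom
    (hG.map_add (Cell.scal (U := U) le_rfl r PUnit.unit) (Cell.scal le_rfl s PUnit.unit)
      (Cell.scal le_rfl (r + s) PUnit.unit) rfl) x
  zero_smul x := by
    have h := ConcreteCategory.congr_hom (hG.map_add (Cell.scal (U := U) le_rfl 0 PUnit.unit)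
      (Cell.scal le_rfl 0 PUnit.unit) (Cell.scal le_rfl 0 PUnit.unit) (add_zero (0 : Γ(Y, U.1))).symm) x
    exact left_eq_add.1 h

/-- The functor of sections over an affine open set. -/
def sections (U : Y.affineOpens) : QCoh Y ⥤ ModuleCat.{u} Γ(Y, U.1) where
  obj G := letI := secModule G.obj G.property U; ModuleCat.of _ (G.obj.obj ⟨U, ⟨⟩⟩)
  map {G G'} α :=
    letI := secModule G.obj G.property U
    letI := secModule G'.obj G'.property U
    ModuleCat.ofHom
      { toFun := α.hom.app ⟨U, ⟨⟩⟩
        map_add' := map_add (α.hom.app ⟨U, ⟨⟩⟩).hom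
        map_smul' := fun r x => ConcreteCategory.congr_hom (α.hom.naturality _) x }

instance (U : Y.affineOpens) : (sections U).Additive where

/-- Coherence of a quasi-coherent sheaf on a (locally) Noetherian scheme. -/
def IsCoherent (G : QCoh Y) : Prop :=
  ∀ U : Y.affineOpens, Module.Finite Γ(Y, U.1) ((sections U).obj G)

/-- A bounded complex of injective quasi-coherent sheaves representing a dualizing complex: its
cohomology is coherent and, over each affine open set `U`, the canonical map from `Γ(Y, U)` to its
derived endomorphism complex is an isomorphism. -/
structure IsDualizing (J : CochainComplex (QCoh Y) ℤ) : Prop where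
  bounded : ∃ m n : ℤ, J.IsStrictlyGE m ∧ J.IsStrictlyLE n
  injective : ∀ n, Injective (J.X n)
  coherent : ∀ n, IsCoherent (J.homology n)
  endo : ∀ U : Y.affineOpens,
    letI K := DerivedCategory.Q.obj (((sections U).mapHomologicalComplex (.up ℤ)).obj J)
    Function.Bijective (fun r : Γ(Y, U.1) => (r • 𝟙 K : K ⟶ K)) ∧
      ∀ n : ℤ, n ≠ 0 → ∀ f : K ⟶ K⟦n⟧, f = 0

end dualizing

section dualFunctor

/-- The internal graded Hom complex into a fixed complex `J` of quasi-coherent sheaves. When `J` is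
a bounded complex of injectives representing a dualizing complex, this computes the dual
`RHom(M, J)`. -/
noncomputable def dual (J : CochainComplex (QCoh Y) ℤ) (M : CochainComplex (GrMod A) ℤ) :
    CochainComplex (GrMod A) ℤ :=
  CochainComplex.of (dualX J M) (dualD J M) (dualD_comp J M)

noncomputable def dualMapX (J : CochainComplex (QCoh Y) ℤ) {M M' : CochainComplex (GrMod A) ℤ}
    (f : M' ⟶ M) (n : ℤ) : dualX J M n ⟶ dualX J M' n :=
  Limits.Pi.map fun x : HomIdx n => homQMap (f.f x.1.1) (𝟙 (J.X x.1.2))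

lemma dualMapX_comm (J : CochainComplex (QCoh Y) ℤ) {M M' : CochainComplex (GrMod A) ℤ}
    (f : M' ⟶ M) (n : ℤ) :
    dualMapX J f n ≫ dualD J M' n = dualD J M n ≫ dualMapX J f (n + 1) := by
  refine Pi.hom_ext _ _ fun x => ?_
  simp [dualD, dualMapX, homQMap_comp, Preadditive.comp_add, Preadditive.add_comp,
    Linear.comp_units_smul, Linear.units_smul_comp]

/-- The (contravariant) functoriality of the Hom complex. -/
noncomputable def dualMap (J : CochainComplex (QCoh Y) ℤ) {M M' : CochainComplex (GrMod A) ℤ}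
    (f : M' ⟶ M) : dual J M ⟶ dual J M' :=
  CochainComplex.ofHom (X := dual J M) (Y := dual J M') (dualMapX J f) fun n => by
    simpa only [dual, CochainComplex.of_d] using dualMapX_comm J f n

end dualFunctor

section modules

lemma exists_homogeneous_lift (U V : Y.affineOpens) (h : V ≤ U) (i : Λ) (x : A.obj U)
    (hx : A.res h x ∈ A.deg V i) : ∃ z ∈ A.deg U i, A.res h z = A.res h x := by
  obtain ⟨z, rfl⟩ := (A.isInternal U).2 x
  let m : DirectSum Λ (fun i => A.deg U i) →+ DirectSum Λ (fun i => A.deg V i) :=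
    DirectSum.map fun i => ((A.res h).toAddMonoidHom.comp (A.deg U i).subtype).codRestrict
      (A.deg V i) fun y => A.res_mem h y.2
  have hm : ∀ w, DirectSum.coeAddMonoidHom (A.deg V) (m w) =
      A.res h (DirectSum.coeAddMonoidHom (A.deg U) w) := by
    intro w
    refine DFunLike.congr_fun (f := (DirectSum.coeAddMonoidHom (A.deg V)).comp m)
      (g := (A.res h).toAddMonoidHom.comp (DirectSum.coeAddMonoidHom (A.deg U))) ?_ w
    ext j y
    simp [m]
  have e : m z = DirectSum.of (fun i => A.deg V i) i ⟨_, hx⟩ := by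
    apply (A.isInternal V).1
    rw [hm]
    simp
  refine ⟨z i, (z i).2, ?_⟩
  have := congrArg (fun t => ((t i : A.deg V i) : A.obj V)) e
  simpa [m] using this

variable (A) in
/-- The algebra `A`, as a presheaf of graded modules over itself. -/
def selfFunctor : Cell A ⥤ AddCommGrpCat.{u} where
  obj X := AddCommGrpCat.of (A.deg X.U X.i)
  map {X Z} f := AddCommGrpCat.ofHom
    { toFun := fun x => ⟨f.val * A.res f.hle x.1, by
        have := A.mul_mem f.mem (A.res_mem f.hle x.2)
        rwa [sub_add_cancel] at this⟩
      map_zero' := by simp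
      map_add' := fun x y => by
        ext
        simp [mul_add] }
  map_id X := by
    ext x
    simp [A.res_self]
  map_comp f g := by
    ext x
    simp [A.res_res, mul_assoc]

variable (A) in
/-- The algebra `A`, as a graded module over itself. -/
def selfMod : GrMod A where
  obj := selfFunctor A
  property :=
    { map_add := fun {X Z} a b c e => by
        refine ConcreteCategory.hom_ext _ _ fun x => ?_
        have : c.val * A.res c.hle x.1 = a.val * A.res a.hle x.1 + b.val * A.res b.hle x.1 := by
          rw [e, add_mul]
        exact Subtype.ext this
      qc_surj := fun U f i y => by
        obtain ⟨n, x, e⟩ := A.qc_surj U f y.1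
        have e' : A.res (Y.affineBasicOpen_le f) x =
            A.str _ (rs (Y.affineBasicOpen_le f) f ^ n) * A.res le_rfl y.1 := by
          rw [e, A.res_str, A.res_self, map_pow]
        have hx : A.res (Y.affineBasicOpen_le f) x ∈ A.deg _ i := by
          rw [e', A.res_self]
          have := A.mul_mem (A.str_mem _ (rs (Y.affineBasicOpen_le f) f ^ n)) y.2
          rwa [zero_add] at this
        obtain ⟨z, hz, ez⟩ := exists_homogeneous_lift _ _ _ _ _ hx
        refine ⟨n, ⟨z, hz⟩, Subtype.ext ?_⟩
        refine Eq.trans ?_ (ez.trans e')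
        exact (congrArg (· * _) (map_one (A.str _))).trans (one_mul _)
      qc_inj := fun U f i x hx => by
        have hx' : A.res (Y.affineBasicOpen_le f) x.1 = 0 :=
          ((congrArg (· * _) (map_one (A.str _))).trans (one_mul _)).symm.trans
            (congrArg Subtype.val hx)
        obtain ⟨n, e⟩ := A.qc_inj U f x.1 hx'
        refine ⟨n, Subtype.ext ?_⟩
        refine Eq.trans ?_ e
        change A.str U (f ^ n) * A.res le_rfl x.1 = _
        rw [A.res_self, map_pow] }

/-- The functor on cells inducing the shift of the grading by `a`. -/
def Cell.shift (a : Λ) : Cell A ⥤ Cell A where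
  obj X := ⟨X.U, X.i + a⟩
  map f := Cell.Hom.mk f.val f.hle (by simpa using f.mem)

/-- The graded module `M(a)`, with `M(a)_i = M_{i + a}`. -/
def twist (a : Λ) : GrMod A ⥤ GrMod A where
  obj M :=
    { obj := Cell.shift a ⋙ M.obj
      property :=
        { map_add := fun {X Z} p q r e => M.property.map_add _ _ _ e
          qc_surj := fun U f i y => M.property.qc_surj U f (i + a) y
          qc_inj := fun U f i x hx => M.property.qc_inj U f (i + a) x hx } }
  map α := ObjectProperty.homMk (Functor.whiskerLeft (Cell.shift a) α.hom)

instance (a : Λ) : (twist (A := A) a).Additive where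

variable (A) in
/-- The functor on cells inducing the weight `i` component. -/
def Cell.emb (i : Λ) : Cell (structAlg Y) ⥤ Cell A where
  obj X := ⟨X.U, i⟩
  map f := Cell.scal f.hle f.val i
  map_id X := by
    ext
    exact map_one (A.str X.U)
  map_comp {X Z W} f g := by
    refine Eq.trans ?_ (Cell.scal_comp f.hle g.hle f.val g.val i).symm
    rfl

/-- The weight `i` component of a graded module. -/
def weight (i : Λ) : GrMod A ⥤ QCoh Y where
  obj M :=
    { obj := Cell.emb A i ⋙ M.obj
      property :=
        { map_add := fun {X Z} p q r e => M.property.map_add _ _ _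
            ((congrArg (A.str Z.U) e).trans (map_add (A.str Z.U) _ _))
          qc_surj := fun U f _ y => M.property.qc_surj U f i y
          qc_inj := fun U f _ x hx => M.property.qc_inj U f i x hx } }
  map α := ObjectProperty.homMk (Functor.whiskerLeft (Cell.emb A i) α.hom)

instance (i : Λ) : (weight (A := A) i).Additive where

end modules

section torsion

variable (A) in
/-- The graded ideal of `A` over `U` generated by the elements whose degree lies in `S`. -/
def degIdeal (S : Set Λ) (U : Y.affineOpens) : Ideal (A.obj U) :=
  Ideal.span (⋃ i ∈ S, (A.deg U i : Set (A.obj U)))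

/-- The torsion sections, i.e. those killed by a power of the ideal generated by the elements
whose degree lies in `S`. -/
def torsSec (S : Set Λ) (M : Cell A ⥤ AddCommGrpCat.{u}) (X : Cell A) :
    AddSubgroup (M.obj X) where
  carrier := {m | ∃ n : ℕ, ∀ (Z : Cell A) (f : X ⟶ Z), f.val ∈ degIdeal A S Z.U ^ n →
    M.map f m = 0}
  zero_mem' := ⟨0, fun Z f _ => map_zero (M.map f).hom⟩
  add_mem' := by
    rintro x y ⟨n, hx⟩ ⟨k, hy⟩
    refine ⟨max n k, fun Z f hf => ?_⟩
    rw [map_add, hx Z f (Ideal.pow_le_pow_right (le_max_left n k) hf),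
      hy Z f (Ideal.pow_le_pow_right (le_max_right n k) hf), add_zero]
  neg_mem' := by
    rintro x ⟨n, hx⟩
    refine ⟨n, fun Z f hf => ?_⟩
    rw [map_neg, hx Z f hf, neg_zero]

lemma torsSec_map (S : Set Λ) (M : Cell A ⥤ AddCommGrpCat.{u}) {X Z : Cell A} (f : X ⟶ Z)
    (x : M.obj X) (hx : x ∈ torsSec S M X) : M.map f x ∈ torsSec S M Z := by
  obtain ⟨n, h⟩ := hx
  refine ⟨n, fun W g hg => ?_⟩
  refine (ConcreteCategory.congr_hom (M.map_comp f g) x).symm.trans (h W (f ≫ g) ?_)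
  exact Ideal.mul_mem_right _ _ hg

/-- The presheaf of torsion sections. -/
def torsPre (S : Set Λ) : GrMod A ⥤ (Cell A ⥤ AddCommGrpCat.{u}) where
  obj M := subFunctor M.obj (torsSec S M.obj) fun f x hx => torsSec_map S M.obj f x hx
  map {M M'} α :=
    { app := fun X => AddCommGrpCat.ofHom
        (((α.hom.app X).hom.comp (torsSec S M.obj X).subtype).codRestrict (torsSec S M'.obj X)
          fun x => by
            obtain ⟨n, h⟩ := x.2
            refine ⟨n, fun Z f hf => ?_⟩
            refine (ConcreteCategory.congr_hom (α.hom.naturality f) x.1).symm.trans ?_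
            exact (congrArg (α.hom.app Z) (h Z f hf)).trans (map_zero (α.hom.app Z).hom))
      naturality := fun X Z f => by
        refine ConcreteCategory.hom_ext _ _ fun x => Subtype.ext ?_
        exact ConcreteCategory.congr_hom (α.hom.naturality f) x.1 }

instance (S : Set Λ) : (torsPre (A := A) S).Additive where

/-- The inclusion of the presheaf of torsion sections. -/
def torsPreι (S : Set Λ) : torsPre (A := A) S ⟶ (isGrMod A).ι where
  app M := subFunctorι M.obj (torsSec S M.obj) fun f x hx => torsSec_map S M.obj f x hx

/-- The functor `M ↦ Γ_I(M)`, the quasi-coherent submodule of torsion sections, where `I` is the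
ideal generated by the elements whose degree lies in `S`. -/
noncomputable def Γtors (S : Set Λ) : GrMod A ⥤ GrMod A := torsPre S ⋙ coherator A

instance (S : Set Λ) : (Γtors (A := A) S).Additive := by
  unfold Γtors
  infer_instance

/-- The inclusion `Γ_I(M) ⟶ M`. -/
noncomputable def Γtorsι (S : Set Λ) : Γtors (A := A) S ⟶ 𝟭 (GrMod A) where
  app M := ObjectProperty.homMk
    ((Adjunction.ofIsLeftAdjoint (isGrMod A).ι).counit.app ((torsPre S).obj M) ≫
      (torsPreι S).app M)
  naturality M M' α := by
    refine ObjectProperty.hom_ext _ ?_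
    have h1 := (Adjunction.ofIsLeftAdjoint (isGrMod A).ι).counit.naturality ((torsPre S).map α)
    have h2 := (torsPreι S).naturality α
    have h3 := congrArg (· ≫ (torsPreι S).app M') h1
    simp only [Category.assoc, Functor.id_map] at h3
    rw [h2, ← Category.assoc] at h3
    simp only [← Category.assoc] at h3
    exact h3

variable (A) in
/-- An injective resolution of `A` in the category of graded modules. -/
noncomputable def resol : CochainComplex (GrMod A) ℤ :=
  (injectiveResolution (selfMod A)).cochainComplex

variable (A) in
/-- The algebra `A`, as a complex of graded modules concentrated in degree zero. -/
noncomputable def selfCpx : CochainComplex (GrMod A) ℤ :=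
  (CochainComplex.singleFunctor (GrMod A) 0).obj (selfMod A)

variable (A) in
/-- The local cohomology complex of `A`, for the ideal generated by the elements whose degree lies
in `S`: the torsion functor applied to an injective resolution of `A`. -/
noncomputable def RΓ (S : Set Λ) : CochainComplex (GrMod A) ℤ :=
  ((Γtors S).mapHomologicalComplex (.up ℤ)).obj (resol A)

variable (A) in
noncomputable def RΓι (S : Set Λ) : RΓ A S ⟶ resol A where
  f _ := (Γtorsι S).app _
  comm' _ _ _ := ((Γtorsι S).naturality _).symm

variable (A) in
/-- The Čech complex of `A`: the cofiber of the map from the local cohomology complex to (an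
injective resolution of) `A`. -/
noncomputable def cech (S : Set Λ) : CochainComplex (GrMod A) ℤ := cokernel (RΓι A S)

variable (A) in
/-- The canonical map from `A` to its Čech complex. -/
noncomputable def eta (S : Set Λ) : selfCpx A ⟶ cech A S :=
  (injectiveResolution (selfMod A)).ι' ≫ cokernel.π (RΓι A S)

end torsion

section flips

/-- The shift of the grading of a complex. -/
noncomputable abbrev twistCpx (a : Λ) :
    CochainComplex (GrMod A) ℤ ⥤ CochainComplex (GrMod A) ℤ :=
  (twist a).mapHomologicalComplex (.up ℤ)

/-- The vanishing in weight `i` of an object of the derived category. -/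
def IsZeroInWeight (i : Λ) (K : DerivedCategory (GrMod A)) : Prop :=
  ∀ n : ℤ, IsZero ((weight i).obj ((DerivedCategory.homologyFunctor (GrMod A) n).obj K))

/-- A morphism of the derived category is a quasi-isomorphism in weight `i`. -/
def QuasiIsoInWeight (i : Λ) {K L : DerivedCategory (GrMod A)} (φ : K ⟶ L) : Prop :=
  ∀ n : ℤ, IsIso ((weight i).map ((DerivedCategory.homologyFunctor (GrMod A) n).map φ))

open DerivedCategory in
/-- A homological flip (if `0 < a`) or a homological flop (if `a = 0`) over `Y`. The ideals
involved are those generated by the elements of positive, resp. negative, degree. -/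
structure HomologicalFlipFlop (Y : Scheme.{u}) where
  ω : CochainComplex (QCoh Y) ℤ
  isDualizing : IsDualizing ω
  A : GradedAlgebra Y ℤ
  isNoetherianRing : ∀ U, IsNoetherianRing (A.obj U)
  isCoherent : IsCoherent ((weight 0).obj (selfMod A))
  a : ℤ
  a_nonneg : 0 ≤ a
  Φpos : Q.obj ((twistCpx a).obj (cech A (Set.Ioi 0))) ⟶ Q.obj (dual ω (cech A (Set.Ioi 0)))
  Φneg : Q.obj ((twistCpx a).obj (cech A (Set.Iio 0))) ⟶ Q.obj (dual ω (cech A (Set.Iio 0)))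
  compat : Q.map ((twistCpx a).map (eta A (Set.Ioi 0))) ≫ Φpos ≫
      Q.map (dualMap ω (eta A (Set.Ioi 0))) =
    Q.map ((twistCpx a).map (eta A (Set.Iio 0))) ≫ Φneg ≫
      Q.map (dualMap ω (eta A (Set.Iio 0)))
  quasiIso_pos : ∀ i, QuasiIsoInWeight i Φpos
  quasiIso_neg : ∀ i, QuasiIsoInWeight i Φneg

end flips

end HFF

/-! Write `C^±` for the Čech complexes of `A` and `D` for the duality. The twisted and rotated local
cohomology triangle `A(a) → C^+(a) → RΓ_{I^+}(A)(a)[1]` and the dual triangle `D(C^-) → D(A) →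
D(RΓ_{I^-}(A))` are linked by `Φ^- ∘ η^-(a)` on the first terms and `D(η^+) ∘ Φ^+` on the second
ones. The resulting square commutes exactly by the compatibility of `Φ^+` and `Φ^-`. `Ψ` is a
completion to a morphism of triangles, hence is independent of `c^±`. If `i ≤ min(-c^+, c^- - a)`,
then `RΓ_{I^-}(A)(a)` and `D(RΓ_{I^+}(A))` vanish in weight `i`, so both given maps are
quasi-isomorphisms in weight `i`, and so is `Ψ`. If `i ≥ max(-c^-, c^+ - a)`, the source and the
target of `Ψ` both vanish in weight `i`.

The bulk of the work shows that `D` is exact. It is represented by the Hom complex into a bounded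
complex of injective quasi-coherent sheaves, formed with the coherator of the sheaf Hom. It must
send short exact sequences of complexes to short exact sequences (`dualShortComplex_shortExact`) and
complexes acyclic in weight `-i` to complexes acyclic in weight `i` (`AcyclicInWeight.dual`). Both
rest on `secExact_homQ`: the internal Hom into one injective sheaf `J` is exact weight by weight,
even on sections over affine open sets.

For this, `exists_sum_push_eq_id` writes `J` as a summand of a finite sum of direct images of
injective modules `I` from affine open sets `U`. By `existsUnique_pushHom`, the coherator of the
sheaf Hom from `M` to such a direct image is the direct image of `Hom(M(U), I)`. This is exact in
`M`, because `I` is injective and restriction from `U` to `U ∩ V`, affine by separatedness, is flat.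
The coherator is compatible with weight components (`existsUnique_weight_coherator`), because taking
weight `i` has the left adjoint `N ↦ N ⊗ A` with a shifted grading.

Boundedness of the dualizing complex reduces the Hom complex to finite products and to a bounded
double complex with exact rows (`exists_of_exact_rows`). Finally, the compatibility is given on `A`,
whereas the triangles involve its injective resolution; `HomologicalFlipFlop.compat_resol` bridges
the two by means of `isIso_Q_map_dualMap`. -/

namespace HFF

/-! ### Sections of quasi-coherent sheaves over affine open sets, as modules -/

section sec
variable {Y : Scheme.{u}}

/-- The sections of a quasi-coherent sheaf over an affine open set. -/
abbrev Sec (G : QCoh Y) (V : Y.affineOpens) : Type u := G.obj.obj ⟨V, PUnit.unit⟩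

variable (G : QCoh Y) {U V W : Y.affineOpens}

instance : Module Γ(Y, V.1) (Sec G V) := secModule G.obj G.property V

namespace Sec

/-- The restriction of sections. -/
def res (h : V ≤ U) : Sec G U →+ Sec G V := (G.obj.map (Cell.scal h 1 PUnit.unit)).hom

lemma map_scal (h : V ≤ U) (r : Γ(Y, V.1)) (x : Sec G U) :
    G.obj.map (Cell.scal h r PUnit.unit) x = r • res G h x := by
  refine Eq.trans ?_ (map_scal_scal G.obj h le_rfl 1 r PUnit.unit x).symm
  rw [map_one, mul_one]

lemma res_smul (h : V ≤ U) (r : Γ(Y, U.1)) (x : Sec G U) :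
    res G h (r • x) = rs h r • res G h x := by
  rw [← map_scal]
  refine (map_scal_scal G.obj le_rfl h r 1 PUnit.unit x).trans ?_
  rw [one_mul]

lemma res_res (h : V ≤ U) (h' : W ≤ V) (x : Sec G U) :
    res G h' (res G h x) = res G (h'.trans h) x := by
  refine (map_scal_scal G.obj h h' 1 1 PUnit.unit x).trans ?_
  rw [map_one, mul_one]
  rfl

lemma res_self (h : V ≤ V) (x : Sec G V) : res G h x = x := map_scal_one _ _ G.obj x

lemma exists_res_eq (f : Γ(Y, U.1)) (y : Sec G (Y.affineBasicOpen f)) :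
    ∃ (n : ℕ) (x : Sec G U), res G (Y.affineBasicOpen_le f) x =
      rs (Y.affineBasicOpen_le f) f ^ n • y :=
  G.property.qc_surj U f PUnit.unit y

lemma exists_pow_smul_eq_zero (f : Γ(Y, U.1)) (x : Sec G U)
    (hx : res G (Y.affineBasicOpen_le f) x = 0) : ∃ n : ℕ, f ^ n • x = 0 :=
  G.property.qc_inj U f PUnit.unit x hx

variable {G} in
/-- Two sections which agree on a family of basic open sets covering `U` are equal. -/
lemma eq_zero_of_span (s : Set Γ(Y, U.1)) (hs : Ideal.span s = ⊤) (x : Sec G U)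
    (h : ∀ f ∈ s, res G (Y.affineBasicOpen_le f) x = 0) : x = 0 := by
  refine (Submodule.mem_bot Γ(Y, U.1)).1
    (Submodule.mem_of_span_eq_top_of_smul_pow_mem ⊥ s hs x fun f => ?_)
  exact exists_pow_smul_eq_zero G _ x (h f f.2)

end Sec

variable {G} in
lemma app_smul {G' : QCoh Y} (α : G ⟶ G') (r : Γ(Y, V.1)) (x : Sec G V) :
    (α.hom.app ⟨V, PUnit.unit⟩ (r • x : Sec G V) : Sec G' V) = r • (α.hom.app ⟨V, PUnit.unit⟩ x : Sec G' V) :=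
  ConcreteCategory.congr_hom (α.hom.naturality _) x

end sec


/-! ### Base change can be checked locally -/

section algebra
open TensorProduct

/-- Membership in an `S`-submodule is local on `Spec S`. The covering functions are taken from `R`,
so that one and the same `f` localizes both `R`-modules and `S`-modules. -/
lemma mem_of_span_image_eq_top {R S Q : Type*} [CommRing R] [CommRing S] [Algebra R S]
    [AddCommGroup Q] [Module R Q] [Module S Q] [IsScalarTower R S Q] (s : Set R)
    (hs : Ideal.span (algebraMap R S '' s) = ⊤) (N : Submodule S Q) (x : Q)
    (H : ∀ f : s, ∃ n : ℕ, f.1 ^ n • x ∈ N) : x ∈ N := by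
  refine N.mem_of_span_eq_top_of_smul_pow_mem _ hs x ?_
  rintro ⟨_, f, hf, rfl⟩
  obtain ⟨n, hn⟩ := H ⟨f, hf⟩
  exact ⟨n, by simpa only [← map_pow, algebraMap_smul] using hn⟩

/-- A map to an `S`-module is a base change along `R → S` if it is so over a family of basic open
subsets of `Spec R` covering `Spec S`. -/
theorem isBaseChange_of_span {R S M P : Type*} [CommRing R] [CommRing S] [Algebra R S]
    [AddCommGroup M] [Module R M] [AddCommGroup P] [Module R P] [Module S P] [IsScalarTower R S P]
    (φ : M →ₗ[R] P) (s : Set R) (hs : Ideal.span (algebraMap R S '' s) = ⊤)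
    (S' : s → Type*) [∀ f, CommRing (S' f)] [∀ f, Algebra R (S' f)]
    [∀ f : s, IsLocalization.Away f.1 (S' f)] (a : ∀ f, S →ₗ[R] S' f)
    [∀ f : s, IsLocalizedModule (.powers f.1) (a f)]
    (P' : s → Type*) [∀ f, AddCommGroup (P' f)] [∀ f, Module R (P' f)] [∀ f, Module (S' f) (P' f)]
    [∀ f, IsScalarTower R (S' f) (P' f)] (ρ : ∀ f, P →ₗ[R] P' f)
    [∀ f : s, IsLocalizedModule (.powers f.1) (ρ f)]
    [∀ f : s, IsLocalizedModule (.powers f.1) (ρ f ∘ₗ φ)]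
    (hρ : ∀ f x p, ρ f (x • p) = a f x • ρ f p) : IsBaseChange S φ := by
  -- The plan is to show that `b` is bijective. Localizing at `f` turns it into the base change of
  -- `M` along `R → R_f` (`sq`), which is bijective (`bij`); so kernel elements die, and arbitrary
  -- elements enter the image, after multiplication by a power of `f`.
  let b : S ⊗[R] M →ₗ[S] P := LinearMap.liftBaseChange S φ
  have hb : ∀ x m, b (x ⊗ₜ m) = x • φ m := fun x m => by simp [b]
  have sq : ∀ f z, ρ f (b z) = LinearMap.liftBaseChange (S' f) (ρ f ∘ₗ φ)
      ((a f).rTensor M z) := by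
    intro f z
    induction z with
    | zero => simp
    | add x y hx hy => simp only [map_add, hx, hy]
    | tmul x m => simp [hb, hρ]
  have bij : ∀ f : s, Function.Bijective (LinearMap.liftBaseChange (S' f) (ρ f ∘ₗ φ)) := by
    intro f
    have h := IsLocalizedModule.isBaseChange (.powers f.1) (S' f) (ρ f ∘ₗ φ)
    have e : LinearMap.liftBaseChange (S' f) (ρ f ∘ₗ φ) = h.equiv.toLinearMap := by
      ext m
      simp
    rw [e]
    exact h.equiv.bijective
  have loc : ∀ f : s, IsLocalizedModule (.powers f.1) ((a f).rTensor M) := fun f =>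
    inferInstanceAs (IsLocalizedModule (.powers f.1)
      (TensorProduct.AlgebraTensorModule.rTensor R M (a f)))
  have hbij : Function.Bijective b := by
    constructor
    · refine (injective_iff_map_eq_zero b).2 fun x hx => ?_
      refine (Submodule.mem_bot S).1 (mem_of_span_image_eq_top s hs ⊥ x fun f => ?_)
      have e : (a f).rTensor M x = 0 := by
        apply (bij f).1
        rw [← sq, hx, map_zero, map_zero]
      obtain ⟨⟨_, n, rfl⟩, hn⟩ := (IsLocalizedModule.eq_zero_iff (.powers f.1) _).1 e
      exact ⟨n, (Submodule.mem_bot S).2 hn⟩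
    · intro y
      refine mem_of_span_image_eq_top s hs (LinearMap.range b) y fun f => ?_
      obtain ⟨z, hz⟩ := (bij f).2 (ρ f y)
      obtain ⟨⟨x, _, n, rfl⟩, hx⟩ := IsLocalizedModule.surj (.powers f.1) ((a f).rTensor M) z
      have e : ρ f (f.1 ^ n • y - b x) = 0 := by
        rw [map_sub, map_smul, sq, ← hx, ← hz]
        exact sub_eq_zero.2 (((LinearMap.liftBaseChange (S' f) (ρ f ∘ₗ φ)).restrictScalars R
          |>.map_smul (f.1 ^ n) z).symm)
      obtain ⟨⟨_, m, rfl⟩, hm⟩ := (IsLocalizedModule.eq_zero_iff (.powers f.1) _).1 e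
      -- The exponent `n` clears the denominator in the localization, and `m` kills the difference
      -- that remains before localizing.
      refine ⟨m + n, ⟨f.1 ^ m • x, ?_⟩⟩
      have hm' : f.1 ^ m • (f.1 ^ n • y - b x) = 0 := hm
      rw [smul_sub, sub_eq_zero, smul_smul, ← pow_add] at hm'
      rw [hm']
      exact (b.restrictScalars R).map_smul _ _
  refine IsBaseChange.of_equiv (LinearEquiv.ofBijective b hbij) fun x => ?_
  simp [hb]

end algebra

lemma rs_rs {Y : Scheme.{u}} {U V W : Y.affineOpens} (h : V ≤ U) (h' : W ≤ V) (r : Γ(Y, U.1)) :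
    rs h' (rs h r) = rs (h'.trans h) r := (structAlg Y).res_res h h' r

/-! ### Restriction between affine open sets as localization and base change -/

namespace Sec
variable {Y : Scheme.{u}} (G : QCoh Y) {U V W : Y.affineOpens}

/-- The quasi-coherence condition for an affine open set that is only propositionally a basic open
set. One open set often occurs as a basic open set of several larger ones. -/
lemma exists_res_eq_of_eq (f : Γ(Y, U.1)) (h : V ≤ U) (e : V.1 = Y.basicOpen f) (y : Sec G V) :
    ∃ (n : ℕ) (x : Sec G U), res G h x = rs h f ^ n • y := by
  obtain rfl : V = Y.affineBasicOpen f := Subtype.ext e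
  exact exists_res_eq G f y

lemma exists_pow_smul_eq_zero_of_eq (f : Γ(Y, U.1)) (h : V ≤ U) (e : V.1 = Y.basicOpen f)
    (x : Sec G U) (hx : res G h x = 0) : ∃ n : ℕ, f ^ n • x = 0 := by
  obtain rfl : V = Y.affineBasicOpen f := Subtype.ext e
  exact exists_pow_smul_eq_zero G f x hx

lemma isUnit_rs_of_eq (f : Γ(Y, U.1)) (h : V ≤ U) (e : V.1 = Y.basicOpen f) :
    IsUnit (rs h f) := by
  obtain rfl : V = Y.affineBasicOpen f := Subtype.ext e
  exact isUnit_rs U f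

/-- Restriction to a basic open set is a localization. -/
lemma isLocalizedModule_of_eq {R M N : Type u} [CommRing R] [AddCommGroup M] [Module R M]
    [AddCommGroup N] [Module R N] (φ : M →ₗ[R] N)
    (ρ : R →+* Γ(Y, U.1)) (eM : M ≃+ Sec G U) (hM : ∀ (r : R) m, eM (r • m) = ρ r • eM m)
    (h : V ≤ U) (eN : N ≃+ Sec G V) (hN : ∀ (r : R) n, eN (r • n) = rs h (ρ r) • eN n)
    (hφ : ∀ m, eN (φ m) = res G h (eM m)) (f : R) (e : V.1 = Y.basicOpen (ρ f)) :
    IsLocalizedModule (.powers f) φ where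
  map_units := by
    rintro ⟨_, n, rfl⟩
    have hu := (isUnit_rs_of_eq (ρ f) h e).pow n
    rw [Module.End.isUnit_iff]
    constructor
    · intro x y hxy
      apply eN.injective
      apply hu.smul_left_cancel.1
      simpa [← map_pow, ← hN] using hxy
    · intro y
      refine ⟨eN.symm ((hu.unit⁻¹ : _ˣ).1 • eN y), ?_⟩
      apply eN.injective
      have : (f ^ n) • eN.symm ((hu.unit⁻¹ : _ˣ).1 • eN y) = y := by
        apply eN.injective
        rw [hN, eN.apply_symm_apply, map_pow, map_pow, smul_smul, IsUnit.mul_val_inv, one_smul]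
      exact congrArg eN this
  surj y := by
    obtain ⟨n, x, hx⟩ := exists_res_eq_of_eq G (ρ f) h e (eN y)
    refine ⟨⟨eM.symm x, ⟨_, n, rfl⟩⟩, ?_⟩
    apply eN.injective
    rw [hφ, eM.apply_symm_apply, hx]
    exact (hN _ _).trans (by simp)
  exists_of_eq {x y} hxy := by
    have h0 : res G h (eM (x - y)) = 0 := by rw [← hφ, map_sub, hxy, sub_self, map_zero]
    obtain ⟨n, hn⟩ := exists_pow_smul_eq_zero_of_eq G (ρ f) h e _ h0
    refine ⟨⟨_, n, rfl⟩, ?_⟩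
    have : f ^ n • (x - y) = 0 := by
      apply eM.injective
      rw [hM, map_pow, hn, map_zero]
    exact sub_eq_zero.1 ((smul_sub _ _ _).symm.trans this)

/-- The basic open sets of `U` form a basis, so those contained in `W` cover `W`; each of them is
also the basic open set in `W` of the restricted function. -/
lemma span_image_rs (h : W ≤ U) :
    Ideal.span (rs h '' {f : Γ(Y, U.1) | Y.affineBasicOpen f ≤ W}) = ⊤ := by
  rw [← W.2.self_le_iSup_basicOpen_iff]
  intro x hx
  obtain ⟨f, hf, hxf⟩ := U.2.exists_basicOpen_le ⟨x, hx⟩ (h hx)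
  refine TopologicalSpace.Opens.mem_iSup.2 ⟨⟨rs h f, f, hf, rfl⟩, ?_⟩
  change x ∈ Y.basicOpen (Y.presheaf.map (homOfLE (show W.1 ≤ U.1 from h)).op f)
  rw [Y.basicOpen_res]
  exact ⟨hx, hxf⟩

/-- The sections over a smaller affine open set are obtained by base change. -/
theorem exists_isBaseChange (h : W ≤ U) :
    letI : Algebra Γ(Y, U.1) Γ(Y, W.1) := (rs h).toAlgebra
    letI : Module Γ(Y, U.1) (Sec G W) := Module.compHom _ (rs h)
    haveI : IsScalarTower Γ(Y, U.1) Γ(Y, W.1) (Sec G W) := ⟨fun r s x => mul_smul (rs h r) s x⟩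
    ∃ φ : Sec G U →ₗ[Γ(Y, U.1)] Sec G W, (∀ x, φ x = res G h x) ∧ IsBaseChange Γ(Y, W.1) φ := by
  let : Algebra Γ(Y, U.1) Γ(Y, W.1) := (rs h).toAlgebra
  let : Module Γ(Y, U.1) (Sec G W) := Module.compHom _ (rs h)
  have : IsScalarTower Γ(Y, U.1) Γ(Y, W.1) (Sec G W) := ⟨fun r s x => mul_smul (rs h r) s x⟩
  let φ : Sec G U →ₗ[Γ(Y, U.1)] Sec G W :=
    { res G h with map_smul' := fun r x => res_smul G h r x }
  refine ⟨φ, fun _ => rfl, ?_⟩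
  let s := {f : Γ(Y, U.1) | Y.affineBasicOpen f ≤ W}
  let D (f : s) := Y.affineBasicOpen f.1
  have hD (f : s) : D f ≤ W := f.2
  let (f : s) : Algebra Γ(Y, U.1) Γ(Y, (D f).1) := (rs (Y.affineBasicOpen_le f.1)).toAlgebra
  let (f : s) : Algebra Γ(Y, W.1) Γ(Y, (D f).1) := (rs (hD f)).toAlgebra
  have (f : s) : IsScalarTower Γ(Y, U.1) Γ(Y, W.1) Γ(Y, (D f).1) :=
    IsScalarTower.of_algebraMap_eq fun r => ((structAlg Y).res_res h (hD f) r).symm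
  let (f : s) : Module Γ(Y, U.1) (Sec G (D f)) :=
    Module.compHom _ (rs (Y.affineBasicOpen_le f.1))
  have (f : s) : IsScalarTower Γ(Y, U.1) Γ(Y, (D f).1) (Sec G (D f)) :=
    ⟨fun r s x => mul_smul (rs (Y.affineBasicOpen_le f.1) r) s x⟩
  have (f : s) : IsLocalization.Away f.1 Γ(Y, (D f).1) :=
    U.2.isLocalization_of_eq_basicOpen f.1 (homOfLE (Y.affineBasicOpen_le f.1)) rfl
  let a (f : s) : Γ(Y, W.1) →ₗ[Γ(Y, U.1)] Γ(Y, (D f).1) :=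
    (IsScalarTower.toAlgHom Γ(Y, U.1) Γ(Y, W.1) Γ(Y, (D f).1)).toLinearMap
  -- Since `D(f)` lies in `W`, it is a basic open set both of `U` and of `W`. Hence restriction to
  -- it is a localization at `f` from either of them, as `isBaseChange_of_span` requires.
  have eD (f : s) : (D f).1 = Y.basicOpen (rs h f.1) := by
    refine Eq.trans ?_ (Y.basicOpen_res f.1 (homOfLE (show W.1 ≤ U.1 from h)).op).symm
    exact (inf_eq_right.2 (hD f)).symm
  have (f : s) : IsLocalizedModule (.powers f.1) (a f) := by
    have : IsLocalization.Away (rs h f.1) Γ(Y, (D f).1) :=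
      W.2.isLocalization_of_eq_basicOpen (rs h f.1) (homOfLE (hD f)) (eD f)
    refine isLocalizedModule_iff_isLocalization.2 ?_
    rw [Algebra.algebraMapSubmonoid_powers]
    exact this
  let ρ (f : s) : Sec G W →ₗ[Γ(Y, U.1)] Sec G (D f) :=
    { res G (hD f) with
      map_smul' := fun r x => (res_smul G (hD f) (rs h r) x).trans
        (congrArg (· • _) ((structAlg Y).res_res h (hD f) r)) }
  have (f : s) : IsLocalizedModule (.powers f.1) (ρ f) :=
    isLocalizedModule_of_eq G (ρ f) (rs h) (AddEquiv.refl _) (fun r m => rfl) (hD f)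
      (AddEquiv.refl _) (fun r n => by rw [rs_rs]; rfl)
      (fun _ => rfl) f.1 (eD f)
  have (f : s) : IsLocalizedModule (.powers f.1) (ρ f ∘ₗ φ) :=
    isLocalizedModule_of_eq G (ρ f ∘ₗ φ) (RingHom.id _) (AddEquiv.refl _) (fun r m => rfl)
      (Y.affineBasicOpen_le f.1) (AddEquiv.refl _) (fun r n => rfl)
      (fun x => res_res G h (hD f) x) f.1 rfl
  exact isBaseChange_of_span φ s (span_image_rs h) (fun f => Γ(Y, (D f).1)) a
    (fun f => Sec G (D f)) ρ fun f x p => res_smul G (hD f) x p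

lemma span_range_res (h : W ≤ U) : Submodule.span Γ(Y, W.1) (Set.range (res G h)) = ⊤ := by
  let : Algebra Γ(Y, U.1) Γ(Y, W.1) := (rs h).toAlgebra
  let : Module Γ(Y, U.1) (Sec G W) := Module.compHom _ (rs h)
  have : IsScalarTower Γ(Y, U.1) Γ(Y, W.1) (Sec G W) := ⟨fun r s x => mul_smul (rs h r) s x⟩
  obtain ⟨φ, hφ, hb⟩ := exists_isBaseChange G h
  rw [eq_top_iff]
  rintro y -
  induction y using hb.inductionOn with
  | zero => exact zero_mem _
  | tmul m => exact Submodule.subset_span ⟨m, (hφ m).symm⟩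
  | smul r n hn => exact Submodule.smul_mem _ _ hn
  | add a b ha hb => exact add_mem ha hb

/-- Sections over a smaller affine open set can be mapped by extension of scalars. -/
lemma exists_lift (h : W ≤ U) {Q : Type u} [AddCommGroup Q] [Module Γ(Y, W.1) Q]
    (φ : Sec G U →+ Q) (hφ : ∀ r x, φ (r • x) = rs h r • φ x) :
    ∃ ψ : Sec G W →ₗ[Γ(Y, W.1)] Q, ∀ x, ψ (res G h x) = φ x := by
  let : Algebra Γ(Y, U.1) Γ(Y, W.1) := (rs h).toAlgebra
  let : Module Γ(Y, U.1) (Sec G W) := Module.compHom _ (rs h)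
  have : IsScalarTower Γ(Y, U.1) Γ(Y, W.1) (Sec G W) := ⟨fun r s x => mul_smul (rs h r) s x⟩
  let : Module Γ(Y, U.1) Q := Module.compHom _ (rs h)
  have : IsScalarTower Γ(Y, U.1) Γ(Y, W.1) Q := ⟨fun r s x => mul_smul (rs h r) s x⟩
  obtain ⟨ρ, hρ, hb⟩ := exists_isBaseChange G h
  let φ' : Sec G U →ₗ[Γ(Y, U.1)] Q := { φ with map_smul' := hφ }
  exact ⟨hb.lift φ', fun x => by rw [← hρ, hb.lift_eq]; rfl⟩

end Sec


section
variable {Y : Scheme.{u}} {G : QCoh Y} {U : Y.affineOpens}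

/-- Induction along the base change from `U` to a smaller affine open set. -/
lemma Sec.induction_res {W : Y.affineOpens} (h : W ≤ U) {p : Sec G W → Prop}
    (hres : ∀ x, p (Sec.res G h x)) (hadd : ∀ x y, p x → p y → p (x + y))
    (hsmul : ∀ (r : Γ(Y, W.1)) x, p x → p (r • x)) (x : Sec G W) : p x := by
  have hx : x ∈ Submodule.span Γ(Y, W.1) (Set.range (Sec.res G h)) := by
    rw [Sec.span_range_res]; trivial
  induction hx using Submodule.span_induction with
  | mem _ hx => obtain ⟨y, rfl⟩ := hx; exact hres y
  | zero => simpa using hres 0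
  | add _ _ _ _ h1 h2 => exact hadd _ _ h1 h2
  | smul r _ _ h1 => exact hsmul r _ h1

end

/-! ### Intersections of affine open sets -/

section inter
variable {Y : Scheme.{u}} [Y.IsSeparated]

/-- The intersection of two affine open sets of a separated scheme. -/
def inter (U V : Y.affineOpens) : Y.affineOpens := ⟨U.1 ⊓ V.1, U.2.inf V.2⟩

variable {U V W : Y.affineOpens}

lemma inter_le_left (U V : Y.affineOpens) : inter U V ≤ U := show U.1 ⊓ V.1 ≤ U.1 from inf_le_left

lemma inter_le_right (U V : Y.affineOpens) : inter U V ≤ V := show U.1 ⊓ V.1 ≤ V.1 from inf_le_right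

lemma le_inter (h : W ≤ U) (h' : W ≤ V) : W ≤ inter U V :=
  show W.1 ≤ U.1 ⊓ V.1 from le_inf h h'

lemma inter_mono (U : Y.affineOpens) (h : W ≤ V) : inter U W ≤ inter U V :=
  le_inter (inter_le_left U W) ((inter_le_right U W).trans h)

noncomputable instance (U V : Y.affineOpens) : Algebra Γ(Y, U.1) Γ(Y, (inter U V).1) :=
  (rs (inter_le_left U V)).toAlgebra

/-- The restriction to a smaller set, followed by a multiplication. -/
noncomputable def mulRes (h : inter U W ≤ inter U V) (r : Γ(Y, (inter U W).1)) :
    Γ(Y, (inter U V).1) →ₗ[Γ(Y, U.1)] Γ(Y, (inter U W).1) where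
  toFun s := r * rs h s
  map_add' s t := by rw [map_add, mul_add]
  map_smul' a s := by
    rw [Algebra.smul_def, Algebra.smul_def, map_mul]
    change r * (rs h (rs _ a) * _) = rs _ a * _
    rw [rs_rs, mul_left_comm]

lemma mulRes_apply (h : inter U W ≤ inter U V) (r s) : mulRes h r s = r * rs h s := rfl

lemma mulRes_comp {Z : Y.affineOpens} (h : inter U W ≤ inter U V) (h' : inter U Z ≤ inter U W)
    (r : Γ(Y, (inter U W).1)) (s : Γ(Y, (inter U Z).1)) :
    mulRes h' s ∘ₗ mulRes h r = mulRes (h'.trans h) (s * rs h' r) := by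
  ext t
  simp only [LinearMap.comp_apply, mulRes_apply, map_mul, rs_rs, mul_assoc]

lemma mulRes_self (h : inter U V ≤ inter U V) : mulRes h 1 = LinearMap.id := by
  ext t
  simp [mulRes_apply, rs_self]

lemma mulRes_add (h : inter U W ≤ inter U V) (r s : Γ(Y, (inter U W).1)) :
    mulRes h (r + s) = mulRes h r + mulRes h s := by
  ext t
  simp [mulRes_apply, add_mul]

end inter

/-! ### Direct images of modules from an affine open set -/

section push
open TensorProduct

/-- The presheaf of modules given by a family of groups with restriction maps and scalar
multiplications. -/
def ofSections {Y : Scheme.{u}} (S : Y.affineOpens → Type u) [∀ V, AddCommGroup (S V)]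
    (m : ∀ {V W : Y.affineOpens}, W ≤ V → Γ(Y, W.1) → (S V →+ S W))
    (m_one : ∀ {V} (x : S V), m le_rfl 1 x = x)
    (m_mul : ∀ {V W Z : Y.affineOpens} (h : W ≤ V) (h' : Z ≤ W) (r : Γ(Y, W.1)) (s : Γ(Y, Z.1))
      (x : S V), m (h'.trans h) (s * rs h' r) x = m h' s (m h r x)) :
    Cell (structAlg Y) ⥤ AddCommGrpCat.{u} where
  obj X := AddCommGrpCat.of (S X.U)
  map f := AddCommGrpCat.ofHom (m f.hle f.val)
  map_id X := ConcreteCategory.hom_ext _ _ m_one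
  map_comp f g := ConcreteCategory.hom_ext _ _ (m_mul f.hle g.hle f.val g.val)

/-- A morphism of presheaves of modules given by a family of maps. -/
def natOfSections {Y : Scheme.{u}} {F P : Cell (structAlg Y) ⥤ AddCommGrpCat.{u}}
    (t : ∀ V : Y.affineOpens, F.obj ⟨V, PUnit.unit⟩ →+ P.obj ⟨V, PUnit.unit⟩)
    (ht : ∀ {V W : Y.affineOpens} (h : W ≤ V) (r : Γ(Y, W.1)) (x : F.obj ⟨V, PUnit.unit⟩),
      t W (F.map (Cell.scal h r PUnit.unit) x) = P.map (Cell.scal h r PUnit.unit) (t V x)) :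
    F ⟶ P where
  app X := AddCommGrpCat.ofHom (t X.U)
  naturality _ _ f := ConcreteCategory.hom_ext _ _ fun x => ht f.hle f.val x

lemma isGrMod_ofSections {Y : Scheme.{u}} (S : Y.affineOpens → Type u) [∀ V, AddCommGroup (S V)]
    (m : ∀ {V W : Y.affineOpens}, W ≤ V → Γ(Y, W.1) → (S V →+ S W)) (m_one) (m_mul)
    (m_add : ∀ {V W : Y.affineOpens} (h : W ≤ V) (r s : Γ(Y, W.1)) (x : S V),
      m h (r + s) x = m h r x + m h s x)
    (qc_surj : ∀ (U : Y.affineOpens) (f : Γ(Y, U.1)) (y : S (Y.affineBasicOpen f)),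
      ∃ (n : ℕ) (x : S U), m (Y.affineBasicOpen_le f) 1 x =
        m le_rfl (rs (Y.affineBasicOpen_le f) f ^ n) y)
    (qc_inj : ∀ (U : Y.affineOpens) (f : Γ(Y, U.1)) (x : S U),
      m (Y.affineBasicOpen_le f) 1 x = 0 → ∃ n : ℕ, m le_rfl (f ^ n) x = 0) :
    IsGrMod (ofSections S m m_one m_mul) where
  map_add := fun {_ _} a b c e => by
    refine ConcreteCategory.hom_ext _ _ fun x => ?_
    refine Eq.trans ?_ (m_add a.hle a.val b.val x)
    exact congrArg (fun t => m c.hle t x) e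
  qc_surj U f _ y := qc_surj U f y
  qc_inj U f _ x hx := qc_inj U f x hx
variable {Y : Scheme.{u}} [Y.IsSeparated] (U : Y.affineOpens) (N : Type u) [AddCommGroup N]
  [Module Γ(Y, U.1) N]

/-- The extension of scalars of a module over an affine open set to its intersection with `V`. -/
abbrev PushSec (V : Y.affineOpens) : Type u := Γ(Y, (inter U V).1) ⊗[Γ(Y, U.1)] N

variable {U} {V W : Y.affineOpens}

/-- The restriction of sections of a direct image. -/
noncomputable def pushRes (h : inter U W ≤ inter U V) : PushSec U N V →ₗ[Γ(Y, U.1)] PushSec U N W :=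
  (mulRes h 1).rTensor N

lemma rTensor_mulRes (h : inter U W ≤ inter U V) (r : Γ(Y, (inter U W).1)) (x : PushSec U N V) :
    (mulRes h r).rTensor N x = r • pushRes N h x := by
  induction x using TensorProduct.induction_on with
  | zero => simp
  | add x y hx hy => rw [map_add, map_add, hx, hy, smul_add]
  | tmul s n => simp [pushRes, mulRes_apply, smul_tmul']

@[simp] lemma pushRes_tmul (h : inter U W ≤ inter U V) (s : Γ(Y, (inter U V).1)) (n : N) :
    pushRes N h (s ⊗ₜ n) = rs h s ⊗ₜ n := by
  simp [pushRes, mulRes_apply]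

lemma pushRes_smul (h : inter U W ≤ inter U V) (s : Γ(Y, (inter U V).1)) (x : PushSec U N V) :
    pushRes N h (s • x) = rs h s • pushRes N h x := by
  induction x using TensorProduct.induction_on with
  | zero => simp
  | add x y hx hy => rw [smul_add, map_add, map_add, hx, hy, smul_add]
  | tmul t n => simp [smul_tmul']

lemma pushRes_pushRes {Z : Y.affineOpens} (h : inter U W ≤ inter U V) (h' : inter U Z ≤ inter U W)
    (x : PushSec U N V) : pushRes N h' (pushRes N h x) = pushRes N (h'.trans h) x := by
  induction x using TensorProduct.induction_on with
  | zero => simp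
  | add x y hx hy => simp only [map_add, hx, hy]
  | tmul t n => simp [rs_rs]

lemma pushRes_self (h : inter U V ≤ inter U V) (x : PushSec U N V) : pushRes N h x = x := by
  rw [pushRes, mulRes_self, LinearMap.rTensor_id]
  rfl

/-- Inclusions in both directions make the restriction invertible. The case of interest is `U ∩ W`
and `U ∩ (U ∩ W)`, equal sets presented by different terms. -/
lemma pushRes_injective (h : inter U W ≤ inter U V) (h' : inter U V ≤ inter U W) :
    Function.Injective (pushRes N h) := fun x y e => by
  have := congrArg (pushRes N h') e
  rwa [pushRes_pushRes, pushRes_pushRes, pushRes_self, pushRes_self] at this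

variable (U) in
/-- The direct image of the quasi-coherent sheaf associated with a module over an affine open set,
as a presheaf. -/
noncomputable def pushPre : Cell (structAlg Y) ⥤ AddCommGrpCat.{u} :=
  ofSections (PushSec U N)
    (fun {_ W} h r => ((mulRes (inter_mono U h) (rs (inter_le_right U W) r)).rTensor N).toAddMonoidHom)
    (fun x => (rTensor_mulRes N _ _ x).trans (by rw [map_one, one_smul, pushRes_self]))
    (fun h h' r s x => by
      change (mulRes _ _).rTensor N x = (mulRes _ _).rTensor N ((mulRes _ _).rTensor N x)
      rw [← LinearMap.comp_apply, ← LinearMap.rTensor_comp, mulRes_comp, map_mul, rs_rs, rs_rs])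

/-- The set `U ∩ D(f)` is the basic open set of `f` inside the affine open set `U ∩ V`, and
tensoring over `Γ(Y, U)` with `N` preserves localizations at `f`. This is the quasi-coherence of the
direct image. -/
lemma isLocalizedModule_pushRes (f : Γ(Y, V.1)) :
    let D := Y.affineBasicOpen f
    let h : inter U D ≤ inter U V := inter_mono U (Y.affineBasicOpen_le f)
    let g := rs (inter_le_right U V) f
    (∀ y : PushSec U N D, ∃ (n : ℕ) (x : PushSec U N V), pushRes N h x = rs h g ^ n • y) ∧
      ∀ x : PushSec U N V, pushRes N h x = 0 → ∃ n : ℕ, g ^ n • x = 0 := by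
  intro D h g
  let : Algebra Γ(Y, (inter U V).1) Γ(Y, (inter U D).1) := (rs h).toAlgebra
  have : IsScalarTower Γ(Y, U.1) Γ(Y, (inter U V).1) Γ(Y, (inter U D).1) :=
    IsScalarTower.of_algebraMap_eq fun r => (rs_rs _ h r).symm
  have e : (inter U D).1 = Y.basicOpen g := by
    refine Eq.trans ?_
      (Y.basicOpen_res f (homOfLE (show (inter U V).1 ≤ V.1 from inter_le_right U V)).op).symm
    change U.1 ⊓ Y.basicOpen f = (U.1 ⊓ V.1) ⊓ Y.basicOpen f
    rw [inf_assoc, inf_eq_right.2 (Y.basicOpen_le f)]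
  have : IsLocalization.Away g Γ(Y, (inter U D).1) :=
    (inter U V).2.isLocalization_of_eq_basicOpen g (homOfLE h) e
  let a := Algebra.linearMap Γ(Y, (inter U V).1) Γ(Y, (inter U D).1)
  have : IsLocalizedModule (.powers g) a :=
    isLocalizedModule_iff_isLocalization.2 (by
      rw [Algebra.algebraMapSubmonoid_powers]
      exact this)
  let b := TensorProduct.AlgebraTensorModule.rTensor Γ(Y, U.1) N a
  have hb : IsLocalizedModule (.powers g) b := inferInstance
  have hab : ∀ x, b x = pushRes N h x := by
    intro x
    induction x using TensorProduct.induction_on with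
    | zero => simp
    | add x y hx hy => simp only [map_add, hx, hy]
    | tmul t n => simp [b, a]; rfl
  refine ⟨fun y => ?_, fun x hx => ?_⟩
  · obtain ⟨⟨x, _, n, rfl⟩, hx⟩ := IsLocalizedModule.surj (.powers g) b y
    refine ⟨n, x, ?_⟩
    rw [← hab, ← hx, ← map_pow]
    exact (algebraMap_smul Γ(Y, (inter U D).1) (g ^ n) y).symm
  · rw [← hab] at hx
    obtain ⟨⟨_, n, rfl⟩, hn⟩ := (IsLocalizedModule.eq_zero_iff (.powers g) b).1 hx
    exact ⟨n, hn⟩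

variable (U) in
/-- The direct image on `Y` of the quasi-coherent sheaf associated with a module over an affine
open set. -/
noncomputable def push : QCoh Y where
  obj := pushPre U N
  property := by
    refine isGrMod_ofSections _ _ _ _ ?_ ?_ ?_
    · intro V W h r s x
      change (mulRes _ _).rTensor N x = (mulRes _ _).rTensor N x + (mulRes _ _).rTensor N x
      rw [← LinearMap.add_apply, ← LinearMap.rTensor_add, ← mulRes_add, ← map_add]
    · intro V f y
      obtain ⟨n, x, e⟩ := (isLocalizedModule_pushRes (U := U) N f).1 y
      refine ⟨n, x, ?_⟩
      refine (rTensor_mulRes N _ _ x).trans (Eq.trans ?_ (rTensor_mulRes N _ _ y).symm)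
      rw [map_one, one_smul, pushRes_self, map_pow, rs_rs]
      rw [rs_rs] at e
      exact e
    · intro V f x hx
      have e := (rTensor_mulRes N _ _ x).symm.trans hx
      rw [map_one, one_smul] at e
      obtain ⟨n, hn⟩ := (isLocalizedModule_pushRes (U := U) N f).2 x e
      refine ⟨n, (rTensor_mulRes N _ _ x).trans ?_⟩
      rw [pushRes_self, map_pow]
      exact hn

variable (U V) in
/-- The sections of the direct image. -/
noncomputable def pushEquiv : PushSec U N V ≃+ Sec (push U N) V where
  toFun x := x
  invFun x := x
  left_inv _ := rfl
  right_inv _ := rfl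
  map_add' _ _ := rfl

lemma push_map (h : W ≤ V) (r : Γ(Y, W.1)) (x : PushSec U N V) :
    (push U N).obj.map (Cell.scal h r PUnit.unit) (pushEquiv U N V x) =
      pushEquiv U N W (rs (inter_le_right U W) r • pushRes N (inter_mono U h) x) :=
  rTensor_mulRes N _ _ x

lemma push_res (h : W ≤ V) (x : PushSec U N V) :
    Sec.res (push U N) h (pushEquiv U N V x) =
      pushEquiv U N W (pushRes N (inter_mono U h) x) :=
  (push_map N h 1 x).trans (by rw [map_one, one_smul])

lemma push_smul (r : Γ(Y, V.1)) (x : PushSec U N V) :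
    r • pushEquiv U N V x = pushEquiv U N V (rs (inter_le_right U V) r • x) :=
  (push_map N le_rfl r x).trans (by rw [pushRes_self])

/-- The sections over `U` of the direct image. -/
noncomputable def pushEval : PushSec U N U →ₗ[Γ(Y, U.1)] N :=
  TensorProduct.lift
    { toFun := fun s => (rs (le_inter (le_refl U) (le_refl U)) s) • LinearMap.id
      map_add' := fun s t => by rw [map_add, add_smul]
      map_smul' := fun a s => by
        rw [Algebra.smul_def a s, map_mul, mul_smul]
        refine congrArg (· • (rs (le_inter (le_refl U) (le_refl U)) s • LinearMap.id (M := N))) ?_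
        exact (rs_rs _ _ a).trans (rs_self _ a) }

lemma pushEval_tmul (s : Γ(Y, (inter U U).1)) (n : N) :
    pushEval N (s ⊗ₜ n) = rs (le_inter (le_refl U) (le_refl U)) s • n := rfl

lemma pushEval_one_tmul (n : N) : pushEval N ((1 : Γ(Y, (inter U U).1)) ⊗ₜ n) = n := by
  rw [pushEval_tmul, map_one, one_smul]

lemma one_tmul_pushEval (x : PushSec U N U) :
    (1 : Γ(Y, (inter U U).1)) ⊗ₜ pushEval N x = x := by
  induction x using TensorProduct.induction_on with
  | zero => simp
  | add x y hx hy => rw [map_add, tmul_add, hx, hy]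
  | tmul s n =>
    rw [pushEval_tmul, ← smul_tmul, Algebra.smul_def, mul_one]
    congr 1
    exact (rs_rs _ _ s).trans (rs_self _ s)

end push

/-! ### Morphisms into direct images -/

section lift
open TensorProduct
variable {Y : Scheme.{u}} [Y.IsSeparated] {U : Y.affineOpens} (G : QCoh Y) {N : Type u}
  [AddCommGroup N] [Module Γ(Y, U.1) N] (φ : Sec G U →ₗ[Γ(Y, U.1)] N)

/-- Sections over `U ∩ V` are the extension of scalars of the sections over `U`, so the linear map
`x ↦ 1 ⊗ φ x` extends. -/
lemma exists_pushLift (V : Y.affineOpens) :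
    ∃ ψ : Sec G (inter U V) →ₗ[Γ(Y, (inter U V).1)] PushSec U N V,
      ∀ x, ψ (Sec.res G (inter_le_left U V) x) = 1 ⊗ₜ φ x :=
  Sec.exists_lift G (inter_le_left U V)
    ((TensorProduct.mk Γ(Y, U.1) Γ(Y, (inter U V).1) N 1).toAddMonoidHom.comp φ.toAddMonoidHom)
    fun r x => by
      change 1 ⊗ₜ φ (r • x) = rs _ r • (1 ⊗ₜ φ x)
      rw [map_smul, ← smul_tmul, smul_tmul', Algebra.smul_def]
      rfl

variable {G} in
/-- The map to the direct image induced by a linear map on the sections over `U`. -/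
noncomputable def pushLiftSec (V : Y.affineOpens) :
    Sec G (inter U V) →ₗ[Γ(Y, (inter U V).1)] PushSec U N V :=
  (exists_pushLift G φ V).choose

variable {G}

lemma pushLiftSec_res (V : Y.affineOpens) (x : Sec G U) :
    pushLiftSec φ V (Sec.res G (inter_le_left U V) x) = 1 ⊗ₜ φ x :=
  (exists_pushLift G φ V).choose_spec x

/-- Both sides are semilinear and agree on the restrictions of sections over `U`, which generate. -/
lemma pushRes_pushLiftSec {V W : Y.affineOpens} (h : inter U W ≤ inter U V)
    (x : Sec G (inter U V)) :
    pushRes N h (pushLiftSec φ V x) = pushLiftSec φ W (Sec.res G h x) := by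
  induction x using Sec.induction_res (inter_le_left U V) with
  | hres x => rw [pushLiftSec_res, Sec.res_res, pushLiftSec_res, pushRes_tmul, map_one]
  | hadd x y hx hy => rw [map_add, map_add, map_add, map_add, hx, hy]
  | hsmul r x hx => rw [map_smul, pushRes_smul, hx, Sec.res_smul, map_smul]

/-- The morphism to the direct image induced by a linear map on the sections over `U`. -/
noncomputable def pushLift : G ⟶ push U N :=
  ObjectProperty.homMk
    (natOfSections (fun V => ((pushEquiv U N V).toAddMonoidHom.comp
        (pushLiftSec φ V).toAddMonoidHom).comp (Sec.res G (inter_le_right U V)))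
      fun {V W} h r x => by
        refine Eq.trans ?_ (push_map N h r _).symm
        refine congrArg (pushEquiv U N W) ?_
        refine (congrArg (fun t => pushLiftSec φ W (Sec.res G (inter_le_right U W) t))
          (Sec.map_scal G h r x)).trans ?_
        refine Eq.trans ?_ (congrArg _ (pushRes_pushLiftSec φ (inter_mono U h) _).symm)
        rw [Sec.res_smul, map_smul, Sec.res_res, Sec.res_res])

lemma pushLift_apply_self (x : Sec G U) :
    (pushLift φ).hom.app ⟨U, PUnit.unit⟩ x = pushEquiv U N U (1 ⊗ₜ φ x) :=
  congrArg (pushEquiv U N U) (pushLiftSec_res φ U x)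

end lift


/-! ### Morphisms to the sheaf Hom as bilinear pairings -/

section homSec
variable {Y : Scheme.{u}} {N M G : QCoh Y}

/-- The value, on a section of `M`, of a section of the sheaf Hom. -/
def homApp {V : Y.affineOpens} (φ : (preHomObj M.obj G.obj).obj ⟨V, PUnit.unit⟩)
    {W : Y.affineOpens} (h : W ≤ V) : Sec M W →+ Sec G W :=
  φ.1 ⟨W, h⟩

lemma homApp_smul {V : Y.affineOpens} (φ : (preHomObj M.obj G.obj).obj ⟨V, PUnit.unit⟩)
    {W : Y.affineOpens} (h : W ≤ V) (r : Γ(Y, W.1)) (m : Sec M W) :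
    homApp φ h (r • m) = r • homApp φ h m :=
  φ.2 ⟨W, h⟩ ⟨W, h⟩ le_rfl r m

lemma homApp_res {V : Y.affineOpens} (φ : (preHomObj M.obj G.obj).obj ⟨V, PUnit.unit⟩)
    {W W' : Y.affineOpens} (h : W ≤ V) (h' : W' ≤ W) (m : Sec M W) :
    homApp φ (h'.trans h) (Sec.res M h' m) = Sec.res G h' (homApp φ h m) :=
  φ.2 ⟨W, h⟩ ⟨W', h'.trans h⟩ h' 1 m

lemma homApp_map {V V' : Y.affineOpens} (φ : (preHomObj M.obj G.obj).obj ⟨V, PUnit.unit⟩)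
    (h : V' ≤ V) (r : Γ(Y, V'.1)) {W : Y.affineOpens} (h' : W ≤ V') (m : Sec M W) :
    homApp ((preHomObj M.obj G.obj).map (Cell.scal h r PUnit.unit) φ) h' m =
      homApp φ (h'.trans h) (rs h' r • m) := rfl

lemma homSec_ext {V : Y.affineOpens} {φ ψ : (preHomObj M.obj G.obj).obj ⟨V, PUnit.unit⟩}
    (e : ∀ (W : Y.affineOpens) (h : W ≤ V) (m : Sec M W), homApp φ h m = homApp ψ h m) : φ = ψ :=
  Subtype.ext (funext fun W => AddMonoidHom.ext fun m => e W.1 W.2 m)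

/-- Construct a section of the sheaf Hom. -/
def homMk {V : Y.affineOpens} (t : ∀ W : Y.affineOpens, W ≤ V → (Sec M W →+ Sec G W))
    (ht : ∀ {W W' : Y.affineOpens} (h : W ≤ V) (h' : W' ≤ W) (r : Γ(Y, W'.1)) (m : Sec M W),
      t W' (h'.trans h) (r • Sec.res M h' m) = r • Sec.res G h' (t W h m)) :
    (preHomObj M.obj G.obj).obj ⟨V, PUnit.unit⟩ :=
  ⟨fun W => t W.1 W.2, fun W W' h r m => by
    refine (congrArg (t W'.1 W'.2) (Sec.map_scal M h r m)).trans ?_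
    exact (ht W.2 h r m).trans (Sec.map_scal G h r _).symm⟩

variable (φ : N.obj ⟶ preHomObj M.obj G.obj)

/-- The bilinear map corresponding to a morphism to the sheaf Hom. -/
def bil {V W : Y.affineOpens} (h : W ≤ V) (n : Sec N V) (m : Sec M W) : Sec G W :=
  homApp (φ.app ⟨V, PUnit.unit⟩ n) h m

lemma bil_add_left {V W : Y.affineOpens} (h : W ≤ V) (n n' : Sec N V) (m : Sec M W) :
    bil φ h (n + n') m = bil φ h n m + bil φ h n' m :=
  congrArg (fun t => homApp t h m) (map_add (φ.app ⟨V, PUnit.unit⟩).hom n n')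

lemma bil_add_right {V W : Y.affineOpens} (h : W ≤ V) (n : Sec N V) (m m' : Sec M W) :
    bil φ h n (m + m') = bil φ h n m + bil φ h n m' := map_add _ _ _

lemma bil_smul_right {V W : Y.affineOpens} (h : W ≤ V) (n : Sec N V) (r : Γ(Y, W.1))
    (m : Sec M W) : bil φ h n (r • m) = r • bil φ h n m := homApp_smul _ _ _ _

lemma bil_res_right {V W W' : Y.affineOpens} (h : W ≤ V) (h' : W' ≤ W) (n : Sec N V)
    (m : Sec M W) : bil φ (h'.trans h) n (Sec.res M h' m) = Sec.res G h' (bil φ h n m) :=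
  homApp_res _ _ _ _

lemma bil_map {V V' W : Y.affineOpens} (h : V' ≤ V) (h' : W ≤ V') (r : Γ(Y, V'.1)) (n : Sec N V)
    (m : Sec M W) :
    bil φ h' (N.obj.map (Cell.scal h r PUnit.unit) n) m = bil φ (h'.trans h) n (rs h' r • m) :=
  congrArg (fun t => homApp t h' m)
    (ConcreteCategory.congr_hom (φ.naturality (Cell.scal h r PUnit.unit)) n)

lemma bil_res_left {V V' W : Y.affineOpens} (h : V' ≤ V) (h' : W ≤ V') (n : Sec N V)
    (m : Sec M W) : bil φ h' (Sec.res N h n) m = bil φ (h'.trans h) n m :=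
  (bil_map φ h h' 1 n m).trans (by rw [map_one, one_smul])

lemma bil_smul_left {V W : Y.affineOpens} (h : W ≤ V) (r : Γ(Y, V.1)) (n : Sec N V)
    (m : Sec M W) : bil φ h (r • n) m = rs h r • bil φ h n m :=
  (bil_map φ le_rfl h r n m).trans (bil_smul_right φ h n _ m)

lemma hom_ext_bil {φ ψ : N.obj ⟶ preHomObj M.obj G.obj}
    (e : ∀ {V W : Y.affineOpens} (h : W ≤ V) (n : Sec N V) (m : Sec M W),
      bil φ h n m = bil ψ h n m) : φ = ψ := by
  ext X n
  exact homSec_ext fun W h m => e h n m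

end homSec

section
variable {Y : Scheme.{u}}

lemma app_res {G G' : QCoh Y} (α : G ⟶ G') {V W : Y.affineOpens} (h : W ≤ V) (x : Sec G V) :
    α.hom.app ⟨W, PUnit.unit⟩ (Sec.res G h x) = Sec.res G' h (α.hom.app ⟨V, PUnit.unit⟩ x) :=
  ConcreteCategory.congr_hom (α.hom.naturality (Cell.scal h 1 PUnit.unit)) x

lemma app_add {G G' : QCoh Y} (α : G ⟶ G') {V : Y.affineOpens} (x y : Sec G V) :
    α.hom.app ⟨V, PUnit.unit⟩ (x + y) =
      α.hom.app ⟨V, PUnit.unit⟩ x + α.hom.app ⟨V, PUnit.unit⟩ y :=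
  map_add (α.hom.app ⟨V, PUnit.unit⟩).hom x y

end

/-! ### The coherator of the sheaf Hom into a direct image -/

section couniversal
open TensorProduct
variable {Y : Scheme.{u}} [Y.IsSeparated] {U : Y.affineOpens} {N M : QCoh Y} {I : Type u}
  [AddCommGroup I] [Module Γ(Y, U.1) I]

/-- The sections of the direct image over `W` and over `U ∩ W` are the same, both being computed on
`U ∩ W`. -/
lemma push_res_inter_injective (W : Y.affineOpens) :
    Function.Injective (Sec.res (push U I) (inter_le_right U W)) := by
  intro x y e
  obtain ⟨x, rfl⟩ := (pushEquiv U I W).surjective x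
  obtain ⟨y, rfl⟩ := (pushEquiv U I W).surjective y
  rw [push_res, push_res] at e
  exact congrArg _ (pushRes_injective I _ (le_inter (inter_le_left U W) le_rfl)
    ((pushEquiv U I (inter U W)).injective e))

/-- Morphisms to the sheaf Hom with values in a direct image from `U` are determined over `U`. -/
lemma hom_ext_bil_push {φ ψ : N.obj ⟶ preHomObj M.obj (push U I).obj}
    (e : ∀ (n : Sec N U) (m : Sec M U), bil φ le_rfl n m = bil ψ le_rfl n m) : φ = ψ := by
  refine hom_ext_bil fun {V W} h n m => ?_
  -- Values in the direct image may be compared over `U ∩ W`, where both arguments of the pairing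
  -- are generated by restrictions of sections over `U`.
  apply push_res_inter_injective
  rw [← bil_res_right, ← bil_res_right, ← bil_res_left φ ((inter_le_right U W).trans h) le_rfl,
    ← bil_res_left ψ ((inter_le_right U W).trans h) le_rfl]
  generalize Sec.res N _ n = n'
  generalize Sec.res M _ m = m'
  induction n' using Sec.induction_res (inter_le_left U W) with
  | hadd x y hx hy => rw [bil_add_left, bil_add_left, hx, hy]
  | hsmul r x hx => rw [bil_smul_left, bil_smul_left, hx]
  | hres n =>
    rw [bil_res_left, bil_res_left]
    induction m' using Sec.induction_res (inter_le_left U W) with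
    | hadd x y hx hy => rw [bil_add_right, bil_add_right, hx, hy]
    | hsmul r x hx => rw [bil_smul_right, bil_smul_right, hx]
    | hres m => rw [bil_res_right φ le_rfl, bil_res_right ψ le_rfl, e]

/-- Morphisms to a direct image from `U` are determined over `U`. -/
lemma hom_ext_push {φ ψ : N ⟶ push U I}
    (e : ∀ n : Sec N U, φ.hom.app ⟨U, PUnit.unit⟩ n = ψ.hom.app ⟨U, PUnit.unit⟩ n) : φ = ψ := by
  refine ObjectProperty.hom_ext _ ?_
  ext X n
  apply push_res_inter_injective
  refine (app_res φ _ n).symm.trans (Eq.trans ?_ (app_res ψ _ n))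
  generalize Sec.res N _ n = n'
  induction n' using Sec.induction_res (inter_le_left U X.U) with
  | hadd x y hx hy => rw [app_add, app_add, hx, hy]
  | hsmul r x hx => rw [app_smul, app_smul, hx]
  | hres n => rw [app_res, app_res, e]

/-- The sections over `U` of the direct image. -/
noncomputable def pushEvalSec : Sec (push U I) U →ₗ[Γ(Y, U.1)] I where
  toFun x := pushEval I ((pushEquiv U I U).symm x)
  map_add' x y := by rw [map_add, map_add]
  map_smul' r x := by
    obtain ⟨x, rfl⟩ := (pushEquiv U I U).surjective x
    rw [push_smul, AddEquiv.symm_apply_apply, AddEquiv.symm_apply_apply]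
    refine Eq.trans ?_ ((pushEval I).map_smul r x)
    exact congrArg _ (algebraMap_smul Γ(Y, (inter U U).1) r x)

lemma pushEvalSec_one_tmul (x : I) : pushEvalSec (pushEquiv U I U (1 ⊗ₜ x)) = x :=
  pushEval_one_tmul I x

lemma pushEquiv_pushEvalSec (x : Sec (push U I) U) :
    pushEquiv U I U (1 ⊗ₜ pushEvalSec x) = x := by
  exact (congrArg (pushEquiv U I U) (one_tmul_pushEval I ((pushEquiv U I U).symm x))).trans
    ((pushEquiv U I U).apply_symm_apply x)

/-- The map `pushLiftSec φ V` is chosen by an existence statement, so additivity in `φ` has to be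
read off from its values on generators. -/
lemma pushLiftSec_add (φ ψ : Sec M U →ₗ[Γ(Y, U.1)] I) (V : Y.affineOpens) :
    pushLiftSec (φ + ψ) V = pushLiftSec φ V + pushLiftSec ψ V := by
  ext x
  induction x using Sec.induction_res (inter_le_left U V) with
  | hadd x y hx hy => rw [map_add, map_add, hx, hy]
  | hsmul r x hx => rw [map_smul, map_smul, hx]
  | hres n => simp only [LinearMap.add_apply, pushLiftSec_res, tmul_add]

lemma pushLiftSec_smul (r : Γ(Y, U.1)) (φ : Sec M U →ₗ[Γ(Y, U.1)] I) (V : Y.affineOpens) :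
    pushLiftSec (r • φ) V = r • pushLiftSec φ V := by
  ext x
  induction x using Sec.induction_res (inter_le_left U V) with
  | hadd x y hx hy => rw [map_add, map_add, hx, hy]
  | hsmul r x hx => rw [map_smul, map_smul, hx]
  | hres n => simp only [LinearMap.smul_apply, pushLiftSec_res, tmul_smul]

variable (M I) in
/-- The evaluation pairing over the intersection of `U` and `V`. -/
noncomputable def pushPairing (V : Y.affineOpens) :
    PushSec U (Sec M U →ₗ[Γ(Y, U.1)] I) V →ₗ[Γ(Y, (inter U V).1)]
      Sec M (inter U V) →ₗ[Γ(Y, (inter U V).1)] PushSec U I V :=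
  LinearMap.liftBaseChange Γ(Y, (inter U V).1)
    { toFun := fun φ => pushLiftSec φ V
      map_add' := fun φ ψ => pushLiftSec_add φ ψ V
      map_smul' := fun r φ => pushLiftSec_smul r φ V }

lemma pushPairing_tmul (V : Y.affineOpens) (s : Γ(Y, (inter U V).1))
    (φ : Sec M U →ₗ[Γ(Y, U.1)] I) (x : Sec M (inter U V)) :
    pushPairing M I V (s ⊗ₜ φ) x = s • pushLiftSec φ V x := by
  simp [pushPairing]

lemma pushRes_pushPairing {V W : Y.affineOpens} (h : inter U W ≤ inter U V)
    (t : PushSec U (Sec M U →ₗ[Γ(Y, U.1)] I) V) (x : Sec M (inter U V)) :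
    pushRes I h (pushPairing M I V t x) = pushPairing M I W (pushRes _ h t) (Sec.res M h x) := by
  induction t using TensorProduct.induction_on with
  | zero => simp
  | add t t' ht ht' => simp only [map_add, LinearMap.add_apply, ht, ht']
  | tmul s φ =>
    rw [pushPairing_tmul, pushRes_smul, pushRes_pushLiftSec, pushRes_tmul, pushPairing_tmul]

variable (M I) in
/-- The canonical morphism from the direct image of the module of linear maps to the sheaf Hom. -/
noncomputable def pushHomSec (V : Y.affineOpens) :
    PushSec U (Sec M U →ₗ[Γ(Y, U.1)] I) V →+
      (preHomObj M.obj (push U I).obj).obj ⟨V, PUnit.unit⟩ where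
  toFun t := homMk (fun W h => ((pushEquiv U I W).toAddMonoidHom.comp
      (pushPairing M I W (pushRes _ (inter_mono U h) t)).toAddMonoidHom).comp
        (Sec.res M (inter_le_right U W))) fun {W W'} h h' r m => by
    change pushEquiv U I W' (pushPairing M I W' (pushRes _ _ t) (Sec.res M _ (r • Sec.res M h' m)))
      = r • Sec.res _ h' (pushEquiv U I W (pushPairing M I W (pushRes _ _ t) (Sec.res M _ m)))
    rw [push_res, push_smul, pushRes_pushPairing, pushRes_pushRes, Sec.res_smul, map_smul,
      Sec.res_res, Sec.res_res]
  map_zero' := by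
    refine homSec_ext fun W h m => ?_
    change pushEquiv U I W (pushPairing M I W (pushRes _ (inter_mono U h) 0)
      (Sec.res M (inter_le_right U W) m)) = 0
    rw [map_zero, map_zero, LinearMap.zero_apply, map_zero]
  map_add' t t' := by
    refine homSec_ext fun W h m => ?_
    change pushEquiv U I W (pushPairing M I W (pushRes _ (inter_mono U h) (t + t')) _) =
      pushEquiv U I W (pushPairing M I W (pushRes _ (inter_mono U h) t) _) +
      pushEquiv U I W (pushPairing M I W (pushRes _ (inter_mono U h) t') _)
    rw [map_add, map_add, LinearMap.add_apply, map_add]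

lemma homApp_pushHomSec {V W : Y.affineOpens} (h : W ≤ V)
    (t : PushSec U (Sec M U →ₗ[Γ(Y, U.1)] I) V) (m : Sec M W) :
    homApp (pushHomSec M I V t) h m = pushEquiv U I W
      (pushPairing M I W (pushRes _ (inter_mono U h) t) (Sec.res M (inter_le_right U W) m)) := rfl

variable (U M I) in
/-- The canonical morphism from the direct image of the module of linear maps to the sheaf Hom. -/
noncomputable def pushHom :
    (push U (Sec M U →ₗ[Γ(Y, U.1)] I)).obj ⟶ preHomObj M.obj (push U I).obj :=
  natOfSections (fun V => (pushHomSec M I V).comp (pushEquiv U _ V).symm.toAddMonoidHom)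
    fun {V W} h r x => by
      obtain ⟨x, rfl⟩ := (pushEquiv U _ V).surjective x
      refine homSec_ext fun Z h' m => ?_
      refine Eq.trans ?_ (homApp_map _ h r h' m).symm
      have e : (pushEquiv U _ W).symm ((push U (Sec M U →ₗ[Γ(Y, U.1)] I)).obj.map
          (Cell.scal h r PUnit.unit) (pushEquiv U _ V x)) =
          rs (inter_le_right U W) r • pushRes _ (inter_mono U h) x :=
        push_map _ h r x
      refine (congrArg (fun t => homApp (pushHomSec M I W t) h' m) e).trans ?_
      refine (homApp_pushHomSec h' _ m).trans
        (Eq.trans ?_ (homApp_pushHomSec (h'.trans h) x _).symm)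
      refine congrArg (pushEquiv U I Z) ?_
      rw [pushRes_smul, map_smul, LinearMap.smul_apply, Sec.res_smul, map_smul, rs_rs, rs_rs,
        pushRes_pushRes]

/-- Every section of the direct image over `U` has the form `1 ⊗ φ`, and morphisms of this kind are
determined over `U`; so this evaluation formula characterizes `pushHom`. -/
lemma homApp_pushHom_self (φ : Sec M U →ₗ[Γ(Y, U.1)] I) (m : Sec M U) :
    homApp ((pushHom U M I).app ⟨U, PUnit.unit⟩ (pushEquiv U _ U (1 ⊗ₜ φ))) le_rfl m =
      pushEquiv U I U (1 ⊗ₜ φ m) := by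
  refine (homApp_pushHomSec le_rfl (1 ⊗ₜ φ) m).trans (congrArg _ ?_)
  rw [pushRes_self, pushPairing_tmul, one_smul]
  exact pushLiftSec_res φ U m

/-- The direct image of the module of linear maps is the couniversal quasi-coherent sheaf over the
sheaf Hom. -/
theorem existsUnique_pushHom (φ : N.obj ⟶ preHomObj M.obj (push U I).obj) :
    ∃! ψ : N ⟶ push U (Sec M U →ₗ[Γ(Y, U.1)] I), ψ.hom ≫ pushHom U M I = φ := by
  -- This is tensor-Hom adjunction over `U`: a morphism to the sheaf Hom amounts to a bilinear
  -- pairing of `N(U)` and `M(U)` with values in `I`, that is, to a linear map `N(U) → Hom(M(U),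
  -- I)`.
  let h : Sec N U →ₗ[Γ(Y, U.1)] Sec M U →ₗ[Γ(Y, U.1)] I :=
    LinearMap.mk₂ _ (fun n m => pushEvalSec (bil φ le_rfl n m))
      (fun n n' m => by rw [bil_add_left, map_add])
      (fun r n m => by rw [bil_smul_left, rs_self, map_smul])
      (fun n m m' => by rw [bil_add_right, map_add])
      (fun r n m => by rw [bil_smul_right, map_smul])
  refine ⟨pushLift h, ?_, fun ψ hψ => ?_⟩
  · refine hom_ext_bil_push fun n m => ?_
    refine (congrArg (fun t => homApp ((pushHom U M I).app ⟨U, PUnit.unit⟩ t) le_rfl m)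
      (pushLift_apply_self h n)).trans ?_
    rw [homApp_pushHom_self]
    exact pushEquiv_pushEvalSec _
  · refine hom_ext_push fun n => ?_
    refine Eq.trans ?_ (pushLift_apply_self h n).symm
    rw [← pushEquiv_pushEvalSec (ψ.hom.app ⟨U, PUnit.unit⟩ n)]
    congr 2
    ext m
    refine (pushEvalSec_one_tmul (U := U) _).symm.trans ?_
    rw [← homApp_pushHom_self, pushEquiv_pushEvalSec]
    exact congrArg (fun t => pushEvalSec (bil t le_rfl n m)) hψ

end couniversal


/-! ### The induced graded module `N ⊗ A` and the weight components of the coherator -/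

section induced
open TensorProduct
variable {Y : Scheme.{u}} {Λ : Type} [AddCommGroup Λ] [DecidableEq Λ] {A : GradedAlgebra Y Λ}

instance (V : Y.affineOpens) (j : Λ) : Module Γ(Y, V.1) (A.deg V j) where
  smul r a := ⟨A.str V r * a.1, by simpa using A.mul_mem (A.str_mem V r) a.2⟩
  one_smul a := Subtype.ext ((congrArg (· * a.1) (map_one (A.str V))).trans (one_mul _))
  mul_smul r s a := Subtype.ext ((congrArg (· * a.1) (map_mul (A.str V) r s)).trans (mul_assoc _ _ _))
  smul_zero r := Subtype.ext (mul_zero _)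
  smul_add r a b := Subtype.ext (mul_add _ _ _)
  add_smul r s a := Subtype.ext ((congrArg (· * a.1) (map_add (A.str V) r s)).trans (add_mul _ _ _))
  zero_smul a := Subtype.ext ((congrArg (· * a.1) (map_zero (A.str V))).trans (zero_mul _))

lemma coe_smul_deg {V : Y.affineOpens} {j : Λ} (r : Γ(Y, V.1)) (a : A.deg V j) :
    (r • a).1 = A.str V r * a.1 := rfl

/-- The homogeneous elements, as sections of a weight component of the algebra. -/
def degEquiv (V : Y.affineOpens) (j : Λ) : A.deg V j ≃+ Sec ((weight j).obj (selfMod A)) V where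
  toFun a := a
  invFun a := a
  left_inv _ := rfl
  right_inv _ := rfl
  map_add' _ _ := rfl

lemma degEquiv_smul {V : Y.affineOpens} {j : Λ} (r : Γ(Y, V.1)) (a : A.deg V j) :
    degEquiv V j (r • a) = r • degEquiv V j a :=
  Subtype.ext (congrArg (A.str V r * ·) (A.res_self le_rfl a.1).symm)

variable (N : QCoh Y)

/-- The sections of the graded module `N ⊗ A`. -/
abbrev IndSec (A : GradedAlgebra Y Λ) (V : Y.affineOpens) (j : Λ) : Type u :=
  Sec N V ⊗[Γ(Y, V.1)] A.deg V j

/-- The restriction to `W` and multiplication by a homogeneous element. -/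
def degMap {V W : Y.affineOpens} (h : W ≤ V) {j k l : Λ} (a : A.obj W) (ha : a ∈ A.deg W l)
    (e : l + j = k) : A.deg V j →+ A.deg W k where
  toFun b := ⟨a * A.res h b.1, e ▸ A.mul_mem ha (A.res_mem h b.2)⟩
  map_zero' := Subtype.ext (by simp)
  map_add' b c := Subtype.ext (by simp [mul_add])

/-- The functoriality of the sections of `N ⊗ A`. -/
noncomputable def indMap {V W : Y.affineOpens} (h : W ≤ V) {j k l : Λ} (a : A.obj W)
    (ha : a ∈ A.deg W l) (e : l + j = k) : IndSec N A V j →+ IndSec N A W k :=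
  TensorProduct.liftAddHom
    { toFun := fun n => ((TensorProduct.mk Γ(Y, W.1) (Sec N W) (A.deg W k)
        (Sec.res N h n)).toAddMonoidHom).comp (degMap h a ha e)
      map_zero' := by
        ext b
        simp
      map_add' := fun n n' => by
        ext b
        simp }
    fun r n b => by
      change Sec.res N h (r • n) ⊗ₜ[Γ(Y, W.1)] degMap h a ha e b =
        Sec.res N h n ⊗ₜ[Γ(Y, W.1)] degMap h a ha e (r • b)
      have : degMap h a ha e (r • b) = rs h r • degMap h a ha e b := by
        refine Subtype.ext ?_
        change a * A.res h (A.str V r * b.1) = A.str W (rs h r) * (a * A.res h b.1)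
        rw [map_mul, A.res_str, mul_left_comm]
      rw [Sec.res_smul, this, smul_tmul]

lemma indMap_tmul {V W : Y.affineOpens} (h : W ≤ V) {j k l : Λ} (a : A.obj W)
    (ha : a ∈ A.deg W l) (e : l + j = k) (n : Sec N V) (b : A.deg V j) :
    indMap N h a ha e (n ⊗ₜ b) = Sec.res N h n ⊗ₜ degMap h a ha e b := rfl

/-- The element `a` and its degree `l` are kept free because the structure maps produce `1`, `A.str
V 1` and degrees such as `k - k`, which agree with the expected ones only propositionally. -/
lemma indMap_str {V : Y.affineOpens} (h : V ≤ V) {j : Λ} (r : Γ(Y, V.1)) (a : A.obj V)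
    (har : a = A.str V r) {l} (ha : a ∈ A.deg V l) (e : l + j = j) (x : IndSec N A V j) :
    indMap N h a ha e x = r • x := by
  induction x using TensorProduct.induction_on with
  | zero => simp
  | add x y hx hy => rw [map_add, hx, hy, smul_add]
  | tmul n b =>
    rw [indMap_tmul, Sec.res_self, ← tmul_smul]
    refine congrArg _ (Subtype.ext ?_)
    change a * A.res h b.1 = A.str V r * b.1
    rw [A.res_self, har]

variable (A) in
/-- The graded module `N ⊗ A`, with a shift of the grading by `- i`, as a presheaf. -/
noncomputable def indPre (i : Λ) : Cell A ⥤ AddCommGrpCat.{u} where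
  obj X := AddCommGrpCat.of (IndSec N A X.U (X.i - i))
  map {X Z} f := AddCommGrpCat.ofHom
    (indMap N f.hle (j := X.i - i) (k := Z.i - i) f.val f.mem (by abel))
  map_id X := by
    refine ConcreteCategory.hom_ext _ _ fun x => ?_
    refine (indMap_str N le_rfl 1 1 (map_one (A.str X.U)).symm _ _ x).trans ?_
    rw [one_smul]
    rfl
  map_comp {X Z W} f g := by
    refine ConcreteCategory.hom_ext _ _ fun (x : IndSec N A X.U (X.i - i)) => ?_
    change indMap N _ _ _ _ x = indMap N _ _ _ _ (indMap N _ _ _ _ x)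
    induction x using TensorProduct.induction_on with
    | zero => simp
    | add x y hx hy => rw [map_add, hx, hy, map_add, map_add]
    | tmul n b =>
      rw [indMap_tmul, indMap_tmul, indMap_tmul, Sec.res_res]
      refine congrArg _ (Subtype.ext ?_)
      change g.val * A.res g.hle f.val * A.res _ b.1 = g.val * A.res g.hle (f.val * A.res f.hle b.1)
      rw [map_mul, A.res_res, mul_assoc]

/-- Both `N` and the weight components of `A` are localized at `f` by restriction to `D(f)`, and a
tensor product of localizations is a localization of the tensor product. -/
lemma isLocalizedModule_indMap {V : Y.affineOpens} (f : Γ(Y, V.1)) (j : Λ) (l : Λ)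
    (ha : (1 : A.obj (Y.affineBasicOpen f)) ∈ A.deg _ l) (e : l + j = j) :
    (∀ y : IndSec N A (Y.affineBasicOpen f) j, ∃ (n : ℕ) (x : IndSec N A V j),
      indMap N (Y.affineBasicOpen_le f) 1 ha e x = rs (Y.affineBasicOpen_le f) f ^ n • y) ∧
    ∀ x : IndSec N A V j, indMap N (Y.affineBasicOpen_le f) 1 ha e x = 0 →
      ∃ n : ℕ, f ^ n • x = 0 := by
  let D := Y.affineBasicOpen f
  let h : D ≤ V := Y.affineBasicOpen_le f
  let : Algebra Γ(Y, V.1) Γ(Y, D.1) := (rs h).toAlgebra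
  have : IsLocalization.Away f Γ(Y, D.1) :=
    V.2.isLocalization_of_eq_basicOpen f (homOfLE h) rfl
  let : Module Γ(Y, V.1) (Sec N D) := Module.compHom _ (rs h)
  have : IsScalarTower Γ(Y, V.1) Γ(Y, D.1) (Sec N D) := ⟨fun r s x => mul_smul (rs h r) s x⟩
  let : Module Γ(Y, V.1) (A.deg D j) := Module.compHom _ (rs h)
  have : IsScalarTower Γ(Y, V.1) Γ(Y, D.1) (A.deg D j) := ⟨fun r s x => mul_smul (rs h r) s x⟩
  let φ : Sec N V →ₗ[Γ(Y, V.1)] Sec N D :=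
    { Sec.res N h with map_smul' := fun r x => Sec.res_smul N h r x }
  have : IsLocalizedModule (.powers f) φ :=
    Sec.isLocalizedModule_of_eq N φ (RingHom.id _) (AddEquiv.refl _) (fun r m => rfl) h
      (AddEquiv.refl _) (fun r n => rfl) (fun x => rfl) f rfl
  have hψ : ∀ b : A.deg V j, (degMap h 1 ha e b).1 = A.res h b.1 := fun b => one_mul _
  let ψ : A.deg V j →ₗ[Γ(Y, V.1)] A.deg D j :=
    { degMap h 1 ha e with
      map_smul' := fun r x => Subtype.ext (by
        change (degMap h 1 ha e _).1 = A.str D (rs h r) * (degMap h 1 ha e x).1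
        rw [hψ, hψ, coe_smul_deg, map_mul, A.res_str]) }
  have : IsLocalizedModule (.powers f) ψ :=
    Sec.isLocalizedModule_of_eq ((weight j).obj (selfMod A)) ψ (RingHom.id _) (degEquiv V j)
      (fun r m => degEquiv_smul r m) h (degEquiv D j) (fun r n => degEquiv_smul (rs h r) n)
      (fun x => Subtype.ext ((hψ x).trans
        ((congrArg (· * A.res h x.1) (map_one (A.str D))).trans (one_mul _)).symm)) f rfl
  let T := TensorProduct.map φ ψ
  -- For modules over the localization, tensoring over `Γ(Y, D(f))` or over `Γ(Y, V)` gives the same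
  -- result.
  let E := IsLocalization.moduleTensorEquiv (.powers f) Γ(Y, D.1) (Sec N D) (A.deg D j)
  have hE : ∀ x, E (indMap N h 1 ha e x) = T x := by
    intro x
    induction x using TensorProduct.induction_on with
    | zero => simp
    | add x y hx hy => rw [map_add, map_add, hx, hy, map_add]
    | tmul n b => rfl
  constructor
  · intro y
    obtain ⟨⟨x, _, n, rfl⟩, hx⟩ := IsLocalizedModule.surj (.powers f) T (E y)
    refine ⟨n, x, E.injective ?_⟩
    rw [hE, ← hx, map_smul, ← map_pow]
    exact (algebraMap_smul Γ(Y, D.1) (f ^ n) (E y)).symm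
  · intro x hx
    have : T x = 0 := by rw [← hE, hx, map_zero]
    obtain ⟨⟨_, n, rfl⟩, hn⟩ := (IsLocalizedModule.eq_zero_iff (.powers f) T).1 this
    exact ⟨n, hn⟩

variable (A) in
/-- The graded module `N ⊗ A`, with a shift of the grading by `- i`. -/
noncomputable def ind (i : Λ) : GrMod A where
  obj := indPre A N i
  property :=
    { map_add := fun {X Z} a b c e => by
        refine ConcreteCategory.hom_ext _ _ fun (x : IndSec N A X.U (X.i - i)) => ?_
        change indMap N _ _ _ _ x = indMap N _ _ _ _ x + indMap N _ _ _ _ x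
        induction x using TensorProduct.induction_on with
        | zero => simp
        | add x y hx hy => simp only [map_add, hx, hy]; abel
        | tmul n t =>
          rw [indMap_tmul, indMap_tmul, indMap_tmul, ← tmul_add]
          refine congrArg _ (Subtype.ext ?_)
          change c.val * _ = a.val * _ + b.val * _
          rw [e, add_mul]
      qc_surj := fun V f k y => by
        have h1 : A.str (Y.affineBasicOpen f) 1 = 1 := map_one _
        obtain ⟨n, x, e⟩ := (isLocalizedModule_indMap N f (k - i) 0 (A.one_mem _) (zero_add _)).1 y
        refine ⟨n, x, ?_⟩
        refine Eq.trans ?_ (e.trans (indMap_str N le_rfl _ _ rfl _ _ y).symm)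
        change indMap N _ (A.str (Y.affineBasicOpen f) 1) _ _ x = _
        congr 1
        congr 1
        simp
      qc_inj := fun V f k x hx => by
        obtain ⟨n, e⟩ := (isLocalizedModule_indMap N f (k - i) (k - k)
          (by simpa using A.one_mem _) (by abel)).2 x (by
            refine Eq.trans ?_ hx
            change _ = indMap N _ (A.str (Y.affineBasicOpen f) 1) _ _ x
            congr 1
            congr 1
            simp)
        exact ⟨n, (indMap_str N le_rfl _ _ rfl _ _ x).trans e⟩ }

/-- The canonical morphism from `N` to a weight component of `N ⊗ A`. -/
noncomputable def indUnit (i : Λ) : N.obj ⟶ Cell.emb A i ⋙ (ind A N i).obj :=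
  natOfSections (fun V => ((TensorProduct.mk Γ(Y, V.1) (Sec N V) (A.deg V (i - i))).flip
      ⟨1, by simpa using A.one_mem V⟩).toAddMonoidHom)
    fun {V W} h r n => by
      refine Eq.trans ?_ (indMap_tmul N h (j := i - i) (k := i - i) (A.str W r)
        (l := i - i) (by simpa using A.str_mem W r) (by abel) n _).symm
      refine (congrArg (fun t : Sec N W => t ⊗ₜ[Γ(Y, W.1)] _) (Sec.map_scal N h r n)).trans
        ((smul_tmul _ _ _).trans ?_)
      refine congrArg _ (Subtype.ext ?_)
      change A.str W r * 1 = A.str W r * A.res h 1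
      rw [map_one]

variable {N} {P : Cell A ⥤ AddCommGrpCat.{u}} {i : Λ}

/-- The multiplication by a homogeneous element. -/
def Cell.mulDeg (V : Y.affineOpens) (i k : Λ) (b : A.deg V (k - i)) : (⟨V, i⟩ : Cell A) ⟶ ⟨V, k⟩ :=
  Cell.Hom.mk b.1 le_rfl b.2

/-- The values of the morphism from `N ⊗ A` induced by a morphism from `N` to a weight component. -/
noncomputable def indDescSec (hP : isAdd A P) (β : N.obj ⟶ Cell.emb A i ⋙ P) (V : Y.affineOpens)
    (k : Λ) : IndSec N A V (k - i) →+ P.obj ⟨V, k⟩ :=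
  TensorProduct.liftAddHom
    (AddMonoidHom.mk' (fun n : Sec N V => AddMonoidHom.mk'
      (fun b : A.deg V (k - i) => P.map (Cell.mulDeg V i k b) (β.app ⟨V, PUnit.unit⟩ n))
      fun b c => ConcreteCategory.congr_hom
        (hP (Cell.mulDeg V i k b) (Cell.mulDeg V i k c) (Cell.mulDeg V i k (b + c)) rfl) _)
      fun n n' => AddMonoidHom.ext fun b =>
        (congrArg (P.map (Cell.mulDeg V i k b)) (map_add (β.app ⟨V, PUnit.unit⟩).hom n n')).trans
          (map_add (P.map (Cell.mulDeg V i k b)).hom _ _))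
    fun r n b => by
      have e : Cell.scal le_rfl r i ≫ Cell.mulDeg V i k b = Cell.mulDeg V i k (r • b) := by
        refine Cell.hom_ext ?_
        change b.1 * A.res le_rfl (A.str V r) = A.str V r * b.1
        rw [A.res_self, mul_comm]
      change P.map (Cell.mulDeg V i k b) (β.app ⟨V, PUnit.unit⟩ (r • n)) =
        P.map (Cell.mulDeg V i k (r • b)) (β.app ⟨V, PUnit.unit⟩ n)
      rw [← e, P.map_comp]
      exact congrArg (P.map (Cell.mulDeg V i k b))
        (ConcreteCategory.congr_hom (β.naturality (Cell.scal le_rfl r PUnit.unit)) n)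

lemma indDescSec_tmul (hP : isAdd A P) (β : N.obj ⟶ Cell.emb A i ⋙ P) (V : Y.affineOpens)
    (k : Λ) (n : Sec N V) (b : A.deg V (k - i)) :
    indDescSec hP β V k (n ⊗ₜ b) = P.map (Cell.mulDeg V i k b) (β.app ⟨V, PUnit.unit⟩ n) := rfl

/-- The morphism from `N ⊗ A` induced by a morphism from `N` to a weight component. -/
noncomputable def indDesc (hP : isAdd A P) (β : N.obj ⟶ Cell.emb A i ⋙ P) :
    (ind A N i).obj ⟶ P where
  app X := AddCommGrpCat.ofHom (indDescSec hP β X.U X.i)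
  naturality X Z f := by
    refine ConcreteCategory.hom_ext _ _ fun (x : IndSec N A X.U (X.i - i)) => ?_
    change indDescSec hP β Z.U Z.i (indMap N _ _ _ _ x) = P.map f (indDescSec hP β X.U X.i x)
    induction x using TensorProduct.induction_on with
    | zero => rw [map_zero, map_zero, map_zero]; exact (map_zero (P.map f).hom).symm
    | add x y hx hy => simp only [map_add, hx, hy]
    | tmul n b =>
      rw [indMap_tmul, indDescSec_tmul, indDescSec_tmul]
      -- Both sides multiply the restriction of `β n` by `f.val` times the restriction of `b`, so
      -- naturality follows from one equality of morphisms of cells.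
      have e : Cell.scal f.hle 1 i ≫ Cell.mulDeg Z.U i Z.i (degMap f.hle f.val f.mem (by abel) b) =
          Cell.mulDeg X.U i X.i b ≫ f := by
        refine Cell.hom_ext ?_
        change f.val * A.res f.hle b.1 * A.res le_rfl (A.str Z.U 1) = f.val * A.res f.hle b.1
        rw [map_one, map_one, mul_one]
      refine Eq.trans ?_ (ConcreteCategory.congr_hom (P.map_comp _ f) _)
      rw [← e, P.map_comp]
      exact congrArg (P.map (Cell.mulDeg Z.U i Z.i _))
        (ConcreteCategory.congr_hom (β.naturality (Cell.scal f.hle 1 PUnit.unit)) n)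

/-- With `indDesc_comp`, this expresses that `N ↦ N ⊗ A`, suitably shifted, is left adjoint to the
weight `i` component. The target only has to be an additive presheaf, so that sheaf Homs are
covered. -/
lemma indUnit_indDesc (hP : isAdd A P) (β : N.obj ⟶ Cell.emb A i ⋙ P) :
    indUnit N i ≫ Functor.whiskerLeft (Cell.emb A i) (indDesc hP β) = β := by
  ext X n
  change P.map (Cell.mulDeg X.U i i ⟨1, _⟩) (β.app X n) = β.app X n
  have : Cell.mulDeg X.U i i ⟨1, by simpa using A.one_mem X.U⟩ = 𝟙 (⟨X.U, i⟩ : Cell A) := rfl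
  rw [this, P.map_id]
  rfl

lemma indDesc_comp {P' : Cell A ⥤ AddCommGrpCat.{u}} (hP : isAdd A P) (hP' : isAdd A P')
    (β : N.obj ⟶ Cell.emb A i ⋙ P) (γ : P ⟶ P') :
    indDesc hP' (β ≫ Functor.whiskerLeft (Cell.emb A i) γ) = indDesc hP β ≫ γ := by
  ext X x
  change indDescSec hP' (β ≫ Functor.whiskerLeft (Cell.emb A i) γ) X.U X.i x = γ.app X (indDescSec hP β X.U X.i x)
  induction (x : IndSec N A X.U (X.i - i)) using TensorProduct.induction_on with
  | zero => rw [map_zero, map_zero]; exact (map_zero (γ.app X).hom).symm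
  | add x y hx hy => simp only [map_add, hx, hy]
  | tmul n b =>
    exact (ConcreteCategory.congr_hom (γ.naturality (Cell.mulDeg X.U i X.i b)) _).symm

variable (A) in
/-- The adjunction between the inclusion of quasi-coherent modules and the coherator. -/
noncomputable def coheratorAdj : (isGrMod A).ι ⊣ coherator A := Adjunction.ofIsLeftAdjoint _

/-- The counit of the coherator. -/
noncomputable def coheratorε (P : Cell A ⥤ AddCommGrpCat.{u}) : ((coherator A).obj P).obj ⟶ P :=
  (coheratorAdj A).counit.app P

lemma exists_coheratorε (K : GrMod A) (f : K.obj ⟶ P) :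
    ∃ g : K ⟶ (coherator A).obj P, g.hom ≫ coheratorε P = f :=
  ⟨(coheratorAdj A).homEquiv K P f,
    ((coheratorAdj A).homEquiv_counit (g := (coheratorAdj A).homEquiv K P f)).symm.trans
      (((coheratorAdj A).homEquiv K P).symm_apply_apply f)⟩

lemma coheratorε_ext {K : GrMod A} {f g : K ⟶ (coherator A).obj P}
    (h : f.hom ≫ coheratorε P = g.hom ≫ coheratorε P) : f = g := by
  apply ((coheratorAdj A).homEquiv K P).symm.injective
  rw [Adjunction.homEquiv_counit, Adjunction.homEquiv_counit]
  exact h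

lemma coheratorε_naturality {P P' : Cell A ⥤ AddCommGrpCat.{u}} (f : P ⟶ P') :
    ((coherator A).map f).hom ≫ coheratorε P' = coheratorε P ≫ f :=
  (coheratorAdj A).counit.naturality f

/-- The weight components of the coherator are computed by the coherator of the weight
components. -/
theorem existsUnique_weight_coherator (hP : isAdd A P) (β : N.obj ⟶ Cell.emb A i ⋙ P) :
    ∃! ψ : N ⟶ (weight i).obj ((coherator A).obj P),
      ψ.hom ≫ Functor.whiskerLeft (Cell.emb A i) (coheratorε P) = β := by
  have hC : isAdd A ((coherator A).obj P).obj := ((isGrMod_iff _).1 ((coherator A).obj P).property).1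
  -- A morphism from `N` to weight `i` of `P` is a morphism from `N ⊗ A` to `P`. Since `N ⊗ A` is
  -- quasi-coherent, this factors uniquely through the coherator of `P`.
  obtain ⟨g, hg⟩ := exists_coheratorε (ind A N i) (indDesc hP β)
  refine ⟨ObjectProperty.homMk (indUnit N i ≫ Functor.whiskerLeft (Cell.emb A i) g.hom), ?_,
    fun ψ hψ => ?_⟩
  · change (indUnit N i ≫ Functor.whiskerLeft (Cell.emb A i) g.hom) ≫ _ = _
    rw [Category.assoc, ← Functor.whiskerLeft_comp, hg, indUnit_indDesc]
  · refine ObjectProperty.hom_ext _ ?_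
    have e : (ObjectProperty.homMk (indDesc hC ψ.hom) : ind A N i ⟶ (coherator A).obj P) = g := by
      apply coheratorε_ext
      rw [hg, ← hψ]
      exact (indDesc_comp hC hP ψ.hom _).symm
    change _ = indUnit N i ≫ Functor.whiskerLeft (Cell.emb A i) g.hom
    rw [← e]
    exact (indUnit_indDesc hC ψ.hom).symm

end induced


/-! ### Exactness on sections -/

section exact
variable {Y : Scheme.{u}}

/-- Exactness on the sections over all affine open sets. -/
def SecExact {G₁ G₂ G₃ : QCoh Y} (f : G₁ ⟶ G₂) (g : G₂ ⟶ G₃) : Prop :=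
  ∀ (V : Y.affineOpens) (x : Sec G₂ V), (g.hom.app ⟨V, PUnit.unit⟩ x : Sec G₃ V) = 0 →
    ∃ y : Sec G₁ V, f.hom.app ⟨V, PUnit.unit⟩ y = x

lemma app_zero {G G' : QCoh Y} (α : G ⟶ G') (V : Y.affineOpens) :
    α.hom.app ⟨V, PUnit.unit⟩ (0 : Sec G V) = (0 : Sec G' V) :=
  map_zero (α.hom.app ⟨V, PUnit.unit⟩).hom

lemma comp_app {G G' G'' : QCoh Y} (α : G ⟶ G') (β : G' ⟶ G'') (V : Y.affineOpens) (x : Sec G V) :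
    (α ≫ β).hom.app ⟨V, PUnit.unit⟩ x =
      β.hom.app ⟨V, PUnit.unit⟩ (α.hom.app ⟨V, PUnit.unit⟩ x) := rfl

lemma SecExact.of_iso {G₁ G₂ G₃ G₁' G₂' G₃' : QCoh Y} {f : G₁ ⟶ G₂} {g : G₂ ⟶ G₃}
    {f' : G₁' ⟶ G₂'} {g' : G₂' ⟶ G₃'} (h : SecExact f' g') (e₁ : G₁ ≅ G₁') (e₂ : G₂ ≅ G₂')
    (e₃ : G₃ ≅ G₃') (hf : f ≫ e₂.hom = e₁.hom ≫ f') (hg : g ≫ e₃.hom = e₂.hom ≫ g') :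
    SecExact f g := by
  intro V x hx
  obtain ⟨y, hy⟩ := h V (e₂.hom.hom.app ⟨V, PUnit.unit⟩ x) (by
    rw [← comp_app, ← hg, comp_app, hx]
    exact app_zero _ _)
  refine ⟨e₁.inv.hom.app ⟨V, PUnit.unit⟩ y, ?_⟩
  have e : f = e₁.hom ≫ f' ≫ e₂.inv := by rw [← Category.assoc, ← hf]; simp
  have e' : e₁.inv ≫ f = f' ≫ e₂.inv := by rw [e]; simp
  rw [← comp_app, e', comp_app, hy, ← comp_app, e₂.hom_inv_id]
  rfl

end exact

/-! ### Weight components of the internal Hom -/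

section weightHom
variable {Y : Scheme.{u}} {Λ : Type} [AddCommGroup Λ] [DecidableEq Λ] {A : GradedAlgebra Y Λ}

lemma isAdd_preHomObj (M : GrMod A) (G : QCoh Y) : isAdd A (preHomObj M.obj G.obj) := by
  intro X Z a b c e
  refine ConcreteCategory.hom_ext _ _ fun (φ : HomSec M.obj G.obj X) => ?_
  refine Subtype.ext (funext fun W => AddMonoidHom.ext fun x => ?_)
  have e' : (Cell.act c W.2).val = (Cell.act a W.2).val + (Cell.act b W.2).val :=
    (congrArg (A.res W.2) e).trans (map_add _ _ _)
  have := ConcreteCategory.congr_hom (M.property.map_add _ _ _ e') x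
  exact (congrArg (φ.1 ⟨W.1, W.2.trans c.hle⟩) this).trans (map_add _ _ _)

/-- The weight components of the graded sheaf Hom. -/
def weightPreHomIso (M : GrMod A) (G : QCoh Y) (i : Λ) :
    Cell.emb A i ⋙ preHomObj M.obj G.obj ≅ preHomObj ((weight (-i)).obj M).obj G.obj :=
  NatIso.ofComponents (fun X => AddEquiv.toAddCommGrpIso
      (X := AddCommGrpCat.of (HomSec M.obj G.obj ⟨X.U, i⟩))
      (Y := AddCommGrpCat.of (HomSec ((weight (-i)).obj M).obj G.obj X))
      { toFun := fun φ => ⟨φ.1, φ.2⟩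
        invFun := fun φ => ⟨φ.1, φ.2⟩
        left_inv := fun _ => rfl
        right_inv := fun _ => rfl
        map_add' := fun _ _ => rfl })
    fun {X Z} f => by
      refine ConcreteCategory.hom_ext _ _ fun (φ : HomSec M.obj G.obj ⟨X.U, i⟩) => ?_
      refine Subtype.ext (funext fun W => AddMonoidHom.ext fun x => ?_)
      have e : Cell.act ((Cell.emb A i).map f) W.2 = (Cell.emb A (-i)).map (Cell.act f W.2) :=
        Cell.hom_ext (A.res_str W.2 f.val)
      exact congrArg (fun t => φ.1 ⟨W.1, W.2.trans f.hle⟩ (M.obj.map t x)) e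

/-- The canonical morphism from a weight component of the internal Hom to the sheaf Hom. -/
noncomputable def weightHomε (M : GrMod A) (G : QCoh Y) (i : Λ) :
    ((weight i).obj (homQ M G)).obj ⟶ preHomObj ((weight (-i)).obj M).obj G.obj :=
  Functor.whiskerLeft (Cell.emb A i) (coheratorε (preHomObj M.obj G.obj)) ≫
    (weightPreHomIso M G i).hom

lemma weightHomε_naturality {M M' : GrMod A} {G G' : QCoh Y} (α : M' ⟶ M) (β : G ⟶ G') (i : Λ) :
    ((weight i).map (homQMap α β)).hom ≫ weightHomε M' G' i =
      weightHomε M G i ≫ preHomMap ((weight (-i)).map α).hom β.hom := by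
  have h := coheratorε_naturality (preHomMap α.hom β.hom)
  refine (Category.assoc _ _ _).symm.trans ((congrArg (fun t => Functor.whiskerLeft (Cell.emb A i) t
    ≫ (weightPreHomIso M' G' i).hom) h).trans ?_)
  rfl

lemma existsUnique_weightHomε (M : GrMod A) (G : QCoh Y) (i : Λ) {N : QCoh Y}
    (φ : N.obj ⟶ preHomObj ((weight (-i)).obj M).obj G.obj) :
    ∃! ψ : N ⟶ (weight i).obj (homQ M G), ψ.hom ≫ weightHomε M G i = φ := by
  obtain ⟨ψ, h, hu⟩ := existsUnique_weight_coherator (isAdd_preHomObj M G)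
    (φ ≫ (weightPreHomIso M G i).inv)
  exact ⟨ψ, (Category.assoc _ _ _).symm.trans ((Iso.eq_comp_inv _).1 h),
    fun ψ' h' => hu ψ' ((Iso.eq_comp_inv _).2 ((Category.assoc _ _ _).trans h'))⟩

variable [Y.IsSeparated]

/-- Both objects are couniversal among quasi-coherent sheaves over the same sheaf Hom, by
`existsUnique_weightHomε` and `existsUnique_pushHom`. -/
lemma exists_iso_weightHom (M : GrMod A) (U : Y.affineOpens) (I : Type u) [AddCommGroup I]
    [Module Γ(Y, U.1) I] (i : Λ) :
    ∃ e : (weight i).obj (homQ M (push U I)) ≅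
        push U (Sec ((weight (-i)).obj M) U →ₗ[Γ(Y, U.1)] I),
      e.hom.hom ≫ pushHom U _ I = weightHomε M (push U I) i := by
  obtain ⟨f, hf, -⟩ := existsUnique_pushHom (weightHomε M (push U I) i)
  obtain ⟨g, hg, -⟩ := existsUnique_weightHomε M (push U I) i (pushHom U _ I)
  refine ⟨⟨f, g, ?_, ?_⟩, hf⟩
  · refine (existsUnique_weightHomε M (push U I) i (weightHomε M (push U I) i)).unique ?_
      (Category.id_comp _)
    change (f.hom ≫ g.hom) ≫ _ = _
    rw [Category.assoc, hg, hf]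
  · refine (existsUnique_pushHom (pushHom U ((weight (-i)).obj M) I)).unique ?_
      (Category.id_comp _)
    change (g.hom ≫ f.hom) ≫ _ = _
    rw [Category.assoc, hf, hg]

end weightHom

/-! ### Exactness of the direct image -/

section pushMap
open TensorProduct
variable {Y : Scheme.{u}} [Y.IsSeparated] {U : Y.affineOpens} {N N' N'' : Type u}
  [AddCommGroup N] [AddCommGroup N'] [AddCommGroup N''] [Module Γ(Y, U.1) N]
  [Module Γ(Y, U.1) N'] [Module Γ(Y, U.1) N'']

lemma pushRes_lTensor {V W : Y.affineOpens} (h : inter U W ≤ inter U V)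
    (f : N →ₗ[Γ(Y, U.1)] N') (x : PushSec U N V) :
    pushRes N' h (f.lTensor _ x) = f.lTensor _ (pushRes N h x) := by
  induction x using TensorProduct.induction_on with
  | zero => simp
  | add x y hx hy => simp only [map_add, hx, hy]
  | tmul s n => simp

lemma lTensor_smul_push {V : Y.affineOpens} (f : N →ₗ[Γ(Y, U.1)] N') (r : Γ(Y, (inter U V).1))
    (x : PushSec U N V) : f.lTensor _ (r • x) = r • f.lTensor _ x := by
  induction x using TensorProduct.induction_on with
  | zero => simp
  | add x y hx hy => simp only [map_add, smul_add, hx, hy]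
  | tmul s n => simp [smul_tmul']

/-- The functoriality of the direct image. -/
noncomputable def pushMap (f : N →ₗ[Γ(Y, U.1)] N') : push U N ⟶ push U N' :=
  ObjectProperty.homMk
    (natOfSections (fun V => (f.lTensor Γ(Y, (inter U V).1)).toAddMonoidHom)
      fun {V W} h r x => by
        refine (congrArg (f.lTensor Γ(Y, (inter U W).1)) (push_map N h r x)).trans ?_
        refine Eq.trans ?_ (push_map N' h r _).symm
        exact (lTensor_smul_push f _ _).trans (congrArg (_ • ·) (pushRes_lTensor _ f x).symm))

/-- Flatness of the identity morphism of `Y`, read on a pair of nested affine open sets. -/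
instance flat_inter (U V : Y.affineOpens) : Module.Flat Γ(Y, U.1) Γ(Y, (inter U V).1) := by
  have h := Scheme.Hom.flat_appLE (𝟙 Y) U.2 (inter U V).2 (inter_le_left U V)
  have e : (𝟙 Y : Y ⟶ Y).appLE U.1 (inter U V).1 (inter_le_left U V) =
      Y.presheaf.map (homOfLE (inter_le_left U V)).op := by
    simp only [Scheme.Hom.appLE, Scheme.Hom.id_app]
    exact Category.id_comp _
  rw [e] at h
  exact h

lemma secExact_pushMap (f : N →ₗ[Γ(Y, U.1)] N') (g : N' →ₗ[Γ(Y, U.1)] N'')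
    (h : Function.Exact f g) : SecExact (pushMap f) (pushMap g) := by
  intro V x hx
  obtain ⟨y, hy⟩ := (Module.Flat.lTensor_exact Γ(Y, (inter U V).1) h x).1 hx
  exact ⟨y, hy⟩

/-- The linear map on sections induced by a morphism. -/
def secMap {G G' : QCoh Y} (α : G ⟶ G') (V : Y.affineOpens) : Sec G V →ₗ[Γ(Y, V.1)] Sec G' V where
  toFun := α.hom.app ⟨V, PUnit.unit⟩
  map_add' := app_add α
  map_smul' := app_smul α

lemma pushHom_naturality {M M' : QCoh Y} (α : M ⟶ M') (I : Type u) [AddCommGroup I]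
    [Module Γ(Y, U.1) I] :
    (pushMap (LinearMap.lcomp _ I (secMap α U))).hom ≫ pushHom U M I =
      pushHom U M' I ≫ preHomMap α.hom (𝟙 (push U I) : push U I ⟶ push U I).hom := by
  refine hom_ext_bil_push fun (x : Sec (push U _) U) m => ?_
  rw [← pushEquiv_pushEvalSec x]
  exact (homApp_pushHom_self _ m).trans
    (homApp_pushHom_self (pushEvalSec x) (α.hom.app ⟨U, PUnit.unit⟩ m)).symm

end pushMap

/-! ### Internal Hom into the direct image of an injective module -/

section injective
variable {Y : Scheme.{u}} [Y.IsSeparated] {Λ : Type} [AddCommGroup Λ] [DecidableEq Λ]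
  {A : GradedAlgebra Y Λ}

/-- A map `φ` vanishing on the image of `f` vanishes on the kernel of `g`. It therefore descends to
`M₂ / ker g`, which embeds into `M₃`, and injectivity of `I` extends it. -/
lemma exact_lcomp {R : Type u} [CommRing R] {M₁ M₂ M₃ I : Type u} [AddCommGroup M₁]
    [AddCommGroup M₂] [AddCommGroup M₃] [AddCommGroup I] [Module R M₁] [Module R M₂] [Module R M₃]
    [Module R I] [Module.Injective R I] (f : M₁ →ₗ[R] M₂) (g : M₂ →ₗ[R] M₃)
    (h : Function.Exact f g) : Function.Exact (LinearMap.lcomp R I g) (LinearMap.lcomp R I f) := by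
  intro φ
  constructor
  · intro hφ
    have hk : LinearMap.ker g ≤ LinearMap.ker φ := by
      intro x hx
      obtain ⟨y, rfl⟩ := (h x).1 hx
      exact LinearMap.congr_fun hφ y
    obtain ⟨ψ, hψ⟩ := Module.Injective.out ((LinearMap.ker g).liftQ g le_rfl)
      (LinearMap.ker_eq_bot.1 (Submodule.ker_liftQ_eq_bot _ _ _ le_rfl))
      ((LinearMap.ker g).liftQ φ hk)
    exact ⟨ψ, LinearMap.ext fun x => hψ (Submodule.Quotient.mk x)⟩
  · rintro ⟨ψ, rfl⟩
    ext x
    change ψ (g (f x)) = 0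
    rw [h.apply_apply_eq_zero, map_zero]

/-- In weight `i` the sequence is the direct image of `Hom(-, I)` applied to the weight `-i`
sections over `U`; both operations are exact. -/
lemma secExact_homQ_push (U : Y.affineOpens) (I : Type u) [AddCommGroup I] [Module Γ(Y, U.1) I]
    [Module.Injective Γ(Y, U.1) I] {i : Λ} {M₁ M₂ M₃ : GrMod A} (f : M₁ ⟶ M₂) (g : M₂ ⟶ M₃)
    (hz : f ≫ g = 0) (h : SecExact ((weight (-i)).map f) ((weight (-i)).map g)) :
    SecExact ((weight i).map (homQMap g (𝟙 (push U I))))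
      ((weight i).map (homQMap f (𝟙 (push U I)))) := by
  -- The identifications of `exists_iso_weightHom` are natural: the two composites agree after
  -- composition with `pushHom`, which is couniversal.
  have nat : ∀ {M M' : GrMod A} (α : M ⟶ M')
      (e : (weight i).obj (homQ M (push U I)) ≅ push U (Sec ((weight (-i)).obj M) U →ₗ[Γ(Y, U.1)] I))
      (_ : e.hom.hom ≫ pushHom U _ I = weightHomε M (push U I) i)
      (e' : (weight i).obj (homQ M' (push U I)) ≅
        push U (Sec ((weight (-i)).obj M') U →ₗ[Γ(Y, U.1)] I))
      (_ : e'.hom.hom ≫ pushHom U _ I = weightHomε M' (push U I) i),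
      (weight i).map (homQMap α (𝟙 (push U I))) ≫ e.hom =
        e'.hom ≫ pushMap (LinearMap.lcomp _ I (secMap ((weight (-i)).map α) U)) := by
    intro M M' α e he e' he'
    refine (existsUnique_pushHom (weightHomε M' (push U I) i ≫
      preHomMap ((weight (-i)).map α).hom (𝟙 (push U I) : push U I ⟶ push U I).hom)).unique ?_ ?_
    · change (((weight i).map (homQMap α (𝟙 (push U I)))).hom ≫ e.hom.hom) ≫ _ = _
      rw [Category.assoc, he, weightHomε_naturality]
    · change (e'.hom.hom ≫ (pushMap _).hom) ≫ _ = _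
      rw [Category.assoc, pushHom_naturality, ← Category.assoc, he']
  obtain ⟨e₁, h₁⟩ := exists_iso_weightHom M₁ U I i
  obtain ⟨e₂, h₂⟩ := exists_iso_weightHom M₂ U I i
  obtain ⟨e₃, h₃⟩ := exists_iso_weightHom M₃ U I i
  refine SecExact.of_iso ?_ e₃ e₂ e₁ (nat g e₂ h₂ e₃ h₃) (nat f e₁ h₁ e₂ h₂)
  -- `SecExact` only provides that the kernel lies in the image; the converse inclusion comes from
  -- `hz`.
  refine secExact_pushMap _ _ (exact_lcomp _ _ fun x => ⟨h U x, ?_⟩)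
  rintro ⟨y, rfl⟩
  have := congrArg (fun t => ((weight (-i)).map t).hom.app ⟨U, PUnit.unit⟩ y) hz
  simp only [Functor.map_comp, Functor.map_zero] at this
  exact this

end injective


/-! ### Injectivity of the map to a direct image -/

section embed
open TensorProduct
variable {Y : Scheme.{u}} [Y.IsSeparated] {U : Y.affineOpens} {G : QCoh Y} {N : Type u}
  [AddCommGroup N] [Module Γ(Y, U.1) N]

/-- Here `μ` is the multiplication map `s ⊗ x ↦ s • x|`. It reduces injectivity of `pushLiftSec φ V`
to injectivity of `φ` after a flat base change, and for this the surjectivity of `μ` suffices. -/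
lemma exists_lTensor_eq_pushLiftSec (V : Y.affineOpens) :
    ∃ μ : PushSec U (Sec G U) V →+ Sec G (inter U V), Function.Surjective μ ∧
      ∀ (φ : Sec G U →ₗ[Γ(Y, U.1)] N) (t : PushSec U (Sec G U) V),
        pushLiftSec φ V (μ t) = φ.lTensor Γ(Y, (inter U V).1) t := by
  let μ : PushSec U (Sec G U) V →+ Sec G (inter U V) := TensorProduct.liftAddHom
    (AddMonoidHom.mk' (fun s => AddMonoidHom.mk'
      (fun x : Sec G U => s • Sec.res G (inter_le_left U V) x)
      fun x y => by rw [map_add, smul_add]) fun s t => AddMonoidHom.ext fun x => add_smul s t _)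
    fun r s x => by
      change (r • s) • Sec.res G (inter_le_left U V) x = s • Sec.res G (inter_le_left U V) (r • x)
      rw [Sec.res_smul, smul_smul, Algebra.smul_def, mul_comm]
      rfl
  have hμ : ∀ s x, μ (s ⊗ₜ x) = s • Sec.res G (inter_le_left U V) x := fun s x => rfl
  refine ⟨μ, fun y => ?_, fun φ t => ?_⟩
  · induction y using Sec.induction_res (inter_le_left U V) with
    | hres x => exact ⟨1 ⊗ₜ x, by rw [hμ, one_smul]⟩
    | hadd x y hx hy =>
      obtain ⟨a, rfl⟩ := hx
      obtain ⟨b, rfl⟩ := hy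
      exact ⟨a + b, map_add μ a b⟩
    | hsmul r x hx =>
      obtain ⟨a, rfl⟩ := hx
      refine ⟨r • a, ?_⟩
      induction a using TensorProduct.induction_on with
      | zero => rw [smul_zero, map_zero, smul_zero]
      | add a b ha hb => rw [smul_add, map_add, map_add, smul_add, ha, hb]
      | tmul s x => rw [smul_tmul', hμ, hμ, smul_eq_mul, mul_smul]
  · induction t using TensorProduct.induction_on with
    | zero => rw [map_zero, map_zero, map_zero]
    | add a b ha hb => rw [map_add, map_add, map_add, ha, hb]
    | tmul s x =>
      rw [hμ, map_smul, pushLiftSec_res, smul_tmul', smul_eq_mul, mul_one, LinearMap.lTensor_tmul]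

lemma pushLiftSec_injective (φ : Sec G U →ₗ[Γ(Y, U.1)] N) (hφ : Function.Injective φ)
    (V : Y.affineOpens) : Function.Injective (pushLiftSec φ V) := by
  obtain ⟨μ, hs, hμ⟩ := exists_lTensor_eq_pushLiftSec (N := N) (G := G) (U := U) V
  intro x y e
  obtain ⟨a, rfl⟩ := hs x
  obtain ⟨b, rfl⟩ := hs y
  rw [hμ, hμ] at e
  exact congrArg μ (Module.Flat.lTensor_preserves_injective_linearMap φ hφ e)

lemma res_eq_zero_of_pushLift (φ : Sec G U →ₗ[Γ(Y, U.1)] N) (hφ : Function.Injective φ)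
    (V : Y.affineOpens) (x : Sec G V)
    (hx : (pushLift φ).hom.app ⟨V, PUnit.unit⟩ x = (0 : Sec (push U N) V)) :
    Sec.res G (inter_le_right U V) x = 0 := by
  refine pushLiftSec_injective φ hφ V ?_
  rw [map_zero]
  exact hx

end embed

/-! ### Finite affine covers -/

section cover

lemma exists_finite_affine_cover (Y : Scheme.{u}) [CompactSpace Y] :
    ∃ (n : ℕ) (U : Fin n → Y.affineOpens), ∀ y : Y, ∃ a, y ∈ (U a).1 := by
  obtain ⟨s, hs, e⟩ := (isCompact_iff_finite_and_eq_biUnion_affineOpens (U := (⊤ : Y.Opens))).1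
    isCompact_univ
  have : Finite s := hs
  obtain ⟨n, ⟨r⟩⟩ := Finite.exists_equiv_fin s
  refine ⟨n, fun a => (r.symm a).1, fun y => ?_⟩
  have : y ∈ (⊤ : Y.Opens) := trivial
  rw [e] at this
  simp only [TopologicalSpace.Opens.mem_iSup] at this
  obtain ⟨a, ha, hy⟩ := this
  exact ⟨r ⟨a, ha⟩, by simpa using hy⟩

variable {Y : Scheme.{u}} [Y.IsSeparated]

/-- A section vanishing on the members of an affine open cover is zero. -/
lemma Sec.eq_zero_of_cover {ι : Type*} (U : ι → Y.affineOpens) (hU : ∀ y : Y, ∃ a, y ∈ (U a).1)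
    {G : QCoh Y} {V : Y.affineOpens} (x : Sec G V)
    (h : ∀ a, Sec.res G (inter_le_right (U a) V) x = 0) : x = 0 := by
  refine Sec.eq_zero_of_span {f | ∃ a, Y.basicOpen f ≤ (U a).1} ?_ x ?_
  · rw [← V.2.self_le_iSup_basicOpen_iff]
    intro y hy
    obtain ⟨a, ha⟩ := hU y
    obtain ⟨f, hf, hyf⟩ := V.2.exists_basicOpen_le ⟨y, ha⟩ hy
    exact TopologicalSpace.Opens.mem_iSup.2 ⟨⟨f, a, hf⟩, hyf⟩
  · rintro f ⟨a, ha⟩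
    have h' : Y.affineBasicOpen f ≤ inter (U a) V := le_inter ha (Y.affineBasicOpen_le f)
    rw [← Sec.res_res G (inter_le_right (U a) V) h', h, map_zero]

end cover

/-! ### Injective sheaves as summands of direct images -/

section retract
variable {Y : Scheme.{u}} [Y.IsSeparated]

lemma exists_injective_embedding (R : Type u) [CommRing R] (N : Type u) [AddCommGroup N]
    [Module R N] : ∃ (I : ModuleCat.{u} R) (φ : N →ₗ[R] I), Module.Injective R I ∧
      Function.Injective φ := by
  obtain ⟨⟨I, hI, f, hf⟩⟩ := EnoughInjectives.presentation (ModuleCat.of R N)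
  exact ⟨I, f.hom, Module.injective_module_of_injective_object _ _,
    (ModuleCat.mono_iff_injective f).1 hf⟩

/-- An injective quasi-coherent sheaf on a quasi-compact separated scheme is a direct summand of a
finite sum of direct images of injective modules. -/
theorem exists_sum_push_eq_id [CompactSpace Y] (J : QCoh Y) [Injective J] :
    ∃ (n : ℕ) (U : Fin n → Y.affineOpens) (I : ∀ a, ModuleCat.{u} Γ(Y, (U a).1))
      (s : ∀ a, J ⟶ push (U a) (I a)) (p : ∀ a, push (U a) (I a) ⟶ J),
      (∀ a, Module.Injective Γ(Y, (U a).1) (I a)) ∧ ∑ a, s a ≫ p a = 𝟙 J := by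
  obtain ⟨n, U, hU⟩ := exists_finite_affine_cover Y
  have : HasFiniteBiproducts (QCoh Y) := Abelian.hasFiniteBiproducts
  choose I φ hI hφ using fun a => exists_injective_embedding Γ(Y, (U a).1) (Sec J (U a))
  let s a : J ⟶ push (U a) (I a) := pushLift (φ a)
  -- A section killed by all the `s a` vanishes on every `U a ∩ V`, hence is zero since the `U a`
  -- cover `Y`. Injectivity of `J` then splits this embedding into the finite sum.
  have hs : Mono (biproduct.lift s) := by
    refine Preadditive.mono_of_cancel_zero _ fun {G} g hg => ?_
    have h a : g ≫ s a = 0 := by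
      rw [← biproduct.lift_π s a, ← Category.assoc, hg, zero_comp]
    ext X x
    exact Sec.eq_zero_of_cover U hU (V := X.U) (g.hom.app X x : Sec J X.U) fun a =>
      res_eq_zero_of_pushLift (φ a) (hφ a) X.U _
        (congrArg (fun t => t.hom.app X x) (h a))
  refine ⟨n, U, I, s,
    fun a => biproduct.ι (fun a => push (U a) (I a)) a ≫ Injective.factorThru (𝟙 J) (biproduct.lift s), hI, ?_⟩
  refine biproduct.lift_desc.symm.trans ?_
  refine Eq.trans ?_ (Injective.comp_factorThru (𝟙 J) (biproduct.lift s))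
  exact congrArg _ (biproduct.hom_ext' _ _ fun a => biproduct.ι_desc _ a)

end retract

/-! ### Exactness of the internal Hom into an injective sheaf -/

section exactness
variable {Y : Scheme.{u}} {Λ : Type} [AddCommGroup Λ] [DecidableEq Λ]
  {A : GradedAlgebra Y Λ}

lemma homQMap_add_right {M M' : GrMod A} {G G' : QCoh Y} (α : M' ⟶ M) (β β' : G ⟶ G') :
    homQMap α (β + β') = homQMap α β + homQMap α β' := by
  refine Eq.trans ?_ ((coherator A).map_add)
  rfl

lemma homQMap_sum_right {M : GrMod A} {G G' : QCoh Y} {ι : Type*} (s : Finset ι)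
    (β : ι → (G ⟶ G')) : homQMap (𝟙 M) (∑ a ∈ s, β a) = ∑ a ∈ s, homQMap (𝟙 M) (β a) :=
  map_sum (AddMonoidHom.mk' (fun β => homQMap (𝟙 M) β) (homQMap_add_right (𝟙 M))) β s

lemma sum_app {G G' : QCoh Y} {ι : Type*} (s : Finset ι) (β : ι → (G ⟶ G')) (V : Y.affineOpens)
    (x : Sec G V) : ((∑ a ∈ s, β a).hom.app ⟨V, PUnit.unit⟩ x : Sec G' V) =
      ∑ a ∈ s, ((β a).hom.app ⟨V, PUnit.unit⟩ x : Sec G' V) :=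
  map_sum (AddMonoidHom.mk' (fun β : G ⟶ G' => (β.hom.app ⟨V, PUnit.unit⟩ x : Sec G' V))
    fun _ _ => rfl) β s

variable [Y.IsSeparated]

/-- The internal Hom into an injective quasi-coherent sheaf is exact, weight by weight. -/
theorem secExact_homQ [CompactSpace Y] (J : QCoh Y) [Injective J] {i : Λ} {M₁ M₂ M₃ : GrMod A}
    (f : M₁ ⟶ M₂) (g : M₂ ⟶ M₃) (hz : f ≫ g = 0)
    (h : SecExact ((weight (-i)).map f) ((weight (-i)).map g)) :
    SecExact ((weight i).map (homQMap g (𝟙 J))) ((weight i).map (homQMap f (𝟙 J))) := by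
  obtain ⟨n, U, I, s, p, hI, e⟩ := exists_sum_push_eq_id J
  intro V x hx
  -- Transport `x` along each `s a`, lift it there by the case of direct images, and reassemble the
  -- lifts through the `p a`; the identity `∑ s a ≫ p a = 𝟙` shows that the sum lifts `x`.
  have H a := secExact_homQ_push (i := i) (U a) (I a) f g hz h V
    (((weight i).map (homQMap (𝟙 M₂) (s a))).hom.app ⟨V, PUnit.unit⟩ x) (by
      rw [← comp_app, ← Functor.map_comp, homQMap_comp]
      have : homQMap (f ≫ 𝟙 M₂) (s a ≫ 𝟙 _) = homQMap f (𝟙 J) ≫ homQMap (𝟙 M₁) (s a) := by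
        rw [homQMap_comp, Category.comp_id, Category.comp_id, Category.id_comp, Category.id_comp]
      rw [this, Functor.map_comp, comp_app, hx]
      exact app_zero _ _)
  choose y hy using H
  refine ⟨∑ a, ((weight i).map (homQMap (𝟙 M₃) (p a))).hom.app ⟨V, PUnit.unit⟩ (y a), ?_⟩
  refine (map_sum ((((weight i).map (homQMap g (𝟙 J))).hom.app ⟨V, PUnit.unit⟩).hom) _ _).trans ?_
  have e₁ a : ((weight i).map (homQMap g (𝟙 J))).hom.app ⟨V, PUnit.unit⟩
      (((weight i).map (homQMap (𝟙 M₃) (p a))).hom.app ⟨V, PUnit.unit⟩ (y a)) =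
      ((weight i).map (homQMap (𝟙 M₂) (s a ≫ p a))).hom.app ⟨V, PUnit.unit⟩ x := by
    rw [← comp_app, ← Functor.map_comp, homQMap_comp]
    have : homQMap (g ≫ 𝟙 M₃) (p a ≫ 𝟙 J) =
        homQMap g (𝟙 (push (U a) (I a))) ≫ homQMap (𝟙 M₂) (p a) := by
      rw [homQMap_comp, Category.comp_id, Category.comp_id, Category.id_comp, Category.id_comp]
    rw [this, Functor.map_comp, comp_app, hy, ← comp_app, ← Functor.map_comp, homQMap_comp,
      Category.comp_id]
  refine (Finset.sum_congr rfl fun a _ => e₁ a).trans ?_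
  refine (sum_app _ (fun a => (weight i).map (homQMap (𝟙 M₂) (s a ≫ p a))) V x).symm.trans ?_
  rw [← Functor.map_sum, ← homQMap_sum_right, e, homQMap_id, CategoryTheory.Functor.map_id]
  rfl

end exactness


/-! ### Exactness in graded modules, tested on cells -/

section cells
variable {Y : Scheme.{u}} {Λ : Type} [AddCommGroup Λ] [DecidableEq Λ] {A : GradedAlgebra Y Λ}

/-- The sections of graded modules over a cell. -/
abbrev cellFunctor (X : Cell A) : GrMod A ⥤ AddCommGrpCat.{u} :=
  (isGrMod A).ι ⋙ (evaluation _ _).obj X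

instance (X : Cell A) : PreservesFiniteLimits (cellFunctor X) :=
  comp_preservesFiniteLimits _ _

instance (X : Cell A) : PreservesFiniteColimits (cellFunctor X) :=
  comp_preservesFiniteColimits _ _

lemma isZero_iff_cell (M : GrMod A) : IsZero M ↔ ∀ X, IsZero (M.obj.obj X) := by
  rw [← Functor.isZero_iff]
  exact ⟨fun h => (isGrMod A).ι.map_isZero h, fun h => by
    rw [IsZero.iff_id_eq_zero]
    exact ObjectProperty.hom_ext _ (h.eq_of_src _ _)⟩

/-- Sections over a cell form an exact functor, since finite limits and colimits of quasi-coherent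
modules are computed in presheaves; so this functor commutes with homology. -/
lemma isZero_homology_cell_iff (S : ShortComplex (GrMod A)) (X : Cell A) :
    IsZero (S.homology.obj.obj X) ↔
      ∀ x : S.X₂.obj.obj X, (S.g.hom.app X x : S.X₃.obj.obj X) = 0 →
        ∃ y : S.X₁.obj.obj X, S.f.hom.app X y = x := by
  refine ((S.mapHomologyIso (cellFunctor X)).symm.isZero_iff).trans ?_
  rw [← ShortComplex.exact_iff_isZero_homology, ShortComplex.ab_exact_iff]
  rfl

lemma exact_iff_cell (S : ShortComplex (GrMod A)) :
    S.Exact ↔ ∀ (X : Cell A) (x : S.X₂.obj.obj X), (S.g.hom.app X x : S.X₃.obj.obj X) = 0 →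
      ∃ y : S.X₁.obj.obj X, S.f.hom.app X y = x := by
  rw [ShortComplex.exact_iff_isZero_homology, isZero_iff_cell]
  exact forall_congr' fun X => isZero_homology_cell_iff S X

lemma mono_iff_cell {M N : GrMod A} (f : M ⟶ N) :
    Mono f ↔ ∀ X, Function.Injective (f.hom.app X) := by
  rw [← (isGrMod A).ι.mono_map_iff_mono, NatTrans.mono_iff_mono_app]
  exact forall_congr' fun X => AddCommGrpCat.mono_iff_injective _

lemma epi_iff_cell {M N : GrMod A} (f : M ⟶ N) :
    Epi f ↔ ∀ X, Function.Surjective (f.hom.app X) := by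
  rw [← (isGrMod A).ι.epi_map_iff_epi, NatTrans.epi_iff_epi_app]
  exact forall_congr' fun X => AddCommGrpCat.epi_iff_surjective _

lemma shortExact_iff_cell (S : ShortComplex (GrMod A)) :
    S.ShortExact ↔ ∀ X : Cell A, Function.Injective (S.f.hom.app X) ∧
      (∀ x : S.X₂.obj.obj X, (S.g.hom.app X x : S.X₃.obj.obj X) = 0 →
        ∃ y : S.X₁.obj.obj X, S.f.hom.app X y = x) ∧ Function.Surjective (S.g.hom.app X) := by
  constructor
  · intro h X
    exact ⟨(mono_iff_cell _).1 h.mono_f X, (exact_iff_cell S).1 h.exact X,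
      (epi_iff_cell _).1 h.epi_g X⟩
  · intro h
    have := (mono_iff_cell S.f).2 fun X => (h X).1
    have := (epi_iff_cell S.g).2 fun X => (h X).2.2
    exact ⟨(exact_iff_cell S).2 fun X => (h X).2.1⟩

end cells

/-! ### Internal Hom of short exact sequences -/

section homQ
variable {Y : Scheme.{u}} [Y.IsSeparated] {Λ : Type} [AddCommGroup Λ] [DecidableEq Λ]
  {A : GradedAlgebra Y Λ} [CompactSpace Y]

lemma homQ_exact (J : QCoh Y) [Injective J] {M₁ M₂ M₃ : GrMod A} (f : M₁ ⟶ M₂) (g : M₂ ⟶ M₃)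
    (hz : f ≫ g = 0) (X : Cell A) (h : ∀ (V : Y.affineOpens) (x : M₂.obj.obj ⟨V, -X.i⟩),
      (g.hom.app _ x : M₃.obj.obj ⟨V, -X.i⟩) = 0 → ∃ y : M₁.obj.obj ⟨V, -X.i⟩, f.hom.app _ y = x)
    (x : (homQ M₂ J).obj.obj X)
    (hx : ((homQMap f (𝟙 J)).hom.app X x : (homQ M₁ J).obj.obj X) = 0) :
    ∃ y : (homQ M₃ J).obj.obj X, (homQMap g (𝟙 J)).hom.app X y = x :=
  secExact_homQ J (i := X.i) f g hz h X.U x hx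

lemma homQ_shortExact (J : QCoh Y) [Injective J] (S : ShortComplex (GrMod A)) (hS : S.ShortExact)
    (X : Cell A) : Function.Injective ((homQMap S.g (𝟙 J)).hom.app X) ∧
      (∀ x : (homQ S.X₂ J).obj.obj X,
        ((homQMap S.f (𝟙 J)).hom.app X x : (homQ S.X₁ J).obj.obj X) = 0 →
        ∃ y : (homQ S.X₃ J).obj.obj X, (homQMap S.g (𝟙 J)).hom.app X y = x) ∧
      Function.Surjective ((homQMap S.f (𝟙 J)).hom.app X) := by
  have h X := (shortExact_iff_cell S).1 hS X
  refine ⟨?_, fun x hx => homQ_exact J S.f S.g S.zero X (fun V x hx => (h _).2.1 x hx) x hx, ?_⟩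
  · refine (injective_iff_map_eq_zero ((homQMap S.g (𝟙 J)).hom.app X).hom).2 fun x hx => ?_
    -- Surjectivity of `S.g` is exactness of `S.g` followed by zero, so an element in the kernel
    -- comes from the zero map, and is zero.
    obtain ⟨y, rfl⟩ := homQ_exact J S.g (0 : S.X₃ ⟶ S.X₃) comp_zero X
      (fun V x _ => (h _).2.2 x) x hx
    rw [homQMap_zero_left]
    rfl
  · intro x
    -- Dually, injectivity of `S.f` is exactness of zero followed by `S.f`; every element is killed
    -- by the zero map and therefore lifts.
    refine homQ_exact J (0 : S.X₁ ⟶ S.X₁) S.f zero_comp X (fun V x hx => ⟨0, ?_⟩) x ?_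
    · exact ((h _).1 (hx.trans (map_zero (S.f.hom.app _).hom).symm)).symm
    · rw [homQMap_zero_left]
      rfl

end homQ

/-! ### Sections of essentially finite products -/

section products
variable {Y : Scheme.{u}} {Λ : Type} [AddCommGroup Λ] [DecidableEq Λ] {A : GradedAlgebra Y Λ}
  {ι : Type} [Small.{u} ι] (F : ι → GrMod A)

/-- The sections of a product with only finitely many nonzero factors. -/
lemma pi_bijective (s : Finset ι) (hs : ∀ j ∉ s, IsZero (F j)) (X : Cell A) :
    Function.Bijective fun (y : (∏ᶜ F).obj.obj X) (j : ι) =>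
      ((Pi.π F j).hom.app X y : (F j).obj.obj X) := by
  classical
  let e (j : ι) : F j ⟶ ∏ᶜ F := Pi.lift fun k =>
    if h : j = k then eqToHom (congrArg F h) else 0
  have e_self (j : ι) : e j ≫ Pi.π F j = 𝟙 _ := by simp [e]
  have e_ne (j k : ι) (h : j ≠ k) : e j ≫ Pi.π F k = 0 := by simp [e, h]
  -- With finitely many nonzero factors the product is also a biproduct: its identity is a finite
  -- sum of projections followed by inclusions, and this identity can be evaluated on sections.
  have hid : 𝟙 (∏ᶜ F) = ∑ j ∈ s, Pi.π F j ≫ e j := by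
    refine Pi.hom_ext _ _ fun k => ?_
    by_cases hk : k ∈ s
    · rw [Preadditive.sum_comp, Finset.sum_eq_single_of_mem k hk, Category.assoc, e_self,
        Category.id_comp, Category.comp_id]
      intro j _ hj
      rw [Category.assoc, e_ne j k hj, comp_zero]
    · exact (hs k hk).eq_of_tgt _ _
  have happ (y : (∏ᶜ F).obj.obj X) :
      y = ∑ j ∈ s, (e j).hom.app X ((Pi.π F j).hom.app X y) := by
    refine (congrArg (fun t => (t.hom.app X y : (∏ᶜ F).obj.obj X)) hid).trans ?_
    exact map_sum (AddMonoidHom.mk' (fun t : ∏ᶜ F ⟶ ∏ᶜ F => (t.hom.app X y : (∏ᶜ F).obj.obj X))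
      fun _ _ => rfl) (fun j => Pi.π F j ≫ e j) s
  constructor
  · intro x y h
    rw [happ x, happ y]
    exact Finset.sum_congr rfl fun j _ => congrArg ((e j).hom.app X) (congrFun h j)
  · intro t
    refine ⟨∑ j ∈ s, (e j).hom.app X (t j), funext fun k => ?_⟩
    refine (map_sum ((Pi.π F k).hom.app X).hom _ _).trans ?_
    by_cases hk : k ∈ s
    · rw [Finset.sum_eq_single_of_mem k hk]
      · exact congrArg (fun q => (q.hom.app X (t k) : (F k).obj.obj X)) (e_self k)
      · intro j _ hj
        exact congrArg (fun q => (q.hom.app X (t j) : (F k).obj.obj X)) (e_ne j k hj)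
    · have := (isZero_iff_cell (F k)).1 (hs k hk) X
      have := AddCommGrpCat.subsingleton_of_isZero this
      exact Subsingleton.elim _ _

end products


/-! ### The dual of a short exact sequence of complexes -/

section dualExact
variable {Y : Scheme.{u}} {Λ : Type} [AddCommGroup Λ] [DecidableEq Λ] {A : GradedAlgebra Y Λ}

lemma isZero_homQ (M : GrMod A) {G : QCoh Y} (hG : IsZero G) : IsZero (homQ M G) := by
  rw [IsZero.iff_id_eq_zero, ← homQMap_id, hG.eq_of_src (𝟙 G) 0, homQMap_zero_right]

/-- The components of the sections of a Hom complex. -/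
noncomputable def dualComp (J : CochainComplex (QCoh Y) ℤ) (M : CochainComplex (GrMod A) ℤ) (n : ℤ) (X : Cell A)
    (x : HomIdx n) (y : (dualX J M n).obj.obj X) : (homQ (M.X x.1.1) (J.X x.1.2)).obj.obj X :=
  (Pi.π (fun x : HomIdx n => homQ (M.X x.1.1) (J.X x.1.2)) x).hom.app X y

lemma dualComp_zero (J : CochainComplex (QCoh Y) ℤ) (M : CochainComplex (GrMod A) ℤ) (n : ℤ)
    (X : Cell A) (x : HomIdx n) : dualComp J M n X x 0 = 0 :=
  map_zero ((Pi.π (fun x : HomIdx n => homQ (M.X x.1.1) (J.X x.1.2)) x).hom.app X).hom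

/-- Boundedness of `J` enters here. In total degree `n` only the indices `(q - n, q)` with `m ≤ q ≤
k` contribute, so sections of the product are families of sections. -/
lemma dualComp_bijective {J : CochainComplex (QCoh Y) ℤ}
    (hJ : ∃ m k : ℤ, J.IsStrictlyGE m ∧ J.IsStrictlyLE k) (M : CochainComplex (GrMod A) ℤ) (n : ℤ)
    (X : Cell A) : Function.Bijective fun y x => dualComp J M n X x y := by
  classical
  obtain ⟨m, k, hm, hk⟩ := hJ
  refine pi_bijective (fun x : HomIdx n => homQ (M.X x.1.1) (J.X x.1.2))
    ((Finset.Icc m k).image fun q => ⟨(q - n, q), by simp⟩) (fun x hx => isZero_homQ _ ?_) X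
  obtain h | h : x.1.2 < m ∨ k < x.1.2 := by
    by_contra! h
    refine hx (Finset.mem_image.2 ⟨x.1.2, Finset.mem_Icc.2 h, Subtype.ext (Prod.ext ?_ rfl)⟩)
    have := x.2
    simp only
    omega
  · exact CochainComplex.isZero_of_isStrictlyGE J m _ h
  · exact CochainComplex.isZero_of_isStrictlyLE J k _ h

lemma dualComp_dualMapX (J : CochainComplex (QCoh Y) ℤ) {M M' : CochainComplex (GrMod A) ℤ}
    (f : M' ⟶ M) (n : ℤ) (X : Cell A) (x : HomIdx n) (y : (dualX J M n).obj.obj X) :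
    dualComp J M' n X x ((dualMapX J f n).hom.app X y) =
      (homQMap (f.f x.1.1) (𝟙 (J.X x.1.2))).hom.app X (dualComp J M n X x y) :=
  congrArg (fun t => (t.hom.app X y : (homQ (M'.X x.1.1) (J.X x.1.2)).obj.obj X))
    (Limits.Pi.map_π (fun x : HomIdx n => homQMap (f.f x.1.1) (𝟙 (J.X x.1.2))) x)

lemma units_smul_app {M N : GrMod A} (e : ℤˣ) (f : M ⟶ N) (X : Cell A) (x : M.obj.obj X) :
    ((e • f).hom.app X x : N.obj.obj X) = e • (f.hom.app X x : N.obj.obj X) := by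
  obtain rfl | rfl := Int.units_eq_one_or e
  · rw [one_smul, one_smul]
  · rw [Units.neg_smul, Units.neg_smul, one_smul, one_smul]
    rfl

lemma dualComp_dualD (J : CochainComplex (QCoh Y) ℤ) (M : CochainComplex (GrMod A) ℤ) (n : ℤ)
    (X : Cell A) (p q : ℤ) (h : q = p + (n + 1)) (y : (dualX J M n).obj.obj X) :
    dualComp J M (n + 1) X ⟨(p, q), h⟩ ((dualD J M n).hom.app X y) =
      (homQMap (𝟙 (M.X p)) (J.d (q - 1) q)).hom.app X
        (dualComp J M n X ⟨(p, q - 1), by dsimp only; omega⟩ y) +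
      (n + 1).negOnePow • ((homQMap (M.d p (p + 1)) (𝟙 (J.X q))).hom.app X
        (dualComp J M n X ⟨(p + 1, q), by dsimp only; omega⟩ y) : (homQ (M.X p) (J.X q)).obj.obj X) := by
  have e : dualD J M n ≫ Pi.π (fun x : HomIdx (n + 1) => homQ (M.X x.1.1) (J.X x.1.2))
      (⟨(p, q), h⟩ : HomIdx (n + 1)) =
      Pi.π (fun x : HomIdx n => homQ (M.X x.1.1) (J.X x.1.2))
        ⟨(p, q - 1), by dsimp only; omega⟩ ≫ homQMap (𝟙 (M.X p)) (J.d (q - 1) q) +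
      (n + 1).negOnePow • (Pi.π (fun x : HomIdx n => homQ (M.X x.1.1) (J.X x.1.2))
        ⟨(p + 1, q), by dsimp only; omega⟩ ≫ homQMap (M.d p (p + 1)) (𝟙 (J.X q))) :=
    Pi.lift_π _ _
  refine (congrArg (fun t : dualX J M n ⟶ homQ (M.X p) (J.X q) =>
    (t.hom.app X y : (homQ (M.X p) (J.X q)).obj.obj X)) e).trans ?_
  exact congrArg (fun t : (homQ (M.X p) (J.X q)).obj.obj X => _ + t) (units_smul_app _ _ X y)

variable [Y.IsSeparated] [CompactSpace Y]

/-- The functor `dual`, applied to a short complex. -/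
noncomputable def dualShortComplex (J : CochainComplex (QCoh Y) ℤ)
    (S : ShortComplex (CochainComplex (GrMod A) ℤ)) :
    ShortComplex (CochainComplex (GrMod A) ℤ) :=
  ShortComplex.mk (dualMap J S.g) (dualMap J S.f) (by
    ext n : 1
    change dualMapX J S.g n ≫ dualMapX J S.f n = 0
    refine Pi.hom_ext _ _ fun x => ?_
    have : S.f.f x.1.1 ≫ S.g.f x.1.1 = 0 := by
      rw [← HomologicalComplex.comp_f, S.zero, HomologicalComplex.zero_f]
    simp [dualMapX, homQMap_comp, this, homQMap_zero_left])

/-- Short exactness of complexes is tested degree by degree and cell by cell. There the dual is a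
product of internal Homs into injective sheaves, so `homQ_shortExact` applies to each component. -/
theorem dualShortComplex_shortExact {J : CochainComplex (QCoh Y) ℤ}
    (hJ : ∃ m k : ℤ, J.IsStrictlyGE m ∧ J.IsStrictlyLE k) (hJ' : ∀ n, Injective (J.X n))
    {S : ShortComplex (CochainComplex (GrMod A) ℤ)} (hS : S.ShortExact) :
    (dualShortComplex J S).ShortExact := by
  refine HomologicalComplex.shortExact_of_degreewise_shortExact _ fun n => ?_
  rw [shortExact_iff_cell]
  intro X
  have H (x : HomIdx n) := homQ_shortExact (J.X x.1.2)
    (S.map (HomologicalComplex.eval _ _ x.1.1)) (hS.map_of_exact (HomologicalComplex.eval _ _ x.1.1)) X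
  change Function.Injective ((dualMapX J S.g n).hom.app X) ∧
    (∀ x : (dualX J S.X₂ n).obj.obj X,
      ((dualMapX J S.f n).hom.app X x : (dualX J S.X₁ n).obj.obj X) = 0 →
      ∃ y : (dualX J S.X₃ n).obj.obj X, (dualMapX J S.g n).hom.app X y = x) ∧
    Function.Surjective ((dualMapX J S.f n).hom.app X)
  refine ⟨fun a b e => ?_, fun a ha => ?_, fun a => ?_⟩
  · refine (dualComp_bijective hJ S.X₃ n X).1 (funext fun x => (H x).1 ?_)
    exact (dualComp_dualMapX J S.g n X x a).symm.trans
      ((congrArg _ e).trans (dualComp_dualMapX J S.g n X x b))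
  · have h0 (x : HomIdx n) : ((homQMap (S.f.f x.1.1) (𝟙 (J.X x.1.2))).hom.app X
        (dualComp J S.X₂ n X x a) : (homQ (S.X₁.X x.1.1) (J.X x.1.2)).obj.obj X) = 0 :=
      (dualComp_dualMapX J S.f n X x a).symm.trans
        ((congrArg _ ha).trans (dualComp_zero J S.X₁ n X x))
    choose b hb using fun x => (H x).2.1 _ (h0 x)
    obtain ⟨y, hy⟩ := (dualComp_bijective hJ S.X₃ n X).2 b
    refine ⟨y, (dualComp_bijective hJ S.X₂ n X).1 (funext fun x => ?_)⟩
    exact (dualComp_dualMapX J S.g n X x y).trans ((congrArg _ (congrFun hy x)).trans (hb x))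
  · choose b hb using fun x => (H x).2.2 (dualComp J S.X₁ n X x a)
    obtain ⟨y, hy⟩ := (dualComp_bijective hJ S.X₂ n X).2 b
    refine ⟨y, (dualComp_bijective hJ S.X₁ n X).1 (funext fun x => ?_)⟩
    exact (dualComp_dualMapX J S.f n X x y).trans ((congrArg _ (congrFun hy x)).trans (hb x))

end dualExact

/-! ### Bounded double complexes with exact rows -/

section doubleComplex

/-- A bounded double complex of abelian groups with exact rows has an acyclic total complex. -/
theorem exists_of_exact_rows {C : ℤ → ℤ → Type*} [∀ p q, AddCommGroup (C p q)]
    (dv : ∀ p q, C p (q - 1) →+ C p q) (dh : ∀ p q, C (p + 1) q →+ C p q)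
    (hvv : ∀ p q x, dv p q (dv p (q - 1) x) = 0)
    (hvh : ∀ p q x, dv p q (dh p (q - 1) x) = dh p q (dv (p + 1) q x))
    (hh : ∀ p q (x : C (p + 1) q), dh p q x = 0 → ∃ w, dh (p + 1) q w = x)
    (m k : ℤ) (hm : ∀ p q, q < m → Subsingleton (C p q)) (hk : ∀ p q, k < q → Subsingleton (C p q))
    (n : ℤ) (e : ℤˣ) (y : ∀ p q, q = p + (n + 1) → C p q)
    (hy : ∀ p q (h : q = p + (n + 1 + 1)), dv p q (y p (q - 1) (by omega)) -
      e • dh p q (y (p + 1) q (by omega)) = 0) :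
    ∃ z : ∀ p q, q = p + n → C p q, ∀ p q (h : q = p + (n + 1)),
      dv p q (z p (q - 1) (by omega)) + e • dh p q (z (p + 1) q (by omega)) = y p q h := by
  -- The primitive is constructed by increasing `q`: for `q < m` nothing is required, each step adds
  -- the components with `q = m + l`, and beyond `k` all groups vanish.
  suffices H : ∀ l : ℕ, ∃ z : ∀ p q, q = p + n → C p q, ∀ p q (h : q = p + (n + 1)), q < m + l →
      dv p q (z p (q - 1) (by omega)) + e • dh p q (z (p + 1) q (by omega)) = y p q h by
    obtain ⟨z, hz⟩ := H (k + 1 - m).toNat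
    refine ⟨z, fun p q h => ?_⟩
    by_cases hq : k < q
    · have := hk p q hq
      exact Subsingleton.elim _ _
    · exact hz p q h (by omega)
  intro l
  induction l with
  | zero =>
    refine ⟨fun _ _ _ => 0, fun p q h hq => ?_⟩
    have := hm p q (by omega)
    exact Subsingleton.elim _ _
  | succ l ih =>
    obtain ⟨z, hz⟩ := ih
    obtain ⟨Q, hQ⟩ : ∃ Q, Q = m + (l : ℤ) := ⟨_, rfl⟩
    -- The equation at `(p₁ + 1, Q)` is the only one on the line `q = Q`; its new unknown is `z` at
    -- `(p₁ + 2, Q)`.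
    obtain ⟨p₁, hp₁⟩ : ∃ p₁ : ℤ, Q = p₁ + 1 + (n + 1) := ⟨Q - n - 2, by ring⟩
    obtain ⟨w, hw⟩ := hh p₁ Q
      (e • (y (p₁ + 1) Q hp₁ - dv (p₁ + 1) Q (z (p₁ + 1) (Q - 1) (by omega)))) (by
        -- The error in this equation is a `dh`-cycle: apply `dv` to the equation already solved at
        -- `(p₁, Q - 1)` and compare with the cocycle condition at `(p₁, Q)`. The sign `e` is its
        -- own inverse.
        have h1 := congrArg (dv p₁ Q) (hz p₁ (Q - 1) (by omega) (by omega))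
        have h2 := hy p₁ Q (by omega)
        rw [map_add, hvv, zero_add, Units.smul_def, map_zsmul, hvh, ← Units.smul_def] at h1
        rw [← h1, ← smul_sub, ← map_sub] at h2
        rw [Units.smul_def, map_zsmul, ← Units.smul_def, ← neg_eq_zero, ← smul_neg, ← map_neg, neg_sub]
        exact h2)
    let z' : ∀ p q, q = p + n → C p q := fun p q h =>
      if hq : q = Q then
        (show p = p₁ + 1 + 1 by omega) ▸ hq ▸ w
      else z p q h
    have hz' p q h (hq : q ≠ Q) : z' p q h = z p q h := dif_neg hq
    have hw' h : z' (p₁ + 1 + 1) Q h = w := dif_pos rfl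
    refine ⟨z', fun p q h hq => ?_⟩
    by_cases hqQ : q = Q
    · subst hqQ
      obtain rfl : p = p₁ + 1 := by omega
      rw [hw', hw, smul_smul, Int.units_mul_self, one_smul, hz' _ _ _ (by omega), add_sub_cancel]
    · rw [hz' _ _ _ (by omega), hz' _ _ _ hqQ]
      exact hz p q h (by push_cast at hq; omega)

end doubleComplex


/-! ### Duality preserves acyclicity in a given weight -/

section acyclic
variable {Y : Scheme.{u}} {Λ : Type} [AddCommGroup Λ] [DecidableEq Λ] {A : GradedAlgebra Y Λ}

/-- The vanishing of the cohomology of a complex in weight `i`, in terms of cocycles. -/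
def AcyclicInWeight (i : Λ) (K : CochainComplex (GrMod A) ℤ) : Prop :=
  ∀ (p : ℤ) (V : Y.affineOpens) (x : (K.X (p + 1)).obj.obj ⟨V, i⟩),
    ((K.d (p + 1) (p + 1 + 1)).hom.app _ x : (K.X (p + 1 + 1)).obj.obj ⟨V, i⟩) = 0 →
      ∃ y : (K.X p).obj.obj ⟨V, i⟩, (K.d p (p + 1)).hom.app _ y = x

lemma isZeroInWeight_iff (i : Λ) (K : CochainComplex (GrMod A) ℤ) :
    IsZeroInWeight i (DerivedCategory.Q.obj K) ↔ AcyclicInWeight i K := by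
  have H (p : ℤ) : IsZero ((weight i).obj ((DerivedCategory.homologyFunctor (GrMod A) (p + 1)).obj
      (DerivedCategory.Q.obj K))) ↔ ∀ (V : Y.affineOpens) (x : (K.X (p + 1)).obj.obj ⟨V, i⟩),
    ((K.d (p + 1) (p + 1 + 1)).hom.app _ x : (K.X (p + 1 + 1)).obj.obj ⟨V, i⟩) = 0 →
      ∃ y : (K.X p).obj.obj ⟨V, i⟩, (K.d p (p + 1)).hom.app _ y = x := by
    have e : (DerivedCategory.homologyFunctor (GrMod A) (p + 1)).obj (DerivedCategory.Q.obj K) ≅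
        (K.sc' p (p + 1) (p + 1 + 1)).homology :=
      (DerivedCategory.homologyFunctorFactors (GrMod A) (p + 1)).app K ≪≫
        ShortComplex.homologyMapIso (K.isoSc' p (p + 1) (p + 1 + 1) (by simp) (by simp))
    rw [((weight i).mapIso e).isZero_iff, isZero_iff_cell]
    refine Iff.trans ⟨fun h V => h ⟨V, PUnit.unit⟩, fun h X => h X.U⟩
      (forall_congr' fun V => isZero_homology_cell_iff (K.sc' p (p + 1) (p + 1 + 1)) ⟨V, i⟩)
  refine ⟨fun h p => (H p).1 (h _), fun h n => ?_⟩
  have := (H (n - 1)).2 (h (n - 1))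
  rwa [sub_add_cancel] at this

lemma AcyclicInWeight.twist {i a : Λ} {K : CochainComplex (GrMod A) ℤ}
    (h : AcyclicInWeight (i + a) K) : AcyclicInWeight i ((twistCpx a).obj K) :=
  fun p V x hx => h p V x hx

/-- Dualizing preserves acyclicity, weight by weight. -/
theorem AcyclicInWeight.dual [Y.IsSeparated] [CompactSpace Y] {J : CochainComplex (QCoh Y) ℤ}
    (hJ : ∃ m k : ℤ, J.IsStrictlyGE m ∧ J.IsStrictlyLE k) (hJ' : ∀ n, Injective (J.X n))
    {i : Λ} {K : CochainComplex (GrMod A) ℤ} (h : AcyclicInWeight (-i) K) :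
    AcyclicInWeight i (HFF.dual J K) := by
  intro n V x hx
  have e (n : ℤ) : (HFF.dual J K).d n (n + 1) = dualD J K n := CochainComplex.of_d _ _ _
  rw [e] at hx ⊢
  let X : Cell A := ⟨V, i⟩
  change (dualX J K (n + 1)).obj.obj X at x
  change ((dualD J K (n + 1)).hom.app X x : (dualX J K (n + 1 + 1)).obj.obj X) = 0 at hx
  change ∃ y : (dualX J K n).obj.obj X, (dualD J K n).hom.app X y = x
  obtain ⟨m, k, hm, hk⟩ := hJ
  have hsub p q (hq : IsZero (J.X q)) : Subsingleton ((homQ (K.X p) (J.X q)).obj.obj X) :=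
    AddCommGrpCat.subsingleton_of_isZero ((isZero_iff_cell _).1 (isZero_homQ (K.X p) hq) X)
  -- The double complex is `Hom(K_p, J_q)` in weight `i`. Its rows have `q` fixed, and are exact
  -- because `J_q` is injective and `K` is acyclic in weight `-i`.
  obtain ⟨z, hz⟩ := exists_of_exact_rows (C := fun p q => (homQ (K.X p) (J.X q)).obj.obj X)
    (fun p q => ((homQMap (𝟙 (K.X p)) (J.d (q - 1) q)).hom.app X).hom)
    (fun p q => ((homQMap (K.d p (p + 1)) (𝟙 (J.X q))).hom.app X).hom)
    (fun p q x => by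
      have : homQMap (𝟙 (K.X p)) (J.d (q - 1 - 1) (q - 1)) ≫ homQMap (𝟙 (K.X p)) (J.d (q - 1) q) =
          0 := by
        rw [homQMap_comp, HomologicalComplex.d_comp_d, homQMap_zero_right]
      exact congrArg (fun t => (t.hom.app X x : (homQ (K.X p) (J.X q)).obj.obj X)) this)
    (fun p q x => by
      have : homQMap (K.d p (p + 1)) (𝟙 (J.X (q - 1))) ≫ homQMap (𝟙 (K.X p)) (J.d (q - 1) q) =
          homQMap (𝟙 (K.X (p + 1))) (J.d (q - 1) q) ≫ homQMap (K.d p (p + 1)) (𝟙 (J.X q)) := by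
        rw [homQMap_comp, homQMap_comp, Category.id_comp, Category.id_comp, Category.comp_id,
          Category.comp_id]
      exact congrArg (fun t => (t.hom.app X x : (homQ (K.X p) (J.X q)).obj.obj X)) this)
    (fun p q x hx => homQ_exact (J.X q) (K.d p (p + 1)) (K.d (p + 1) (p + 1 + 1))
      (K.d_comp_d _ _ _) X (h p) x hx)
    m k (fun p q hq => hsub p q (CochainComplex.isZero_of_isStrictlyGE J m _ hq))
    (fun p q hq => hsub p q (CochainComplex.isZero_of_isStrictlyLE J k _ hq))
    n (n + 1).negOnePow (fun p q h => dualComp J K (n + 1) X ⟨(p, q), h⟩ x)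
    (fun p q h => by
      have := dualComp_dualD J K (n + 1) X p q h x
      -- The differential out of degree `n + 1` carries the sign opposite to the one out of degree
      -- `n`; hence the minus sign in the cocycle condition.
      rw [hx, dualComp_zero, Int.negOnePow_succ (n + 1), Units.neg_smul, ← sub_eq_add_neg] at this
      exact this.symm)
  obtain ⟨y, hy⟩ := (dualComp_bijective ⟨m, k, hm, hk⟩ K n X).2 fun x => z x.1.1 x.1.2 x.2
  refine ⟨y, (dualComp_bijective ⟨m, k, hm, hk⟩ K (n + 1) X).1 (funext fun ⟨⟨p, q⟩, hpq⟩ => ?_)⟩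
  refine (dualComp_dualD J K n X p q hpq y).trans (Eq.trans ?_ (hz p q hpq))
  rw [show dualComp J K n X ⟨(p, q - 1), _⟩ y = _ from congrFun hy _,
    show dualComp J K n X ⟨(p + 1, q), _⟩ y = _ from congrFun hy _]

end acyclic

/-! ### Exactness of weight components and twists -/

section exactFunctors
variable {Y : Scheme.{u}} {Λ : Type} [AddCommGroup Λ] [DecidableEq Λ] {A : GradedAlgebra Y Λ}

/-- Short exactness is tested on cells, and each cell of a weight component is a cell of the
original module. -/
lemma weight_exact (i : Λ) : PreservesFiniteLimits (weight (A := A) i) ∧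
    PreservesFiniteColimits (weight (A := A) i) :=
  ((Functor.exact_tfae (weight (A := A) i)).out 0 3).1 fun S hS => (shortExact_iff_cell _).2
    fun X => (shortExact_iff_cell S).1 hS ⟨X.U, i⟩

instance (i : Λ) : PreservesFiniteLimits (weight (A := A) i) := (weight_exact i).1

instance (i : Λ) : PreservesFiniteColimits (weight (A := A) i) := (weight_exact i).2

lemma twist_exact (a : Λ) : PreservesFiniteLimits (twist (A := A) a) ∧
    PreservesFiniteColimits (twist (A := A) a) :=
  ((Functor.exact_tfae (twist (A := A) a)).out 0 3).1 fun S hS => (shortExact_iff_cell _).2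
    fun X => (shortExact_iff_cell S).1 hS ⟨X.U, X.i + a⟩

instance (a : Λ) : PreservesFiniteLimits (twist (A := A) a) := (twist_exact a).1

instance (a : Λ) : PreservesFiniteColimits (twist (A := A) a) := (twist_exact a).2

end exactFunctors

/-! ### Exact functors on derived categories -/

section derived
variable {C D : Type*} [Category* C] [Abelian C] [Category* D] [Abelian D] (F : C ⥤ D) [F.Additive]
  [PreservesFiniteLimits F] [PreservesFiniteColimits F]

/-- An exact functor commutes with the cohomology of complexes. -/
noncomputable def mapHomologicalComplexHomologyIso (n : ℤ) :
    F.mapHomologicalComplex (.up ℤ) ⋙ HomologicalComplex.homologyFunctor D (.up ℤ) n ≅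
      HomologicalComplex.homologyFunctor C (.up ℤ) n ⋙ F :=
  NatIso.ofComponents (fun K => (K.sc n).mapHomologyIso F) fun f =>
    ShortComplex.mapHomologyIso_hom_naturality
      ((HomologicalComplex.shortComplexFunctor C (.up ℤ) n).map f) F

/-- The extension of an exact functor to derived categories commutes with cohomology. -/
noncomputable def mapDerivedCategoryHomologyIso (n : ℤ) :
    F.mapDerivedCategory ⋙ DerivedCategory.homologyFunctor D n ≅
      DerivedCategory.homologyFunctor C n ⋙ F :=
  Localization.liftNatIso DerivedCategory.Q (HomologicalComplex.quasiIso C (.up ℤ))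
    (DerivedCategory.Q ⋙ F.mapDerivedCategory ⋙ DerivedCategory.homologyFunctor D n)
    (DerivedCategory.Q ⋙ DerivedCategory.homologyFunctor C n ⋙ F) _ _
    (Functor.isoWhiskerRight F.mapDerivedCategoryFactors (DerivedCategory.homologyFunctor D n) ≪≫
      Functor.isoWhiskerLeft (F.mapHomologicalComplex (.up ℤ))
        (DerivedCategory.homologyFunctorFactors D n) ≪≫
      mapHomologicalComplexHomologyIso F n ≪≫
      Functor.isoWhiskerRight (DerivedCategory.homologyFunctorFactors C n).symm F)

lemma isIso_mapDerivedCategory_map_iff {K L : DerivedCategory C} (φ : K ⟶ L) :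
    IsIso (F.mapDerivedCategory.map φ) ↔
      ∀ n : ℤ, IsIso (F.map ((DerivedCategory.homologyFunctor C n).map φ)) := by
  rw [DerivedCategory.isIso_iff]
  exact forall_congr' fun n => NatIso.isIso_map_iff (mapDerivedCategoryHomologyIso F n) φ

lemma isZero_iff_homology (K : DerivedCategory C) :
    IsZero K ↔ ∀ n : ℤ, IsZero ((DerivedCategory.homologyFunctor C n).obj K) := by
  refine ⟨fun h n => (DerivedCategory.homologyFunctor C n).map_isZero h, fun h => ?_⟩
  have : IsIso (0 : K ⟶ K) := by
    rw [DerivedCategory.isIso_iff]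
    exact fun n => (h n).isIso (h n) _
  rw [IsZero.iff_id_eq_zero]
  exact isIsoZeroSelfEquiv _ this

lemma isZero_mapDerivedCategory_obj_iff (K : DerivedCategory C) :
    IsZero (F.mapDerivedCategory.obj K) ↔
      ∀ n : ℤ, IsZero (F.obj ((DerivedCategory.homologyFunctor C n).obj K)) := by
  rw [isZero_iff_homology]
  exact forall_congr' fun n => ((mapDerivedCategoryHomologyIso F n).app K).isZero_iff

end derived


/-! ### The local cohomology sequence -/

section localCohomology
variable {Y : Scheme.{u}} {Λ : Type} [AddCommGroup Λ] [DecidableEq Λ] {A : GradedAlgebra Y Λ}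

/-- The counit of the coherator need not be a monomorphism of presheaves. However, maps from
quasi-coherent modules into a coherator are determined by their composite with the counit, and the
torsion presheaf is a subpresheaf of `M`. -/
instance (S : Set Λ) (M : GrMod A) : Mono ((Γtorsι S).app M) where
  right_cancellation {N} g h e := by
    have : Mono ((torsPreι S).app M) := by
      rw [NatTrans.mono_iff_mono_app]
      exact fun X => (AddCommGrpCat.mono_iff_injective _).2 Subtype.val_injective
    refine coheratorε_ext ((cancel_mono ((torsPreι S).app M)).1 ?_)
    refine (Category.assoc _ _ _).trans (Eq.trans ?_ (Category.assoc _ _ _).symm)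
    exact congrArg (fun t => t.hom) e

instance (S : Set Λ) : Mono (RΓι A S) :=
  have (n : ℤ) : Mono ((RΓι A S).f n) := inferInstanceAs (Mono ((Γtorsι S).app _))
  HomologicalComplex.mono_of_mono_f _ this

variable (A) in
/-- The local cohomology sequence. -/
noncomputable def localCohomologySequence (S : Set Λ) :
    ShortComplex (CochainComplex (GrMod A) ℤ) :=
  ShortComplex.mk (RΓι A S) (cokernel.π (RΓι A S)) (cokernel.condition _)

lemma localCohomologySequence_shortExact (S : Set Λ) :
    (localCohomologySequence A S).ShortExact where
  exact := ShortComplex.exact_cokernel _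
  mono_f := inferInstanceAs (Mono (RΓι A S))
  epi_g := inferInstanceAs (Epi (cokernel.π (RΓι A S)))

lemma shortExact_map_twistCpx (a : Λ) {S : ShortComplex (CochainComplex (GrMod A) ℤ)}
    (hS : S.ShortExact) : (S.map (twistCpx a)).ShortExact :=
  HomologicalComplex.shortExact_of_degreewise_shortExact _ fun n =>
    (hS.map_of_exact (HomologicalComplex.eval _ _ n)).map_of_exact (twist a)

end localCohomology

/-! ### Duality and the injective resolution -/

section resolution
variable {Y : Scheme.{u}} {Λ : Type} [AddCommGroup Λ] [DecidableEq Λ] {A : GradedAlgebra Y Λ}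

/-- In degree zero the map is the coaugmentation, and in the other degrees its source is zero. -/
instance mono_ι' {C : Type*} [Category* C] [Abelian C] {X : C} (R : InjectiveResolution X) :
    Mono R.ι' := by
  refine HomologicalComplex.mono_of_mono_f _ fun n => ?_
  by_cases hn : n = 0
  · subst hn
    rw [InjectiveResolution.ι'_f_zero]
    have : Mono (R.ι.f 0) := inferInstance
    have h₁ : Mono (HomologicalComplex.singleObjXSelf (.up ℤ) 0 X).hom := inferInstance
    have h₂ := mono_comp (R.ι.f 0) (R.cochainComplexXIso 0 0 rfl).inv
    exact mono_comp' h₁ h₂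
  · refine ⟨fun g h _ => ?_⟩
    exact (HomologicalComplex.isZero_single_obj_X (.up ℤ) 0 X n hn).eq_of_tgt _ _

variable (A) in
/-- The quasi-isomorphism from `A` to its injective resolution. -/
noncomputable def resolι : selfCpx A ⟶ resol A := (injectiveResolution (selfMod A)).ι'

instance : Mono (resolι A) := mono_ι' (injectiveResolution (selfMod A))

instance : QuasiIso (resolι A) :=
  inferInstanceAs (QuasiIso (injectiveResolution (selfMod A)).ι')

lemma dualMap_comp (J : CochainComplex (QCoh Y) ℤ) {K L M : CochainComplex (GrMod A) ℤ}
    (f : K ⟶ L) (g : L ⟶ M) : dualMap J (f ≫ g) = dualMap J g ≫ dualMap J f := by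
  ext n : 1
  change dualMapX J (f ≫ g) n = dualMapX J g n ≫ dualMapX J f n
  refine Pi.hom_ext _ _ fun x => ?_
  simp [dualMapX, homQMap_comp]

lemma isZero_of_isZeroInWeight (K : DerivedCategory (GrMod A)) (h : ∀ i, IsZeroInWeight i K) :
    IsZero K := by
  rw [isZero_iff_homology]
  intro n
  rw [isZero_iff_cell]
  exact fun X => (isZero_iff_cell _).1 (h X.i n) ⟨X.U, PUnit.unit⟩

-- The cokernel of a monic quasi-isomorphism is acyclic, so its dual is acyclic in every weight. The
-- dual short exact sequence then shows that the dual map is an isomorphism in the derived category.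
open DerivedCategory in
lemma isIso_Q_map_dualMap [Y.IsSeparated] [CompactSpace Y] {J : CochainComplex (QCoh Y) ℤ}
    (hJ : ∃ m k : ℤ, J.IsStrictlyGE m ∧ J.IsStrictlyLE k) (hJ' : ∀ n, Injective (J.X n))
    {K L : CochainComplex (GrMod A) ℤ} (f : K ⟶ L) [Mono f] [QuasiIso f] :
    IsIso (Q.map (dualMap J f)) := by
  let S := ShortComplex.mk f (cokernel.π f) (cokernel.condition f)
  have hS : S.ShortExact :=
    { exact := ShortComplex.exact_cokernel f
      mono_f := inferInstanceAs (Mono f)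
      epi_g := inferInstanceAs (Epi (cokernel.π f)) }
  have h₃ : IsZero (Q.obj S.X₃) :=
    (Pretriangulated.Triangle.isZero₃_iff_isIso₁ _ (triangleOfSES_distinguished hS)).2
      (inferInstanceAs (IsIso (Q.map f)))
  have h₁ : IsZero (Q.obj (dual J S.X₃)) := isZero_of_isZeroInWeight _ fun i =>
    (isZeroInWeight_iff _ _).2 (AcyclicInWeight.dual hJ hJ' ((isZeroInWeight_iff _ _).1
      fun n => (weight (-i)).map_isZero ((homologyFunctor _ n).map_isZero h₃)))
  exact (Pretriangulated.Triangle.isZero₁_iff_isIso₂ _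
    (triangleOfSES_distinguished (dualShortComplex_shortExact hJ hJ' hS))).1 h₁

end resolution

/-! ### Triangles and quasi-isomorphisms in a given weight -/

section weights
variable {Y : Scheme.{u}} {Λ : Type} [AddCommGroup Λ] [DecidableEq Λ] {A : GradedAlgebra Y Λ}

lemma quasiIsoInWeight_iff (i : Λ) {K L : DerivedCategory (GrMod A)} (φ : K ⟶ L) :
    QuasiIsoInWeight i φ ↔ IsIso ((weight i).mapDerivedCategory.map φ) :=
  (isIso_mapDerivedCategory_map_iff (weight i) φ).symm

lemma isZeroInWeight_iff_isZero (i : Λ) (K : DerivedCategory (GrMod A)) :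
    IsZeroInWeight i K ↔ IsZero ((weight i).mapDerivedCategory.obj K) :=
  (isZero_mapDerivedCategory_obj_iff (weight i) K).symm

lemma IsZeroInWeight.shift {i : Λ} {K : DerivedCategory (GrMod A)} (h : IsZeroInWeight i K)
    (n : ℤ) : IsZeroInWeight i (K⟦n⟧) := by
  rw [isZeroInWeight_iff_isZero] at h ⊢
  exact ((shiftFunctor _ n).map_isZero h).of_iso
    (((weight i).mapDerivedCategory.commShiftIso n).app K)

lemma QuasiIsoInWeight.comp {i : Λ} {K L M : DerivedCategory (GrMod A)} {φ : K ⟶ L} {ψ : L ⟶ M}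
    (hφ : QuasiIsoInWeight i φ) (hψ : QuasiIsoInWeight i ψ) : QuasiIsoInWeight i (φ ≫ ψ) := by
  rw [quasiIsoInWeight_iff] at *
  rw [Functor.map_comp]
  infer_instance

lemma IsZeroInWeight.quasiIsoInWeight {i : Λ} {K L : DerivedCategory (GrMod A)}
    (hK : IsZeroInWeight i K) (hL : IsZeroInWeight i L) (φ : K ⟶ L) : QuasiIsoInWeight i φ := by
  rw [isZeroInWeight_iff_isZero] at hK hL
  rw [quasiIsoInWeight_iff]
  exact hK.isIso hL _

open Pretriangulated

lemma quasiIsoInWeight_mor₁ {i : Λ} {T : Triangle (DerivedCategory (GrMod A))}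
    (hT : T ∈ distTriang _) (h : IsZeroInWeight i T.obj₃) : QuasiIsoInWeight i T.mor₁ := by
  rw [isZeroInWeight_iff_isZero] at h
  rw [quasiIsoInWeight_iff]
  exact (Triangle.isZero₃_iff_isIso₁ _
    ((weight i).mapDerivedCategory.map_distinguished T hT)).1 h

lemma quasiIsoInWeight_mor₂ {i : Λ} {T : Triangle (DerivedCategory (GrMod A))}
    (hT : T ∈ distTriang _) (h : IsZeroInWeight i T.obj₁) : QuasiIsoInWeight i T.mor₂ := by
  rw [isZeroInWeight_iff_isZero] at h
  rw [quasiIsoInWeight_iff]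
  exact (Triangle.isZero₁_iff_isIso₂ _
    ((weight i).mapDerivedCategory.map_distinguished T hT)).1 h

/-- Being exact, the weight `i` functor induces a triangulated functor on derived categories, so the
five lemma for triangles applies. -/
lemma quasiIsoInWeight_hom₃ {i : Λ} {T T' : Triangle (DerivedCategory (GrMod A))}
    (hT : T ∈ distTriang _) (hT' : T' ∈ distTriang _) (φ : T ⟶ T')
    (h₁ : QuasiIsoInWeight i φ.hom₁) (h₂ : QuasiIsoInWeight i φ.hom₂) :
    QuasiIsoInWeight i φ.hom₃ := by
  rw [quasiIsoInWeight_iff] at *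
  exact isIso₃_of_isIso₁₂ ((weight i).mapDerivedCategory.mapTriangle.map φ)
    ((weight i).mapDerivedCategory.map_distinguished T hT)
    ((weight i).mapDerivedCategory.map_distinguished T' hT') h₁ h₂

end weights

/-! ### Compatibility on the injective resolution and the main theorem -/

section flips
variable {Y : Scheme.{u}} [CompactSpace Y] [Y.IsSeparated] (F : HomologicalFlipFlop Y)

open DerivedCategory

lemma comp_assoc₅ {C : Type*} [Category* C] {X₀ X₁ X₂ X₃ X₄ X₅ : C} (f₀ : X₀ ⟶ X₁) (f₁ : X₁ ⟶ X₂)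
    (f₂ : X₂ ⟶ X₃) (f₃ : X₃ ⟶ X₄) (f₄ : X₄ ⟶ X₅) :
    (f₀ ≫ f₁) ≫ f₂ ≫ f₃ ≫ f₄ = f₀ ≫ (f₁ ≫ f₂ ≫ f₃) ≫ f₄ := by
  simp only [Category.assoc]

/-- The compatibility of the two duality maps, on the injective resolution of the algebra. -/
lemma HomologicalFlipFlop.compat_resol :
    Q.map ((twistCpx F.a).map (cokernel.π (RΓι F.A (Set.Ioi 0)))) ≫ F.Φpos ≫
      Q.map (dualMap F.ω (cokernel.π (RΓι F.A (Set.Ioi 0)))) =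
    Q.map ((twistCpx F.a).map (cokernel.π (RΓι F.A (Set.Iio 0)))) ≫ F.Φneg ≫
      Q.map (dualMap F.ω (cokernel.π (RΓι F.A (Set.Iio 0)))) := by
  have h₁ : IsIso (Q.map (dualMap F.ω (resolι F.A))) :=
    isIso_Q_map_dualMap F.isDualizing.bounded F.isDualizing.injective (resolι F.A)
  have h₂ : IsIso (Q.map ((twistCpx F.a).map (resolι F.A))) := inferInstance
  -- Since `eta` is `resolι` followed by the projection, each side of the compatibility is the
  -- desired composite placed between two fixed maps. Both of these are isomorphisms in the derived
  -- category and can be cancelled.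
  have h (S : Set ℤ) (φ : Q.obj ((twistCpx F.a).obj (cech F.A S)) ⟶ Q.obj (dual F.ω (cech F.A S))) :
      Q.map ((twistCpx F.a).map (eta F.A S)) ≫ φ ≫ Q.map (dualMap F.ω (eta F.A S)) =
        Q.map ((twistCpx F.a).map (resolι F.A)) ≫
          (Q.map ((twistCpx F.a).map (cokernel.π (RΓι F.A S))) ≫ φ ≫
            Q.map (dualMap F.ω (cokernel.π (RΓι F.A S)))) ≫ Q.map (dualMap F.ω (resolι F.A)) := by
    have e : Q.map ((twistCpx F.a).map (eta F.A S)) = _ :=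
      (congrArg Q.map ((twistCpx F.a).map_comp (resolι F.A) (cokernel.π (RΓι F.A S)))).trans
        (Q.map_comp _ _)
    have e' : Q.map (dualMap F.ω (eta F.A S)) = _ :=
      (congrArg Q.map (dualMap_comp F.ω (resolι F.A) (cokernel.π (RΓι F.A S)))).trans
        (Q.map_comp _ _)
    exact (congrArg₂ (fun s t => s ≫ φ ≫ t) e e').trans (comp_assoc₅ _ _ _ _ _)
  have e := F.compat
  rw [h, h] at e
  exact (cancel_mono (Q.map (dualMap F.ω (resolι F.A)))).1
    ((cancel_epi (Q.map ((twistCpx F.a).map (resolι F.A)))).1 e)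

end flips

end HFF

theorem theorem5p5 {Y : Scheme.{u}} [AlgebraicGeometry.IsNoetherian Y] [Y.IsSeparated]
    (F : HFF.HomologicalFlipFlop Y) :
    ∃ Ψ : (DerivedCategory.Q.obj
          ((HFF.twistCpx F.a).obj (HFF.RΓ F.A (Set.Ioi 0))))⟦(1 : ℤ)⟧ ⟶
        DerivedCategory.Q.obj (HFF.dual F.ω (HFF.RΓ F.A (Set.Iio 0))),
      ∀ cpos cneg : ℤ,
        (∀ i : ℤ, cpos ≤ i →
          HFF.IsZeroInWeight i (DerivedCategory.Q.obj (HFF.RΓ F.A (Set.Ioi 0)))) →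
        (∀ i : ℤ, i ≤ cneg →
          HFF.IsZeroInWeight i (DerivedCategory.Q.obj (HFF.RΓ F.A (Set.Iio 0)))) →
        ∀ i : ℤ, (max (-cneg) (cpos - F.a) ≤ i ∨ i ≤ min (-cpos) (cneg - F.a)) →
          HFF.QuasiIsoInWeight i Ψ := by
  have hb := F.isDualizing.bounded
  have hi := F.isDualizing.injective
  have htw (S : Set ℤ) := DerivedCategory.triangleOfSES_distinguished
    (HFF.shortExact_map_twistCpx F.a (HFF.localCohomologySequence_shortExact (A := F.A) S))
  have hdual (S : Set ℤ) := DerivedCategory.triangleOfSES_distinguished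
    (HFF.dualShortComplex_shortExact hb hi (HFF.localCohomologySequence_shortExact (A := F.A) S))
  have hT := Pretriangulated.rot_of_distTriang _ (htw (Set.Ioi 0))
  -- The map on first terms passes through the Čech complex of `I^-`, the map on second terms
  -- through that of `I^+`; their compatibility is `F.compat_resol`.
  obtain ⟨Ψ, h₁, h₂⟩ := Pretriangulated.complete_distinguished_triangle_morphism _ _ hT (hdual (Set.Iio 0))
    (DerivedCategory.Q.map ((HFF.twistCpx F.a).map (cokernel.π (HFF.RΓι F.A (Set.Iio 0)))) ≫ F.Φneg)
    (F.Φpos ≫ DerivedCategory.Q.map (HFF.dualMap F.ω (cokernel.π (HFF.RΓι F.A (Set.Ioi 0)))))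
    (F.compat_resol.trans (Category.assoc _ _ _).symm)
  refine ⟨Ψ, fun cpos cneg hpos hneg i hi' => ?_⟩
  have htwist (S : Set ℤ) (h : HFF.IsZeroInWeight (i + F.a) (DerivedCategory.Q.obj (HFF.RΓ F.A S))) :
      HFF.IsZeroInWeight i (DerivedCategory.Q.obj ((HFF.twistCpx F.a).obj (HFF.RΓ F.A S))) :=
    (HFF.isZeroInWeight_iff _ _).2 ((HFF.isZeroInWeight_iff _ _).1 h).twist
  have hdual' (S : Set ℤ) (h : HFF.IsZeroInWeight (-i) (DerivedCategory.Q.obj (HFF.RΓ F.A S))) :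
      HFF.IsZeroInWeight i (DerivedCategory.Q.obj (HFF.dual F.ω (HFF.RΓ F.A S))) :=
    (HFF.isZeroInWeight_iff _ _).2 (((HFF.isZeroInWeight_iff _ _).1 h).dual hb hi)
  obtain h | h := hi'
  · rw [max_le_iff] at h
    -- Here `i + a ≥ c^+` and `-i ≤ c^-`, so the source and the target of `Ψ` both vanish in weight
    -- `i`.
    exact ((htwist _ (hpos _ (by omega))).shift 1).quasiIsoInWeight
      (hdual' _ (hneg _ (by omega))) Ψ
  · rw [le_min_iff] at h
    -- Here `i + a ≤ c^-` and `-i ≥ c^+`. Thus `RΓ_{I^-}(A)(a)` and the dual of `RΓ_{I^+}(A)` vanish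
    -- in weight `i`, which makes the first two components quasi-isomorphisms in that weight.
    refine HFF.quasiIsoInWeight_hom₃ hT (hdual (Set.Iio 0)) (Pretriangulated.Triangle.homMk _ _ _ _ Ψ
      (F.compat_resol.trans (Category.assoc _ _ _).symm) h₁ h₂) ?_ ?_
    · exact HFF.QuasiIsoInWeight.comp
        (HFF.quasiIsoInWeight_mor₂ (htw (Set.Iio 0)) (htwist _ (hneg _ (by omega)))) (F.quasiIso_neg i)
    · exact (F.quasiIso_pos i).comp
        (HFF.quasiIsoInWeight_mor₁ (hdual (Set.Ioi 0)) (hdual' _ (hpos _ (by omega))))
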